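/- Let $R$ be a commutative ring in which $2$ is invertible (for example $R=\mathbb{Q}$). Let $Cob_{/l}$ be the graded $R$-linear category whose objects are finite collections of circles $S$ with a grading shift, $S\{m\}$ ($m\in\mathbb{Z}$), and whose morphisms are the $R$-linear combinations of compact orientable (abstract) cobordisms, up to homeomorphism relative to the boundary, modulo the local relations S (a sphere is $0$), T (a torus is $2$) and 4TU ($C_{12}+C_{34}=C_{13}+C_{24}$, where $C_{ij}$ is obtained from a surface $C$ with four marked disks by replacing the $i$-th and $j$-th disk by a tube); a cobordism $C$ from $S\{m\}$ to $S'\{m'\}$ has degree $\chi(C)+m'-m$. Let $\operatorname{Mat}(Cob_{/l})$ be its category of columns and matrices. Let $T$ be the 2-handle operator, acting on $\emptyset$ as one half of the closed connected surface of genus $3$; it has degree $-4$. Put $t=T/4$. A boxed disk is one half of a disk with a handle. 1. (Delooping.) In $\operatorname{Mat}(Cob_{/l})$ the circle is isomorphic to the column $[\emptyset\{-1\},\emptyset\{+1\}]$. The isomorphism from the circle has entries (disk, boxed disk), its inverse has entries (boxed disk, disk), and both have degree $0$. In the same way every finite collection $S$ of circles is isomorphic, in degree $0$, to a column of $2^{|S|}$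 shifted empty sets, indexed by the maps $S\to\{v_-,v_+\}$, where $v_\pm$ contributes the shift $\pm1$. 2. The functor from finitely generated free $R[T]$-modules with a basis labelled by integers to $\operatorname{Mat}(Cob_{/l})$, which sends a basis element labelled $m$ to $\emptyset\{m\}$ and a matrix over $R[T]$ to the matrix obtained by substituting the 2-handle operator for $T$, is fully faithful. 3. For every diagram $D$ of an oriented link with $n_+$ positive and $n_-$ negative crossings, the cube of resolutions, with the smoothings $\varepsilon\in\{0,1\}^n$ of height $|\varepsilon|=r+n_-$ placed in homological degree $r$ with the shift $\{r+n_+-n_-\}$, is a complex in $\operatorname{Mat}(Cob_{/l})$. Delooping all circles is an isomorphism of complexes, of degree $0$ in both directions, from it to the image under the functor in 2 of a complex of finitely generated free $R[T]$-modules. In homological degree $r$ the latter has the basis of all pairs of a smoothing $\varepsilon$ with $|\varepsilon|=r+n_-$ and a map $s$ from the circles of $\varepsilon$ to $\{v_-,v_+\}$, labelled by $r+n_+-n_-$ plus the sum of the signs of $s$. The entries of the matrices of its differentials are monomials in $T$: each entry is $0$ or of the form $z\,t^k$ with $z\in\mathbb{Z}$, $k\ge 0$, where the label of the target basis element is that of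 the source basis element plus $4k$. 4. (Generalized Lee "pre-TQFT".) Under delooping, where $v_\pm$ is the copy of $\emptyset\{\pm1\}$ and $\otimes$ denotes disjoint union, the two pairs of pants $\bigcirc\to\bigcirc\bigcirc$ and $\bigcirc\bigcirc\to\bigcirc$ become the matrices $$\Delta_2:\quad v_+\mapsto v_+\otimes v_-+v_-\otimes v_+,\qquad v_-\mapsto v_-\otimes v_-+t\,v_+\otimes v_+,$$ $$m_2:\quad v_+\otimes v_+\mapsto v_+,\quad v_+\otimes v_-\mapsto v_-,\quad v_-\otimes v_+\mapsto v_-,\quad v_-\otimes v_-\mapsto t\,v_+ .$$ -/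

import Mathlib

open CategoryTheory
open scoped Polynomial
universe u

namespace CobL

/-! ### Gluing along circles: bookkeeping of components and genera -/

section Tubing

open scoped Classical in
/-- The sum of `w` over the fibre of `q` above `c`. -/
noncomputable def fiberSum {A V Q : Type} [AddCommMonoid A] [Fintype V] (q : V → Q) (w : V → A)
    (c : Q) : A :=
  ∑ v, if q v = c then w v else 0

theorem fiberSum_eq {A V Q : Type} [AddCommMonoid A] [Fintype V] [DecidableEq Q] (q : V → Q)
    (w : V → A) (c : Q) : fiberSum q w c = ∑ v, if q v = c then w v else 0 := by
  unfold fiberSum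
  refine Finset.sum_congr rfl fun v _ => ?_
  congr

/-- `w' : Q → ℤ` arises from `w : V → ℤ` by joining, for every `m : M`, the components `f m` and
`g m` along a circle. Here `w v` stands for `1 - genus` of the component `v`. -/
structure IsTubing {V Q M : Type} [Fintype V] [Fintype M] (w : V → ℤ) (f g : M → V)
    (w' : Q → ℤ) (q : V → Q) : Prop where
  surj : Function.Surjective q
  ker : ∀ v v', q v = q v' ↔ Relation.EqvGen (fun a b => ∃ m, f m = a ∧ g m = b) v v'
  euler : ∀ c, w' c = fiberSum q w c - fiberSum (q ∘ f) (fun _ => 1) c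

theorem IsTubing.glue {V Q M : Type} [Fintype V] [Fintype M] {w : V → ℤ} {f g : M → V}
    {w' : Q → ℤ} {q : V → Q} (h : IsTubing w f g w' q) (m : M) : q (f m) = q (g m) :=
  (h.ker _ _).2 (.rel _ _ ⟨m, rfl, rfl⟩)

theorem IsTubing.unique {V Q Q' M : Type} [Fintype V] [Fintype M] {w : V → ℤ} {f g : M → V}
    {w' : Q → ℤ} {q : V → Q} {w'' : Q' → ℤ} {q' : V → Q'}
    (h : IsTubing w f g w' q) (h' : IsTubing w f g w'' q') :
    ∃ e : Q ≃ Q', (∀ v, e (q v) = q' v) ∧ ∀ c, w'' (e c) = w' c := by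
  classical
  have key : ∀ v v', q v = q v' ↔ q' v = q' v' := fun v v' => by rw [h.ker, h'.ker]
  choose s hs using h.surj
  choose s' hs' using h'.surj
  have e1 : ∀ v, q' (s (q v)) = q' v := fun v => (key _ _).1 (hs _)
  have e2 : ∀ v, q (s' (q' v)) = q v := fun v => (key _ _).2 (hs' _)
  refine ⟨⟨fun c => q' (s c), fun c => q (s' c), fun c => ?_, fun c => ?_⟩, e1, fun c => ?_⟩
  · exact (e2 _).trans (hs _)
  · exact (e1 _).trans (hs' _)
  · obtain ⟨v, rfl⟩ := h.surj c
    change w'' (q' (s (q v))) = _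
    rw [e1, h.euler, h'.euler]
    simp only [fiberSum_eq, Function.comp_apply, key]

theorem fiberSum_fiberSum {K Q P : Type} [Fintype K] [Fintype Q] (k : K → Q) (p : Q → P)
    (z : K → ℤ) (c : P) : fiberSum p (fiberSum k z) c = fiberSum (p ∘ k) z c := by
  classical
  simp only [fiberSum_eq, Function.comp_apply]
  have : ∀ x : Q, (if p x = c then ∑ v, (if k v = x then z v else 0) else 0)
      = ∑ v, if k v = x then (if p (k v) = c then z v else 0) else 0 := by
    intro x
    split_ifs with hx
    · refine Finset.sum_congr rfl fun v _ => ?_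
      by_cases h2 : k v = x
      · subst h2; simp [hx]
      · simp [h2]
    · symm
      refine Finset.sum_eq_zero fun v _ => ?_
      by_cases h2 : k v = x
      · subst h2; simp [hx]
      · simp [h2]
  simp only [this]
  rw [Finset.sum_comm]
  simp

theorem fiberSum_sub {V Q : Type} [Fintype V] (q : V → Q) (w z : V → ℤ) (c : Q) :
    fiberSum q (fun v => w v - z v) c = fiberSum q w c - fiberSum q z c := by
  classical
  simp only [fiberSum_eq]
  rw [← Finset.sum_sub_distrib]
  refine Finset.sum_congr rfl fun x _ => ?_
  split_ifs <;> simp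

theorem fiberSum_sum {V U Q : Type} [Fintype V] [Fintype U] (q : V ⊕ U → Q) (w : V ⊕ U → ℤ)
    (c : Q) : fiberSum q w c =
      fiberSum (q ∘ Sum.inl) (w ∘ Sum.inl) c + fiberSum (q ∘ Sum.inr) (w ∘ Sum.inr) c := by
  classical
  simp [fiberSum_eq, Fintype.sum_sum_type]

theorem fiberSum_equiv {V V' Q : Type} [Fintype V] [Fintype V'] (e : V' ≃ V) (q : V → Q)
    (w : V → ℤ) (c : Q) : fiberSum (q ∘ e) (w ∘ e) c = fiberSum q w c := by
  classical
  simp only [fiberSum_eq, Function.comp_apply]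
  exact e.sum_comp (fun v => if q v = c then w v else 0)

theorem IsTubing.trans {V Q P M N : Type} [Fintype V] [Fintype Q] [Fintype M] [Fintype N] {w : V → ℤ} {f g : M → V} {w' : Q → ℤ} {q : V → Q}
    {f' g' : N → V} {w'' : P → ℤ} {p : Q → P}
    (h : IsTubing w f g w' q) (h' : IsTubing w' (q ∘ f') (q ∘ g') w'' p) :
    IsTubing w (Sum.elim f f') (Sum.elim g g') w'' (p ∘ q) where
  surj := h'.surj.comp h.surj
  ker v v' := by
    constructor
    · intro hv
      have h1 := (h'.ker _ _).1 hv
      have : ∀ a b, Relation.EqvGen (fun a b => ∃ m, (q ∘ f') m = a ∧ (q ∘ g') m = b) a b →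
          ∀ x y, q x = a → q y = b → Relation.EqvGen
            (fun a b => ∃ m, Sum.elim f f' m = a ∧ Sum.elim g g' m = b) x y := by
        have lift : ∀ x y, q x = q y → Relation.EqvGen
            (fun a b => ∃ m, Sum.elim f f' m = a ∧ Sum.elim g g' m = b) x y := by
          intro x y hxy
          refine Relation.EqvGen.mono ?_ _ _ ((h.ker _ _).1 hxy)
          rintro a b ⟨m, rfl, rfl⟩
          exact ⟨.inl m, rfl, rfl⟩
        intro a b hab
        induction hab with
        | rel a b hr =>
          obtain ⟨m, rfl, rfl⟩ := hr
          intro x y hx hy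
          exact (lift _ _ hx).trans _ _ _
            ((Relation.EqvGen.rel _ _ ⟨.inr m, rfl, rfl⟩).trans _ _ _ (lift _ _ hy.symm))
        | refl a => intro x y hx hy; exact lift _ _ (hx.trans hy.symm)
        | symm a b _ ih => intro x y hx hy; exact (ih y x hy hx).symm
        | trans a b c _ _ ih1 ih2 =>
          intro x y hx hy
          obtain ⟨z, rfl⟩ := h.surj b
          exact (ih1 x z hx rfl).trans _ _ _ (ih2 z y rfl hy)
      exact this _ _ h1 _ _ rfl rfl
    · intro hv
      induction hv with
      | rel a b hr =>
        obtain ⟨m | m, rfl, rfl⟩ := hr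
        · exact congrArg p (h.glue m)
        · exact h'.glue m
      | refl => rfl
      | symm _ _ _ ih => exact ih.symm
      | trans _ _ _ _ _ ih1 ih2 => exact ih1.trans ih2
  euler c := by
    have h1 : w' = fun x => fiberSum q w x - fiberSum (q ∘ f) (fun _ => 1) x :=
      funext h.euler
    rw [h'.euler, h1, fiberSum_sub, fiberSum_fiberSum, fiberSum_fiberSum, fiberSum_sum]
    have e1 : ((p ∘ q) ∘ Sum.elim f f') ∘ Sum.inl = p ∘ q ∘ f := rfl
    have e2 : ((p ∘ q) ∘ Sum.elim f f') ∘ Sum.inr = p ∘ q ∘ f' := rfl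
    rw [e1, e2, sub_sub]
    rfl

theorem IsTubing.reindex {V V' Q M M' : Type} [Fintype V] [Fintype M] [Fintype V'] [Fintype M']
    {w : V → ℤ} {f g : M → V} {w' : Q → ℤ} {q : V → Q}
    (h : IsTubing w f g w' q) (e : V' ≃ V) (d : M' ≃ M)
    {w₁ : V' → ℤ} {f₁ g₁ : M' → V'} {q₁ : V' → Q}
    (hw : ∀ v, w₁ v = w (e v)) (hf : ∀ m, e (f₁ m) = f (d m)) (hg : ∀ m, e (g₁ m) = g (d m))
    (hq : ∀ v, q₁ v = q (e v)) : IsTubing w₁ f₁ g₁ w' q₁ where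
  surj c := by
    obtain ⟨v, rfl⟩ := h.surj c
    exact ⟨e.symm v, by simp [hq]⟩
  ker v v' := by
    rw [hq, hq, h.ker]
    constructor
    · have : ∀ a b, Relation.EqvGen (fun a b => ∃ m, f m = a ∧ g m = b) a b →
          Relation.EqvGen (fun a b => ∃ m, f₁ m = a ∧ g₁ m = b) (e.symm a) (e.symm b) := by
        intro a b hab
        induction hab with
        | rel a b hr =>
          obtain ⟨m, rfl, rfl⟩ := hr
          refine .rel _ _ ⟨d.symm m, ?_, ?_⟩
          · rw [Equiv.eq_symm_apply, hf, d.apply_symm_apply]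
          · rw [Equiv.eq_symm_apply, hg, d.apply_symm_apply]
        | refl a => exact .refl _
        | symm a b _ ih => exact ih.symm
        | trans a b c _ _ ih1 ih2 => exact ih1.trans _ _ _ ih2
      intro hv
      simpa using this _ _ hv
    · intro hv
      induction hv with
      | rel a b hr =>
        obtain ⟨m, rfl, rfl⟩ := hr
        exact .rel _ _ ⟨d m, (hf m).symm, (hg m).symm⟩
      | refl a => exact .refl _
      | symm a b _ ih => exact ih.symm
      | trans a b c _ _ ih1 ih2 => exact ih1.trans _ _ _ ih2
  euler c := by
    have e1 : q₁ = q ∘ e := funext hq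
    have e2 : w₁ = w ∘ e := funext hw
    have e3 : q₁ ∘ f₁ = (q ∘ f) ∘ d := funext fun m => by simp [hq, hf]
    rw [h.euler, e3, e1, e2, fiberSum_equiv]
    congr 1
    exact (fiberSum_equiv d (q ∘ f) (fun _ => 1) c).symm

theorem IsTubing.sumRight {V U Q M : Type} [Fintype V] [Fintype M] [Fintype U] {w : V → ℤ} {f g : M → V} {w' : Q → ℤ}
    {q : V → Q} (h : IsTubing w f g w' q) (z : U → ℤ) :
    IsTubing (Sum.elim w z) (Sum.inl ∘ f) (Sum.inl ∘ g) (Sum.elim w' z)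
      (Sum.map q (id : U → U)) where
  surj := Sum.map_surjective.2 ⟨h.surj, Function.surjective_id⟩
  ker v v' := by
    constructor
    · intro hv
      rcases v with v | v <;> rcases v' with v' | v' <;> simp at hv
      · have := (h.ker _ _).1 hv
        induction this with
        | rel a b hr =>
          obtain ⟨m, rfl, rfl⟩ := hr
          exact .rel _ _ ⟨m, rfl, rfl⟩
        | refl a => exact .refl _
        | symm a b hab ih => exact (ih ((h.ker _ _).2 hab)).symm
        | trans a b c h1 h2 ih1 ih2 =>
          exact (ih1 ((h.ker _ _).2 h1)).trans _ _ _ (ih2 ((h.ker _ _).2 h2))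
      · subst hv; exact .refl _
    · intro hv
      induction hv with
      | rel a b hr =>
        obtain ⟨m, rfl, rfl⟩ := hr
        exact congrArg Sum.inl (h.glue m)
      | refl => rfl
      | symm _ _ _ ih => exact ih.symm
      | trans _ _ _ _ _ ih1 ih2 => exact ih1.trans ih2
  euler c := by
    classical
    rcases c with c | c
    · simp [fiberSum_eq, Fintype.sum_sum_type, h.euler]
    · simp [fiberSum_eq, Fintype.sum_sum_type]

/-- The key inequality: a connected graph with `k` vertices has at least `k - 1` edges. -/
theorem card_fiber_le {V M : Type} [Fintype V] [Fintype M] (f g : M → V) (r : V → V → Prop)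
    (hr : r = fun a b => ∃ m, f m = a ∧ g m = b) (c : Quot r) :
    fiberSum (Quot.mk r) (fun _ : V => 1) c ≤
      fiberSum (Quot.mk r ∘ f) (fun _ : M => 1) c + 1 := by
  classical
  let F := {v : V // Quot.mk r v = c}
  let G : SimpleGraph F := SimpleGraph.fromRel (fun a b => r a.1 b.1)
  have reach : ∀ a b, Relation.EqvGen r a b → ∀ (ha : Quot.mk r a = c) (hb : Quot.mk r b = c),
      G.Reachable ⟨a, ha⟩ ⟨b, hb⟩ := by
    intro a b hab
    induction hab with
    | rel a b h =>
      intro ha hb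
      by_cases hne : a = b
      · subst hne; exact .refl _
      · refine SimpleGraph.Adj.reachable ?_
        rw [SimpleGraph.fromRel_adj]
        exact ⟨fun h' => hne (congrArg Subtype.val h'), Or.inl h⟩
    | refl a => intro ha hb; exact .refl _
    | symm a b _ ih => intro ha hb; exact (ih hb ha).symm
    | trans a b d h1 _ ih1 ih2 =>
      intro ha hd
      have hb : Quot.mk r b = c := (Quot.eqvGen_sound h1).symm.trans ha
      exact (ih1 ha hb).trans (ih2 hb hd)
  obtain ⟨v₀, hv₀⟩ := Quot.exists_rep c
  have hconn : G.Connected := by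
    have : Nonempty F := ⟨⟨v₀, hv₀⟩⟩
    refine ⟨fun a b => ?_⟩
    exact reach _ _ (Quot.eqvGen_exact (a.2.trans b.2.symm)) a.2 b.2
  have h1 := hconn.card_vert_le_card_edgeSet_add_one
  let H := {m : M // Quot.mk r (f m) = c}
  have hedge : ∀ e : G.edgeSet, ∃ m : H, ∃ (hb : Quot.mk r (g m.1) = c),
      e.1 = s(⟨f m.1, m.2⟩, ⟨g m.1, hb⟩) := by
    rintro ⟨e, he⟩
    induction e with
    | _ a b =>
      rw [SimpleGraph.mem_edgeSet, SimpleGraph.fromRel_adj] at he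
      simp only [hr] at he
      rcases he.2 with ⟨m, h1, h2⟩ | ⟨m, h1, h2⟩
      · exact ⟨⟨m, by rw [h1]; exact a.2⟩, by rw [h2]; exact b.2, by simp [h1, h2]⟩
      · exact ⟨⟨m, by rw [h1]; exact b.2⟩, by rw [h2]; exact a.2, by simp [h1, h2, Sym2.eq_swap]⟩
  choose φ hb hφ using hedge
  have hinj : Function.Injective φ := by
    intro e e' h
    apply Subtype.ext
    rw [hφ e, hφ e']
    have key : ∀ (m m' : H) (h : m = m') (hb : Quot.mk r (g m.1) = c) (hb' : Quot.mk r (g m'.1) = c),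
        (s(⟨f m.1, m.2⟩, ⟨g m.1, hb⟩) : Sym2 F) = s(⟨f m'.1, m'.2⟩, ⟨g m'.1, hb'⟩) := by
      rintro m _ rfl _ _; rfl
    exact key _ _ h _ _
  have h2 : Nat.card G.edgeSet ≤ Nat.card H := Nat.card_le_card_of_injective φ hinj
  have h3 : Nat.card F = fiberSum (Quot.mk r) (fun _ : V => 1) c := by
    rw [fiberSum_eq, Nat.card_eq_fintype_card, Fintype.card_subtype, Finset.card_filter]
  have h4 : Nat.card H = fiberSum (Quot.mk r ∘ f) (fun _ : M => 1) c := by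
    rw [fiberSum_eq, Nat.card_eq_fintype_card, Fintype.card_subtype, Finset.card_filter]
    simp only [Function.comp_apply]
  rw [← h3, ← h4]
  omega

end Tubing
theorem IsTubing.swap {V Q M : Type} [Fintype V] [Fintype M] {w : V → ℤ} {f g : M → V}
    {w' : Q → ℤ} {q : V → Q} (h : IsTubing w f g w' q) : IsTubing w g f w' q where
  surj := h.surj
  ker v v' := by
    rw [h.ker]
    constructor
    all_goals
      intro hv
      induction hv with
      | rel _ _ h => obtain ⟨m, rfl, rfl⟩ := h; exact (Relation.EqvGen.rel _ _ ⟨m, rfl, rfl⟩).symm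
      | refl => exact .refl _
      | symm _ _ _ ih => exact ih.symm
      | trans _ _ _ _ _ h1 h2 => exact h1.trans _ _ _ h2
  euler c := by
    have : q ∘ g = q ∘ f := funext fun m => (h.glue m).symm
    rw [h.euler, this]

/-! ### Surfaces -/

/-- A compact orientable surface whose boundary circles are labelled by `X`, recorded by its
connected components, the component on which each boundary circle lies, and the genus of each
component. By the classification of surfaces these data determine the surface up to
homeomorphism relative to its boundary (orientations being fixed on the boundary circles). -/
structure Surface (X : Type) where
  comp : Type
  [fin : Fintype comp]
  bdry : X → comp
  genus : comp → ℕ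

attribute [instance] Surface.fin

namespace Surface

variable {X S S₁ S₂ S₃ : Type}

/-- Two surfaces are homeomorphic relative to their boundary if there is a bijection between their
components which respects the boundary circles and the genera. -/
def Homeo (A B : Surface X) : Prop :=
  ∃ e : A.comp ≃ B.comp, (∀ x, e (A.bdry x) = B.bdry x) ∧ ∀ v, B.genus (e v) = A.genus v

/-- Half of the Euler characteristic of the closed surface obtained by capping off `v`. -/
def weight (A : Surface X) (v : A.comp) : ℤ := 1 - A.genus v

/-- The Euler characteristic. -/
def eulerChar [Fintype X] (A : Surface X) : ℤ :=
  ∑ v, (2 - 2 * (A.genus v : ℤ)) - Fintype.card X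

/-- Join the components `f m` and `g m` by a tube for every `m : M`. On a component `c` of the new
surface, which is put together from `k` old components using `l` tubes, the genus is the sum of
the old genera plus the first Betti number `l + 1 - k` of the graph of old components and tubes. -/
noncomputable def tubes {M : Type} [Fintype M] (A : Surface X) (f g : M → A.comp) : Surface X where
  comp := Quot (fun a b => ∃ m, f m = a ∧ g m = b)
  fin := Fintype.ofFinite _
  bdry x := Quot.mk _ (A.bdry x)
  genus c := fiberSum (Quot.mk _) A.genus c + (fiberSum (Quot.mk _ ∘ f) (fun _ => 1) c + 1)
    - fiberSum (Quot.mk _) (fun _ => 1) c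

/-- Join the components `v` and `v'` by a tube (add a handle if they coincide). -/
noncomputable def tube (A : Surface X) (v v' : A.comp) : Surface X :=
  A.tubes (M := Unit) (fun _ => v) (fun _ => v')

/-- Disjoint union with a closed connected surface of genus `g`. -/
def addClosed (A : Surface X) (g : ℕ) : Surface X where
  comp := A.comp ⊕ Unit
  bdry := Sum.inl ∘ A.bdry
  genus := Sum.elim A.genus (fun _ => g)

/-- Disjoint union of a surface between `S` and `S₁` and a surface between `S₁` and `S₂`, where
the circles in `S₁` are forgotten (capped off). -/
def pile (A : Surface (S ⊕ S₁)) (B : Surface (S₁ ⊕ S₂)) : Surface (S ⊕ S₂) where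
  comp := A.comp ⊕ B.comp
  bdry := Sum.elim (Sum.inl ∘ A.bdry ∘ Sum.inl) (Sum.inr ∘ B.bdry ∘ Sum.inr)
  genus := Sum.elim A.genus B.genus

/-- Composition of cobordisms: glue along the circles in `S₁`. -/
noncomputable def stack [Fintype S₁] (A : Surface (S ⊕ S₁)) (B : Surface (S₁ ⊕ S₂)) :
    Surface (S ⊕ S₂) :=
  (pile A B).tubes (M := S₁) (Sum.inl ∘ A.bdry ∘ Sum.inr) (Sum.inr ∘ B.bdry ∘ Sum.inl)

/-- The identity cobordism: a cylinder over each circle. -/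
def cylinders (S : Type) [Fintype S] : Surface (S ⊕ S) where
  comp := S
  bdry := Sum.elim id id
  genus := fun _ => 0

theorem tubes_euler {V M : Type} [Fintype V] [Fintype M] (w : V → ℕ) (f g : M → V)
    (r : V → V → Prop) (hr : r = fun a b => ∃ m, f m = a ∧ g m = b) (c : Quot r) :
    (1 : ℤ) - (fiberSum (Quot.mk r) w c + (fiberSum (Quot.mk r ∘ f) (fun _ => 1) c + 1)
      - fiberSum (Quot.mk r) (fun _ => 1) c : ℕ) =
    fiberSum (Quot.mk r) (fun v => (1 : ℤ) - w v) c
      - fiberSum (Quot.mk r ∘ f) (fun _ => 1) c := by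
  classical
  have h := card_fiber_le f g r hr c
  rw [Nat.cast_sub (by omega), fiberSum_sub]
  simp only [fiberSum_eq]
  push_cast
  ring

theorem tubes_isTubing {M : Type} [Fintype M] (A : Surface X) (f g : M → A.comp) :
    IsTubing A.weight f g (A.tubes f g).weight (Quot.mk _) where
  surj := Quot.exists_rep
  ker _ _ := ⟨Quot.eqvGen_exact, Quot.eqvGen_sound⟩
  euler c := tubes_euler A.genus f g _ rfl c

theorem Homeo.of_isTubing {V M : Type} [Fintype V] [Fintype M] {A B : Surface X} {w : V → ℤ}
    {f g : M → V} {q : V → A.comp} {q' : V → B.comp} (h : IsTubing w f g A.weight q)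
    (h' : IsTubing w f g B.weight q') (b : X → V) (hA : ∀ x, A.bdry x = q (b x))
    (hB : ∀ x, B.bdry x = q' (b x)) : Homeo A B := by
  obtain ⟨e, h1, h2⟩ := h.unique h'
  refine ⟨e, fun x => by rw [hA, hB, h1], fun v => ?_⟩
  have := h2 v
  simp only [weight] at this
  omega

theorem Homeo.refl (A : Surface X) : Homeo A A := ⟨Equiv.refl _, fun _ => rfl, fun _ => rfl⟩

theorem Homeo.symm {A B : Surface X} (h : Homeo A B) : Homeo B A := by
  obtain ⟨e, h1, h2⟩ := h
  exact ⟨e.symm, fun x => by rw [Equiv.symm_apply_eq, h1], fun v => by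
    rw [← h2, e.apply_symm_apply]⟩

theorem Homeo.trans {A B C : Surface X} (h : Homeo A B) (h' : Homeo B C) : Homeo A C := by
  obtain ⟨e, h1, h2⟩ := h
  obtain ⟨e', h1', h2'⟩ := h'
  exact ⟨e.trans e', fun x => by simp [h1, h1'], fun v => by simp [h2, h2']⟩

theorem pile_weight (A : Surface (S ⊕ S₁)) (B : Surface (S₁ ⊕ S₂)) :
    (pile A B).weight = Sum.elim A.weight B.weight := by
  funext v
  cases v <;> rfl

theorem stack_isTubing [Fintype S₁] (A : Surface (S ⊕ S₁)) (B : Surface (S₁ ⊕ S₂)) :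
    IsTubing (Sum.elim A.weight B.weight) (Sum.inl ∘ A.bdry ∘ Sum.inr)
      (Sum.inr ∘ B.bdry ∘ Sum.inl) (stack A B).weight (Quot.mk _) := by
  rw [← pile_weight]
  exact tubes_isTubing (pile A B) _ _

theorem stack_assoc [Fintype S₁] [Fintype S₂] (A : Surface (S ⊕ S₁)) (B : Surface (S₁ ⊕ S₂))
    (C : Surface (S₂ ⊕ S₃)) : Homeo (stack (stack A B) C) (stack A (stack B C)) := by
  have hL := ((stack_isTubing A B).sumRight C.weight).trans
    (f' := Sum.inl ∘ Sum.inr ∘ B.bdry ∘ Sum.inr) (g' := Sum.inr ∘ C.bdry ∘ Sum.inl)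
    (stack_isTubing (stack A B) C)
  have hR2 := (stack_isTubing A (stack B C)).reindex (Equiv.sumComm _ _) (Equiv.refl _)
    (w₁ := Sum.elim (stack B C).weight A.weight) (f₁ := Sum.inr ∘ A.bdry ∘ Sum.inr)
    (g₁ := Sum.inl ∘ (stack B C).bdry ∘ Sum.inl) (q₁ := Quot.mk _ ∘ Sum.swap)
    (by rintro (v | v) <;> rfl) (fun _ => rfl) (fun _ => rfl) (fun _ => rfl)
  have hR := ((stack_isTubing B C).sumRight A.weight).trans
    (f' := Sum.inr ∘ A.bdry ∘ Sum.inr) (g' := Sum.inl ∘ Sum.inl ∘ B.bdry ∘ Sum.inl) hR2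
  let e : (A.comp ⊕ B.comp) ⊕ C.comp ≃ (B.comp ⊕ C.comp) ⊕ A.comp :=
    (Equiv.sumAssoc _ _ _).trans (Equiv.sumComm _ _)
  have hR' := hR.reindex e (Equiv.sumComm S₁ S₂)
    (w₁ := Sum.elim (Sum.elim A.weight B.weight) C.weight)
    (f₁ := Sum.elim (Sum.inl ∘ (Sum.inl ∘ A.bdry ∘ Sum.inr))
      (Sum.inl ∘ Sum.inr ∘ B.bdry ∘ Sum.inr))
    (g₁ := Sum.elim (Sum.inl ∘ (Sum.inr ∘ B.bdry ∘ Sum.inl)) (Sum.inr ∘ C.bdry ∘ Sum.inl))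
    (q₁ := _)
    (by rintro ((v | v) | v) <;> rfl) (by rintro (m | m) <;> rfl) (by rintro (m | m) <;> rfl)
    (fun v => rfl)
  exact Homeo.of_isTubing hL hR'
    (Sum.elim (Sum.inl ∘ Sum.inl ∘ A.bdry ∘ Sum.inl) (Sum.inr ∘ C.bdry ∘ Sum.inr))
    (by rintro (x | x) <;> rfl) (by rintro (x | x) <;> rfl)

theorem isTubing_cylinders {V : Type} [Fintype V] [Fintype S] (w : V → ℤ) (φ : S → V) :
    IsTubing (Sum.elim w (fun _ : S => 1)) (Sum.inl ∘ φ) Sum.inr w (Sum.elim id φ) where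
  surj c := ⟨Sum.inl c, rfl⟩
  ker v v' := by
    have h : ∀ v : V ⊕ S, Relation.EqvGen (fun a b => ∃ m, (Sum.inl ∘ φ) m = a ∧ Sum.inr m = b)
        (Sum.inl (Sum.elim id φ v)) v := by
      rintro (v | v)
      · exact .refl _
      · exact .rel _ _ ⟨v, rfl, rfl⟩
    constructor
    · intro hv
      have h1 := (h v).symm
      rw [hv] at h1
      exact h1.trans _ _ _ (h v')
    · intro h
      induction h with
      | rel _ _ h => obtain ⟨m, rfl, rfl⟩ := h; rfl
      | refl => rfl
      | symm _ _ _ ih => exact ih.symm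
      | trans _ _ _ _ _ h1 h2 => exact h1.trans h2
  euler c := by
    classical
    rw [fiberSum_sum]
    have e1 : (Sum.elim id φ : V ⊕ S → V) ∘ Sum.inl = id := rfl
    have e2 : (Sum.elim id φ : V ⊕ S → V) ∘ Sum.inr = φ := rfl
    have e3 : (Sum.elim id φ : V ⊕ S → V) ∘ Sum.inl ∘ φ = φ := rfl
    rw [e1, e2, e3]
    simp only [fiberSum_eq]
    simp

theorem stack_cylinders [Fintype S₁] (A : Surface (S ⊕ S₁)) :
    Homeo (stack A (cylinders S₁)) A := by
  refine Homeo.of_isTubing (stack_isTubing A (cylinders S₁)) (q' := Sum.elim id (A.bdry ∘ Sum.inr))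
    ?_ (Sum.map (A.bdry ∘ Sum.inl) id) ?_ ?_
  · have e : (cylinders S₁).weight = fun _ => 1 := by
      funext s
      simp [weight, cylinders]
    rw [e]
    exact isTubing_cylinders A.weight (A.bdry ∘ Sum.inr)
  · rintro (x | x) <;> rfl
  · rintro (x | x) <;> rfl

theorem cylinders_stack [Fintype S] (A : Surface (S ⊕ S₁)) :
    Homeo (stack (cylinders S) A) A := by
  refine Homeo.of_isTubing (stack_isTubing (cylinders S) A) (q' := Sum.elim (A.bdry ∘ Sum.inl) id)
    ?_ (Sum.map id (A.bdry ∘ Sum.inr)) ?_ ?_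
  · refine (isTubing_cylinders A.weight (A.bdry ∘ Sum.inl)).swap.reindex
      (Equiv.sumComm _ _) (Equiv.refl _) ?_ ?_ ?_ ?_
    · rintro (v | v)
      · simp [weight, cylinders]
      · rfl
    · exact fun _ => rfl
    · exact fun _ => rfl
    · rintro (v | v) <;> rfl
  · rintro (x | x) <;> rfl
  · rintro (x | x) <;> rfl

theorem Homeo.stack [Fintype S₁] {A A' : Surface (S ⊕ S₁)} {B B' : Surface (S₁ ⊕ S₂)}
    (hA : Homeo A A') (hB : Homeo B B') : Homeo (A.stack B) (A'.stack B') := by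
  obtain ⟨e, h1, h2⟩ := hA
  obtain ⟨d, k1, k2⟩ := hB
  refine Homeo.of_isTubing (stack_isTubing A B)
    ((stack_isTubing A' B').reindex (Equiv.sumCongr e d) (Equiv.refl _) ?_ ?_ ?_ (fun _ => rfl))
    (Sum.map (A.bdry ∘ Sum.inl) (B.bdry ∘ Sum.inr)) ?_ ?_
  · rintro (v | v)
    · simp [weight, h2]
    · simp [weight, k2]
  · intro m; simp [h1]
  · intro m; simp [k1]
  · rintro (x | x) <;> rfl
  · rintro (x | x)
    · exact congrArg (Quot.mk _ ∘ Sum.inl) (h1 _).symm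
    · exact congrArg (Quot.mk _ ∘ Sum.inr) (k1 _).symm

theorem tube_isTubing (A : Surface X) (v v' : A.comp) :
    IsTubing A.weight (fun _ : Unit => v) (fun _ => v') (A.tube v v').weight (Quot.mk _) :=
  tubes_isTubing A _ _

/-- Adding a tube commutes with gluing something below. -/
theorem tube_stack [Fintype S₁] (A : Surface (S ⊕ S₁)) (B : Surface (S₁ ⊕ S₂)) (v v' : A.comp) :
    Homeo ((A.tube v v').stack B)
      ((A.stack B).tube (Quot.mk _ (Sum.inl v)) (Quot.mk _ (Sum.inl v'))) := by
  have hL := ((tube_isTubing A v v').sumRight B.weight).trans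
    (f' := Sum.inl ∘ A.bdry ∘ Sum.inr) (g' := Sum.inr ∘ B.bdry ∘ Sum.inl)
    (stack_isTubing (A.tube v v') B)
  have hR := (stack_isTubing A B).trans (f' := fun _ => Sum.inl v) (g' := fun _ => Sum.inl v')
    (tube_isTubing (A.stack B) (Quot.mk _ (Sum.inl v)) (Quot.mk _ (Sum.inl v')))
  refine Homeo.of_isTubing hL (hR.reindex (Equiv.refl _) (Equiv.sumComm _ _)
    (fun _ => rfl) ?_ ?_ (fun _ => rfl)) (Sum.map (A.bdry ∘ Sum.inl) (B.bdry ∘ Sum.inr)) ?_ ?_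
  · rintro (m | m) <;> rfl
  · rintro (m | m) <;> rfl
  · rintro (x | x) <;> rfl
  · rintro (x | x) <;> rfl

/-- Adding a tube commutes with gluing something above. -/
theorem stack_tube [Fintype S₁] (A : Surface (S ⊕ S₁)) (B : Surface (S₁ ⊕ S₂)) (v v' : B.comp) :
    Homeo (A.stack (B.tube v v'))
      ((A.stack B).tube (Quot.mk _ (Sum.inr v)) (Quot.mk _ (Sum.inr v'))) := by
  have h0 := (stack_isTubing A (B.tube v v')).reindex (Equiv.sumComm _ _) (Equiv.refl _)
    (w₁ := Sum.elim (B.tube v v').weight A.weight) (f₁ := Sum.inr ∘ A.bdry ∘ Sum.inr)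
    (g₁ := Sum.inl ∘ (B.tube v v').bdry ∘ Sum.inl) (q₁ := Quot.mk _ ∘ Sum.swap)
    (by rintro (v | v) <;> rfl) (fun _ => rfl) (fun _ => rfl) (fun _ => rfl)
  have hL := ((tube_isTubing B v v').sumRight A.weight).trans
    (f' := Sum.inr ∘ A.bdry ∘ Sum.inr) (g' := Sum.inl ∘ B.bdry ∘ Sum.inl) h0
  have hR := (stack_isTubing A B).trans (f' := fun _ => Sum.inr v) (g' := fun _ => Sum.inr v')
    (tube_isTubing (A.stack B) (Quot.mk _ (Sum.inr v)) (Quot.mk _ (Sum.inr v')))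
  refine Homeo.of_isTubing hL (hR.reindex (Equiv.sumComm _ _) (Equiv.sumComm _ _)
    ?_ ?_ ?_ (fun _ => rfl))
    (Sum.elim (Sum.inr ∘ A.bdry ∘ Sum.inl) (Sum.inl ∘ B.bdry ∘ Sum.inr)) ?_ ?_
  · rintro (v | v) <;> rfl
  · rintro (m | m) <;> rfl
  · rintro (m | m) <;> rfl
  · rintro (x | x) <;> rfl
  · rintro (x | x) <;> rfl

theorem addClosed_weight (A : Surface X) (g : ℕ) :
    (A.addClosed g).weight = Sum.elim A.weight (fun _ => 1 - (g : ℤ)) := by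
  funext v
  cases v <;> rfl

theorem addClosed_stack [Fintype S₁] (A : Surface (S ⊕ S₁)) (B : Surface (S₁ ⊕ S₂)) (g : ℕ) :
    Homeo ((A.addClosed g).stack B) ((A.stack B).addClosed g) := by
  have hL := stack_isTubing (A.addClosed g) B
  have hR := (stack_isTubing A B).sumRight (fun _ : Unit => 1 - (g : ℤ))
  rw [← addClosed_weight] at hR
  let e : (A.comp ⊕ Unit) ⊕ B.comp ≃ (A.comp ⊕ B.comp) ⊕ Unit :=
    (Equiv.sumAssoc _ _ _).trans
      ((Equiv.sumCongr (Equiv.refl _) (Equiv.sumComm _ _)).trans (Equiv.sumAssoc _ _ _).symm)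
  refine Homeo.of_isTubing hL (hR.reindex e (Equiv.refl _) ?_ (fun _ => rfl) (fun _ => rfl)
    (fun _ => rfl)) (Sum.map (Sum.inl ∘ A.bdry ∘ Sum.inl) (B.bdry ∘ Sum.inr)) ?_ ?_
  · rintro ((v | v) | v) <;> rfl
  · rintro (x | x) <;> rfl
  · rintro (x | x) <;> rfl

theorem stack_addClosed [Fintype S₁] (A : Surface (S ⊕ S₁)) (B : Surface (S₁ ⊕ S₂)) (g : ℕ) :
    Homeo (A.stack (B.addClosed g)) ((A.stack B).addClosed g) := by
  have hL := stack_isTubing A (B.addClosed g)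
  have hR := (stack_isTubing A B).sumRight (fun _ : Unit => 1 - (g : ℤ))
  rw [← addClosed_weight] at hR
  refine Homeo.of_isTubing hL (hR.reindex (Equiv.sumAssoc _ _ _).symm (Equiv.refl _) ?_
    (fun _ => rfl) (fun _ => rfl)
    (fun _ => rfl)) (Sum.map (A.bdry ∘ Sum.inl) (Sum.inl ∘ B.bdry ∘ Sum.inr)) ?_ ?_
  · rintro (v | (v | v)) <;> rfl
  · rintro (x | x) <;> rfl
  · rintro (x | x) <;> rfl

end Surface

/-! ### Surfaces modulo the local relations -/

section Skein

variable (R : Type u) [CommRing R]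

/-- The relations imposed on formal linear combinations of surfaces with boundary `X`:
homeomorphic surfaces are identified, a sphere is zero, a torus is two, and the 4TU relation
`C₁₂ + C₃₄ = C₁₃ + C₂₄`, where `Cᵢⱼ` is obtained from a surface `C` with four disks
lying on the components `v₁, …, v₄` (which need not be distinct) by removing the `i`-th and the
`j`-th disk and connecting the two holes by a tube. -/
inductive LocalRel {X : Type} : (Surface X →₀ R) → Prop
  | homeo (A B : Surface X) (h : A.Homeo B) :
      LocalRel (Finsupp.single A 1 - Finsupp.single B 1)
  | sphere (C : Surface X) : LocalRel (Finsupp.single (C.addClosed 0) 1)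
  | torus (C : Surface X) :
      LocalRel (Finsupp.single (C.addClosed 1) 1 - Finsupp.single C 2)
  | fourTube (C : Surface X) (v₁ v₂ v₃ v₄ : C.comp) :
      LocalRel (Finsupp.single (C.tube v₁ v₂) 1 + Finsupp.single (C.tube v₃ v₄) 1
        - (Finsupp.single (C.tube v₁ v₃) 1 + Finsupp.single (C.tube v₂ v₄) 1))

/-- `R`-linear combinations of surfaces with boundary `X` modulo the 4TU, S and T relations. -/
def Skein (X : Type) : Type (max 1 u) :=
  (Surface X →₀ R) ⧸ Submodule.span R {r : Surface X →₀ R | LocalRel R r}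

noncomputable instance (X : Type) : AddCommGroup (Skein R X) :=
  inferInstanceAs (AddCommGroup (_ ⧸ Submodule.span R {r : Surface X →₀ R | LocalRel R r}))

noncomputable instance (X : Type) : Module R (Skein R X) :=
  inferInstanceAs (Module R (_ ⧸ Submodule.span R {r : Surface X →₀ R | LocalRel R r}))

namespace Skein

variable {X S S₁ S₂ S₃ : Type}

/-- The quotient map. -/
noncomputable def proj (X : Type) : (Surface X →₀ R) →ₗ[R] Skein R X :=
  Submodule.mkQ _

/-- The class of a surface. -/
noncomputable def mk (A : Surface X) : Skein R X := proj R X (Finsupp.single A 1)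

theorem proj_single (A : Surface X) (r : R) : proj R X (Finsupp.single A r) = r • mk R A := by
  rw [mk, ← map_smul, Finsupp.smul_single, smul_eq_mul, mul_one]

theorem proj_rel {r : Surface X →₀ R} (h : LocalRel R r) : proj R X r = 0 :=
  (Submodule.Quotient.mk_eq_zero _).2 (Submodule.subset_span h)

theorem mk_homeo {A B : Surface X} (h : A.Homeo B) : mk R A = mk R B := by
  have := proj_rel R (LocalRel.homeo A B h)
  rwa [map_sub, sub_eq_zero] at this

theorem mk_sphere (C : Surface X) : mk R (C.addClosed 0) = 0 := proj_rel R (.sphere C)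

theorem mk_torus (C : Surface X) : mk R (C.addClosed 1) = (2 : R) • mk R C := by
  have := proj_rel R (LocalRel.torus C)
  rwa [map_sub, sub_eq_zero, proj_single R C] at this

theorem mk_fourTube (C : Surface X) (v₁ v₂ v₃ v₄ : C.comp) :
    mk R (C.tube v₁ v₂) + mk R (C.tube v₃ v₄) = mk R (C.tube v₁ v₃) + mk R (C.tube v₂ v₄) := by
  have := proj_rel R (LocalRel.fourTube C v₁ v₂ v₃ v₄)
  rwa [map_sub, sub_eq_zero, map_add, map_add] at this

/-- A linear map out of `Skein R X` is given by its values on surfaces. -/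
noncomputable def lift {N : Type*} [AddCommGroup N] [Module R N] (φ : Surface X → N)
    (homeo : ∀ A B : Surface X, A.Homeo B → φ A = φ B)
    (sphere : ∀ C : Surface X, φ (C.addClosed 0) = 0)
    (torus : ∀ C : Surface X, φ (C.addClosed 1) = (2 : R) • φ C)
    (fourTube : ∀ (C : Surface X) (v₁ v₂ v₃ v₄ : C.comp),
      φ (C.tube v₁ v₂) + φ (C.tube v₃ v₄) = φ (C.tube v₁ v₃) + φ (C.tube v₂ v₄)) :
    Skein R X →ₗ[R] N :=
  Submodule.liftQ _ (Finsupp.linearCombination R φ) (by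
    rw [Submodule.span_le]
    rintro r hr
    rw [SetLike.mem_coe, LinearMap.mem_ker]
    rcases hr with ⟨A, B, h⟩ | ⟨C⟩ | ⟨C⟩ | ⟨C, v₁, v₂, v₃, v₄⟩
    · simp [homeo A B h]
    · simp [sphere]
    · simp [torus]
    · simp [fourTube C v₁ v₂ v₃ v₄])

@[simp]
theorem lift_mk {N : Type*} [AddCommGroup N] [Module R N] (φ : Surface X → N) (h₁ h₂ h₃ h₄)
    (A : Surface X) : lift R φ h₁ h₂ h₃ h₄ (mk R A) = φ A := by
  change Finsupp.linearCombination R φ (Finsupp.single A 1) = φ A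
  simp

variable {R}

theorem hom_ext {N : Type*} [AddCommGroup N] [Module R N] {f g : Skein R X →ₗ[R] N}
    (h : ∀ A, f (mk R A) = g (mk R A)) : f = g := by
  refine Submodule.linearMap_qext _ (Finsupp.lhom_ext' fun A => LinearMap.ext_ring ?_)
  exact h A

variable (R)

/-- Bilinear extension of the composition of cobordisms. -/
noncomputable def glue (S S₁ S₂ : Type) [Fintype S₁] :
    Skein R (S ⊕ S₁) →ₗ[R] Skein R (S₁ ⊕ S₂) →ₗ[R] Skein R (S ⊕ S₂) :=
  lift R (fun A => lift R (fun B => mk R (A.stack B))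
      (fun _ _ h => mk_homeo R ((Surface.Homeo.refl A).stack h))
      (fun C => by rw [mk_homeo R (A.stack_addClosed C 0), mk_sphere])
      (fun C => by rw [mk_homeo R (A.stack_addClosed C 1), mk_torus])
      (fun C v₁ v₂ v₃ v₄ => by
        simp only [mk_homeo R (A.stack_tube C _ _)]
        exact mk_fourTube R _ _ _ _ _))
    (fun A A' h => hom_ext fun B => by
      simp only [lift_mk]
      exact mk_homeo R (h.stack (Surface.Homeo.refl B)))
    (fun C => hom_ext fun B => by
      simp only [lift_mk, LinearMap.zero_apply]
      rw [mk_homeo R (C.addClosed_stack B 0), mk_sphere])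
    (fun C => hom_ext fun B => by
      simp only [lift_mk, LinearMap.smul_apply]
      rw [mk_homeo R (C.addClosed_stack B 1), mk_torus])
    (fun C v₁ v₂ v₃ v₄ => hom_ext fun B => by
      simp only [lift_mk, LinearMap.add_apply, mk_homeo R (C.tube_stack B _ _)]
      exact mk_fourTube R _ _ _ _ _)

@[simp]
theorem glue_mk [Fintype S₁] (A : Surface (S ⊕ S₁)) (B : Surface (S₁ ⊕ S₂)) :
    glue R S S₁ S₂ (mk R A) (mk R B) = mk R (A.stack B) := by
  simp [glue]

end Skein

end Skein

/-! ### The category of cobordisms modulo local relations -/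

/-- The graded category `Cob_{/l}` of abstract cobordisms modulo the local relations, over `R`.
An object: a finite collection of circles together with a grading shift. -/
structure Cob (R : Type u) where
  circles : Type
  [fin : Fintype circles]
  shift : ℤ

attribute [instance] Cob.fin

variable {R : Type u} [CommRing R]

noncomputable instance : Category (Cob R) where
  Hom X Y := Skein R (X.circles ⊕ Y.circles)
  id X := Skein.mk R (Surface.cylinders X.circles)
  comp {X Y Z} f g := Skein.glue R X.circles Y.circles Z.circles f g
  id_comp {X Y} f := by
    have : Skein.glue R X.circles X.circles Y.circles
        (Skein.mk R (Surface.cylinders X.circles)) = LinearMap.id :=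
      Skein.hom_ext fun A => by simpa using Skein.mk_homeo R A.cylinders_stack
    exact LinearMap.congr_fun this f
  comp_id {X Y} f := by
    have : (Skein.glue R X.circles Y.circles Y.circles).flip
        (Skein.mk R (Surface.cylinders Y.circles)) = LinearMap.id :=
      Skein.hom_ext fun A => by simpa using Skein.mk_homeo R A.stack_cylinders
    exact LinearMap.congr_fun this f
  assoc {W X Y Z} f g h := by
    have : ∀ A B, (Skein.glue R W.circles Y.circles Z.circles
        (Skein.glue R W.circles X.circles Y.circles (Skein.mk R A) (Skein.mk R B))) =
        (Skein.glue R W.circles X.circles Z.circles (Skein.mk R A)).comp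
          (Skein.glue R X.circles Y.circles Z.circles (Skein.mk R B)) := fun A B =>
      Skein.hom_ext fun C => by simpa using Skein.mk_homeo R (A.stack_assoc B C)
    have h2 : ∀ A, ((Skein.glue R W.circles Y.circles Z.circles).flip h).comp
        (Skein.glue R W.circles X.circles Y.circles (Skein.mk R A)) =
        (Skein.glue R W.circles X.circles Z.circles (Skein.mk R A)).comp
          ((Skein.glue R X.circles Y.circles Z.circles).flip h) := fun A =>
      Skein.hom_ext fun B => by simpa using LinearMap.congr_fun (this A B) h
    have h3 : ((Skein.glue R W.circles Y.circles Z.circles).flip h).comp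
        ((Skein.glue R W.circles X.circles Y.circles).flip g) =
        (Skein.glue R W.circles X.circles Z.circles).flip
          (Skein.glue R X.circles Y.circles Z.circles g h) :=
      Skein.hom_ext fun A => by simpa using LinearMap.congr_fun (h2 A) g
    exact LinearMap.congr_fun h3 f

noncomputable instance : Preadditive (Cob R) where
  homGroup X Y := inferInstanceAs (AddCommGroup (Skein R (X.circles ⊕ Y.circles)))
  add_comp X Y Z f f' g :=
    LinearMap.map_add₂ (Skein.glue R X.circles Y.circles Z.circles) f f' g
  comp_add X Y Z f g g' :=
    LinearMap.map_add (Skein.glue R X.circles Y.circles Z.circles f) g g'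

noncomputable instance : Linear R (Cob R) where
  homModule X Y := inferInstanceAs (Module R (Skein R (X.circles ⊕ Y.circles)))
  smul_comp X Y Z r f g :=
    LinearMap.map_smul₂ (Skein.glue R X.circles Y.circles Z.circles) r f g
  comp_smul X Y Z f r g :=
    LinearMap.map_smul (Skein.glue R X.circles Y.circles Z.circles f) r g

namespace Cob

/-- The morphism given by a cobordism. -/
noncomputable def ofSurface (X Y : Cob R) (A : Surface (X.circles ⊕ Y.circles)) : X ⟶ Y :=
  Skein.mk R A

/-- The morphisms `X ⟶ Y` of degree `d`: they are spanned by the cobordisms whose Euler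
characteristic plus the difference of the shifts of `Y` and `X` is `d`. -/
noncomputable def homogeneous (X Y : Cob R) (d : ℤ) : Submodule R (X ⟶ Y) :=
  Submodule.span R {f | ∃ A, A.eulerChar + Y.shift - X.shift = d ∧ f = ofSurface X Y A}

/-- The empty set `∅{m}`. -/
def empty (R : Type u) (m : ℤ) : Cob R := ⟨Empty, m⟩

/-- The circle. -/
def circle (R : Type u) : Cob R := ⟨Unit, 0⟩

/-- Two circles. -/
def twoCircles (R : Type u) : Cob R := ⟨Fin 2, 0⟩

end Cob

/-! ### Delooping -/

namespace Cob

/-- A disk of genus `g c` on each circle `c` of `S`, read from `S` to the empty set. -/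
def capSurface {S : Type} [Fintype S] (g : S → ℕ) : Surface (S ⊕ Empty) where
  comp := S
  bdry := Sum.elim id Empty.elim
  genus := g

/-- A disk of genus `g c` on each circle `c` of `S`, read from the empty set to `S`. -/
def cupSurface {S : Type} [Fintype S] (g : S → ℕ) : Surface (Empty ⊕ S) where
  comp := S
  bdry := Sum.elim Empty.elim id
  genus := g

/-- The sign `v₊` (`true`) has degree `1`, the sign `v₋` (`false`) has degree `-1`. -/
def signDeg (b : Bool) : ℤ := if b then 1 else -1

variable [Invertible (2 : R)]

/-- The morphism to `∅{m}` which caps off the circles of `X`; the disk capping off `c` is plain if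
`s c = v₋` and boxed (that is, one half of a disk with a handle) if `s c = v₊`. -/
noncomputable def capOff (X : Cob R) (s : X.circles → Bool) (m : ℤ) : X ⟶ empty R m :=
  (∏ c, if s c then ⅟(2 : R) else 1) •
    ofSurface X (empty R m) (capSurface fun c => if s c then 1 else 0)

/-- The morphism from `∅{m}` which creates the circles of `X`; the disk bounding `c` is boxed if
`s c = v₋` and plain if `s c = v₊`. -/
noncomputable def cupOff (X : Cob R) (s : X.circles → Bool) (m : ℤ) : empty R m ⟶ X :=
  (∏ c, if s c then 1 else ⅟(2 : R)) •
    ofSurface (empty R m) X (cupSurface fun c => if s c then 0 else 1)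

/-- The column `[∅{-1}, ∅{+1}]`, indexed by `false` and `true`. -/
noncomputable def column (R : Type u) [CommRing R] : Mat_ (Cob R) := ⟨Bool, fun b => empty R (signDeg b)⟩

/-- The circle as a column with one entry. -/
noncomputable def circleColumn (R : Type u) [CommRing R] : Mat_ (Cob R) := (Mat_.embedding (Cob R)).obj (circle R)

/-- The column obtained from an object by replacing each circle by `[∅{-1}, ∅{+1}]`; its entries
are indexed by the ways to put `v₋` or `v₊` on each circle. -/
noncomputable def delooped (X : Cob R) : Mat_ (Cob R) :=
  open scoped Classical in
  ⟨X.circles → Bool, fun s => empty R (X.shift + ∑ c, signDeg (s c))⟩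

/-- Delooping all circles of an object. -/
noncomputable def deloopHom (X : Cob R) : (Mat_.embedding (Cob R)).obj X ⟶ delooped X :=
  fun _ s => capOff X s _

/-- The inverse of delooping. -/
noncomputable def deloopInv (X : Cob R) : delooped X ⟶ (Mat_.embedding (Cob R)).obj X :=
  fun s _ => cupOff X s _

/-- All entries of a matrix of morphisms are homogeneous of degree `0`. -/
def IsDegreeZero {M N : Mat_ (Cob R)} (f : M ⟶ N) : Prop :=
  ∀ i j, f i j ∈ homogeneous (M.X i) (N.X j) 0

/-! ### Polynomials in the 2-handle operator -/

/-- The closed connected surface of genus `g`. -/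
def closedSurface (g : ℕ) : Surface (Empty ⊕ Empty) where
  comp := Unit
  bdry := Sum.elim Empty.elim Empty.elim
  genus := fun _ => g

/-- The 2-handle operator `T` in its genus-3 presentation: one half of the closed surface of
genus `3`. -/
noncomputable def twoHandle (R : Type u) [CommRing R] [Invertible (2 : R)] : End (empty R 0) :=
  ⅟(2 : R) • ofSurface (empty R 0) (empty R 0) (closedSurface 3)

/-- The morphism `∅{m} ⟶ ∅{m'}` obtained by substituting the 2-handle operator into a
polynomial. As for all morphisms, it does not depend on the shifts, only its degree does. -/
noncomputable def poly (p : R[X]) (m m' : ℤ) : empty R m ⟶ empty R m' :=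
  (Polynomial.aeval (twoHandle R) p : End (empty R 0))

theorem poly_comp (p q : R[X]) (m m' m'' : ℤ) :
    poly p m m' ≫ poly q m' m'' = poly (p * q) m m'' := by
  have h : (Polynomial.aeval (twoHandle R) (p * q) : End (empty R 0)) =
      Polynomial.aeval (twoHandle R) q * Polynomial.aeval (twoHandle R) p := by
    rw [mul_comm, map_mul]
  exact h.symm

theorem poly_one (m : ℤ) : poly (1 : R[X]) m m = 𝟙 (empty R m) :=
  (map_one (Polynomial.aeval (R := R) (twoHandle R)) :)

theorem poly_add (p q : R[X]) (m m' : ℤ) : poly (p + q) m m' = poly p m m' + poly q m m' :=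
  (map_add (Polynomial.aeval (twoHandle R)) p q :)

theorem poly_zero (m m' : ℤ) : poly (0 : R[X]) m m' = 0 :=
  (map_zero (Polynomial.aeval (R := R) (twoHandle R)) :)

theorem poly_sum {ι : Type} (s : Finset ι) (p : ι → R[X]) (m m' : ℤ) :
    poly (∑ i ∈ s, p i) m m' = ∑ i ∈ s, poly (p i) m m' := by
  classical
  induction s using Finset.induction_on with
  | empty => simp [poly_zero]
  | insert a s ha ih => rw [Finset.sum_insert ha, Finset.sum_insert ha, poly_add, ih]

end Cob

/-- A finite set of basis elements with degrees. -/
structure GradedBasis where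
  ι : Type
  [fin : Fintype ι]
  deg : ι → ℤ

attribute [instance] GradedBasis.fin

/-- The category of finitely generated free `R[T]`-modules `R[T]^ι` with a basis labelled by
degrees: the full subcategory of `R[T]`-modules on these. -/
abbrev FreeMod (R : Type u) [CommRing R] :=
  InducedCategory (ModuleCat.{u} R[X])
    (fun M : GradedBasis => ModuleCat.of R[X] (M.ι → R[X]))

namespace FreeMod

/-- The matrix entry of a linear map: the coefficient of the `j`-th basis element in the image of
the `i`-th basis element. -/
noncomputable def entry {M N : FreeMod R} (f : M ⟶ N) (i : GradedBasis.ι M)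
    (j : GradedBasis.ι N) : R[X] :=
  open scoped Classical in
  (f.hom.hom : (GradedBasis.ι M → R[X]) →ₗ[R[X]] (GradedBasis.ι N → R[X])) (Pi.single i 1) j

theorem entry_id (M : FreeMod R) (i j : GradedBasis.ι M) [Decidable (i = j)] :
    entry (𝟙 M) i j = if i = j then 1 else 0 := by
  classical
  change (Pi.single i 1 : GradedBasis.ι M → R[X]) j = _
  rw [Pi.single_apply]
  simp only [eq_comm]

theorem entry_comp {M N P : FreeMod R} (f : M ⟶ N) (g : N ⟶ P) (i : GradedBasis.ι M)
    (k : GradedBasis.ι P) : entry (f ≫ g) i k = ∑ j, entry f i j * entry g j k := by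
  classical
  let f' : (GradedBasis.ι M → R[X]) →ₗ[R[X]] (GradedBasis.ι N → R[X]) := f.hom.hom
  let g' : (GradedBasis.ι N → R[X]) →ₗ[R[X]] (GradedBasis.ι P → R[X]) := g.hom.hom
  have h : ∀ v : GradedBasis.ι N → R[X], g' v = ∑ j, v j • g' (Pi.single j 1) := fun v => by
    conv_lhs => rw [pi_eq_sum_univ' v]
    simp only [map_sum, map_smul]
  have h2 := congrFun (h (f' (Pi.single i 1))) k
  simp only [Finset.sum_apply, Pi.smul_apply, smul_eq_mul] at h2
  have e1 : entry (f ≫ g) i k = g' (f' (Pi.single i 1)) k := by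
    simp only [entry, g', f']
    congr!
  rw [e1, h2]
  refine Finset.sum_congr rfl fun j _ => ?_
  simp only [entry, g', f']

theorem entry_add {M N : FreeMod R} (f g : M ⟶ N) (i : GradedBasis.ι M) (j : GradedBasis.ι N) :
    entry (f + g) i j = entry f i j + entry g i j := rfl

variable (R) [Invertible (2 : R)]

/-- The column of empty sets `∅{m}` given by the degrees `m` of the basis elements. -/
noncomputable def realizeObj (M : FreeMod R) : Mat_ (Cob R) :=
  ⟨GradedBasis.ι M, fun i => Cob.empty R (GradedBasis.deg M i)⟩

variable {R} in
/-- Substitute the 2-handle operator for the variable in the matrix of a linear map. -/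
noncomputable def realizeMap {M N : FreeMod R} (f : M ⟶ N) : realizeObj R M ⟶ realizeObj R N :=
  fun i j => Cob.poly (entry f i j) (GradedBasis.deg M i) (GradedBasis.deg N j)

/-- The functor from free `R[T]`-modules to `Mat(Cob_{/l})` which sends a basis element of degree
`m` to `∅{m}` and the variable `T` to the 2-handle operator. -/
noncomputable def realize : FreeMod R ⥤ Mat_ (Cob R) where
  obj M := realizeObj R M
  map f := realizeMap f
  map_id M := by
    classical
    refine Mat_.hom_ext _ _ fun i j => ?_
    by_cases h : i = j
    · subst h
      exact (congrArg (fun p => Cob.poly p _ _) ((entry_id M i i).trans (if_pos rfl))).trans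
        ((Cob.poly_one _).trans (Mat_.id_apply_self (realizeObj R M) i).symm)
    · exact (congrArg (fun p => Cob.poly p _ _) ((entry_id M i j).trans (if_neg h))).trans
        ((Cob.poly_zero _ _).trans (Mat_.id_apply_of_ne (realizeObj R M) i j h).symm)
  map_comp {M N P} f g := by
    refine Mat_.hom_ext _ _ fun i k => ?_
    refine Eq.trans ?_ (Mat_.comp_apply (realizeMap f) (realizeMap g) i k).symm
    refine ((congrArg (fun p => Cob.poly p _ _) (entry_comp f g i k)).trans
      (Cob.poly_sum _ _ _ _)).trans ?_
    exact Finset.sum_congr rfl fun j _ => (Cob.poly_comp _ _ _ _ _).symm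

instance : (realize R).Additive where
  map_add {M N f g} := by
    refine Mat_.hom_ext _ _ fun i j => ?_
    exact (congrArg (fun p => Cob.poly p _ _) (entry_add f g i j)).trans (Cob.poly_add _ _ _ _)

end FreeMod

/-! ### Link diagrams and their complexes -/

/-- An oriented link diagram in the plane, given as a planar diagram code.

There are `n` crossings. The four ends of strands at a crossing are numbered `0, 1, 2, 3`
counterclockwise, starting with the incoming end of the lower strand; so the lower strand runs from
`0` to `2`. The upper strand runs from `3` to `1` at a positive crossing and from `1` to `3` at a
negative one. The ends are connected in pairs by the edges of the diagram: `opp h` is the other end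
of the edge at `h`, and the orientations of the strands match along each edge. In addition there
are `loops` components without crossings. (The position of a connected piece of the
diagram relative to the other pieces is not recorded, as it does not affect abstract cobordisms.)

Planarity is expressed through the Euler characteristic: the faces of the diagram are the orbits of
the permutation which follows an edge and then turns to the next end at the crossing reached, and
`V - E + F = n - 2n + F` has to be twice the number of connected pieces. -/
structure LinkDiagram where
  n : ℕ
  loops : ℕ
  pos : Fin n → Bool
  opp : Fin n × Fin 4 → Fin n × Fin 4
  opp_opp : ∀ h, opp (opp h) = h
  oriented : ∀ h,
    (![false, pos (opp h).1, true, !pos (opp h).1] : Fin 4 → Bool) (opp h).2 =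
      !(![false, pos h.1, true, !pos h.1] : Fin 4 → Bool) h.2
  planar : Nat.card (Quot fun h h' : Fin n × Fin 4 => h' = ((opp h).1, (opp h).2 + 1)) =
    n + 2 * Nat.card (Quot fun h h' : Fin n × Fin 4 => h' = opp h ∨ h' = (h.1, h.2 + 1))

namespace LinkDiagram

variable (D : LinkDiagram)

/-- The number of positive crossings. -/
def nPos : ℕ := Finset.card {j | D.pos j = true}

/-- The number of negative crossings. -/
def nNeg : ℕ := Finset.card {j | D.pos j = false}

/-- A vertex of the cube of resolutions. -/
abbrev Vertex : Type := Fin D.n → Bool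

/-- The number of ones. -/
def height (ε : D.Vertex) : ℕ := Finset.card {j | ε j = true}

/-- The ends connected by the `0`-smoothing and by the `1`-smoothing of a crossing: entering along
the lower (respectively upper) strand one turns right. -/
def turn : Bool → Fin 4 → Fin 4
  | false => ![1, 0, 3, 2]
  | true => ![3, 2, 1, 0]

/-- The ends of strands `h` and `h'` are connected by an edge of the diagram or by an arc of the
smoothing `ε`. -/
def Joined (ε : D.Vertex) (h h' : Fin D.n × Fin 4) : Prop :=
  h' = D.opp h ∨ h' = (h.1, turn (ε h.1) h.2)

/-- The circles of the smoothing `ε`. -/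
def Circles (ε : D.Vertex) : Type := Quot (D.Joined ε) ⊕ Fin D.loops

noncomputable instance (ε : D.Vertex) : Fintype (D.Circles ε) :=
  @instFintypeSum _ _ (Fintype.ofFinite _) _

/-- The cobordism between the smoothings `ε` and `ε'` which differ at one crossing: a saddle at
this crossing and a cylinder elsewhere. As a planar saddle merges two circles or
splits a circle in two, all components have genus `0`. -/
noncomputable def saddle (ε ε' : D.Vertex) : Surface (D.Circles ε ⊕ D.Circles ε') where
  comp := Quot (fun h h' => D.Joined ε h h' ∨ D.Joined ε' h h') ⊕ Fin D.loops
  fin := @instFintypeSum _ _ (Fintype.ofFinite _) _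
  bdry := Sum.elim (Sum.map (Quot.map id fun _ _ => Or.inl) id)
    (Sum.map (Quot.map id fun _ _ => Or.inr) id)
  genus := fun _ => 0

/-- The vertices which contribute to the homological degree `r`. -/
abbrev VertexAt (r : ℤ) : Type := {ε : D.Vertex // (D.height ε : ℤ) - D.nNeg = r}

variable (R)

/-- The smoothing `ε` with the shift `{r + n₊ - n₋}`. -/
noncomputable def smoothing (r : ℤ) (ε : D.Vertex) : Cob R :=
  ⟨D.Circles ε, r + D.nPos - D.nNeg⟩

/-- The chain objects of the complex associated to the diagram. -/
noncomputable def khX (r : ℤ) : Mat_ (Cob R) :=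
  ⟨D.VertexAt r, fun ε => D.smoothing R r ε.1⟩

/-- The differential: the entry belonging to an edge of the cube, where the `j`-th crossing
changes from `0` to `1`, is the saddle with the sign given by the number of ones before `j`. -/
noncomputable def khD (r : ℤ) : D.khX R r ⟶ D.khX R (r + 1) := fun ε ε' =>
  ∑ j, if ε.1 j = false ∧ ε'.1 = Function.update ε.1 j true then
    (-1 : R) ^ (Finset.card {i | i < j ∧ ε.1 i = true}) •
      Cob.ofSurface (D.smoothing R r ε.1) (D.smoothing R (r + 1) ε'.1) (D.saddle ε.1 ε'.1)
  else 0

/-- The complex associated to the diagram, in `Kom(Mat(Cob_{/l}))`. -/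
noncomputable def kh (h : ∀ r, D.khD R r ≫ D.khD R (r + 1) = 0) :
    CochainComplex (Mat_ (Cob R)) ℤ :=
  CochainComplex.of (D.khX R) (D.khD R) h

/-- The basis obtained by replacing each circle of each smoothing by `v₋` and `v₊`. -/
noncomputable def deloopedBasis (r : ℤ) : FreeMod R :=
  open scoped Classical in
  { ι := Σ ε : D.VertexAt r, (D.Circles ε.1 → Bool)
    deg := fun p => r + D.nPos - D.nNeg + ∑ c, Cob.signDeg (p.2 c) : GradedBasis }

/-- Delooping all circles of all smoothings in homological degree `r`. -/
noncomputable def deloopKh [Invertible (2 : R)] (r : ℤ) :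
    D.khX R r ⟶ (FreeMod.realize R).obj (D.deloopedBasis R r) :=
  open scoped Classical in
  fun ε p => if h : ε = p.1 then
    eqToHom (by rw [h]; rfl) ≫ Cob.capOff (D.smoothing R r p.1.1) p.2 _
  else 0

end LinkDiagram

/-! ### The generalized Lee structure -/

section Lee

/-- The multiplication of two circles. -/
noncomputable def merge (R : Type u) [CommRing R] : Cob.twoCircles R ⟶ Cob.circle R :=
  Cob.ofSurface (Cob.twoCircles R) (Cob.circle R) ⟨Unit, fun _ => (), fun _ => 0⟩

/-- The pair of pants from one to two circles. -/
noncomputable def split (R : Type u) [CommRing R] : Cob.circle R ⟶ Cob.twoCircles R :=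
  Cob.ofSurface (Cob.circle R) (Cob.twoCircles R) ⟨Unit, fun _ => (), fun _ => 0⟩

/-- The renormalized 2-handle operator `t = T / 4`. -/
noncomputable def tPoly (R : Type u) [CommRing R] [Invertible (2 : R)] : R[X] :=
  Polynomial.C (⅟(2 : R) * ⅟(2 : R)) * Polynomial.X

/-- `m₂ a b c` is the coefficient of `c` in the product of `a` and `b`, where `true` stands for
`v₊` and `false` for `v₋`:
`v₊v₊ = v₊`, `v₊v₋ = v₋v₊ = v₋`, `v₋v₋ = t v₊`. -/
noncomputable def leeMul (R : Type u) [CommRing R] [Invertible (2 : R)] :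
    Bool → Bool → Bool → R[X]
  | true, true, true => 1
  | true, false, false => 1
  | false, true, false => 1
  | false, false, true => tPoly R
  | _, _, _ => 0

/-- `Δ₂ a b c` is the coefficient of `b ⊗ c` in the coproduct of `a`:
`v₊ ↦ v₊ ⊗ v₋ + v₋ ⊗ v₊` and `v₋ ↦ v₋ ⊗ v₋ + t v₊ ⊗ v₊`. -/
noncomputable def leeComul (R : Type u) [CommRing R] [Invertible (2 : R)] :
    Bool → Bool → Bool → R[X]
  | true, true, false => 1
  | true, false, true => 1
  | false, false, false => 1
  | false, true, true => tPoly R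
  | _, _, _ => 0

end Lee

end CobL

/-! ### Tubes, handles and neck cutting -/

namespace CobL

/-! The engine is neck cutting. In 4TU, put the first two disks on one component and the other two
on another: a tube between the two components is one half of the sum of the two surfaces in which
the tube is replaced by a handle at one of its ends (`mk_tube`, and `mk_tubes` for many tubes at
once). All homeomorphisms needed are obtained from `Homeo.of_isTubing`: two surfaces assembled from
the same components by the same tubes are homeomorphic.

Delooping. Cutting every cylinder of an identity cobordism gives the sum over all ways of boxing
exactly one of the two disks of each cylinder; this is one of the two inverse laws
(`sum_capOff_cupOff`). The other one says that spheres with 0, 1, 2 boxes have the values 0, 1, 0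
(`cupOff_capOff`).

Full faithfulness. Neck cutting shows that the closed surface of genus 2 vanishes and that raising
the genus by 2 multiplies by the 2-handle operator. So every closed surface is a polynomial in `T`,
which gives fullness. Conversely these polynomials, multiplied over the components, respect S, T and
4TU. They define an evaluation `evalSkein` that recovers a polynomial from its substitution, which
gives faithfulness.

The complex. All components of a saddle are recorded with genus 0, and planarity is what makes this
behave: a saddle must merge two circles or split one. The Euler characteristic condition forces the
first cohomology modulo 2 to vanish, which yields a checkerboard colouring (`exists_checkerboard`).
It orients the circles of all smoothings coherently, so that circles become cycles of a permutation
and a saddle multiplies this permutation by a transposition (`circleAt_eq_iff_not`). Hence a saddle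
is one pair of pants and otherwise cylinders. The genera in a composition of two saddles then follow
from an Euler characteristic count symmetric in the two crossings (`exists_equiv_stack_saddle`), so
the faces of the cube commute and the signs give `d² = 0`.

The entries. Closing up a cobordism of genus 0 by disks gives a product over its components of
spheres with `n` boxes, which are worth 0 for even `n` and `t^((n-1)/2)` for odd `n`
(`cupOff_ofSurface_capOff`). This yields the Lee matrices and the monomial entries. The differential
over `R[T]` exists by fullness and squares to zero by faithfulness. -/

theorem isTubing_loops {V M : Type} [Fintype V] [Fintype M] (w : V → ℤ) (φ : M → V) :
    IsTubing w φ φ (fun v => w v - fiberSum φ (fun _ => 1) v) id where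
  surj := Function.surjective_id
  ker v v' := by
    constructor
    · rintro rfl; exact .refl _
    · intro h
      induction h with
      | rel _ _ h => obtain ⟨m, rfl, rfl⟩ := h; rfl
      | refl => rfl
      | symm _ _ _ ih => exact ih.symm
      | trans _ _ _ _ _ h1 h2 => exact h1.trans h2
  euler c := by
    classical
    simp [fiberSum_eq]

theorem fiberSum_natCast {V Q : Type} [Fintype V] (q : V → Q) (w : V → ℕ) (c : Q) :
    ((fiberSum q w c : ℕ) : ℤ) = fiberSum q (fun v => (w v : ℤ)) c := by
  classical
  simp only [fiberSum_eq]
  push_cast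
  rfl

/-- A disk of genus `g x` glued on along its only circle adds `g x` to the genus of the component it
meets. Which components get joined does not depend on the genera, so only the count `euler` differs
from the case of cylinders. -/
theorem isTubing_disks {V S : Type} [Fintype V] [Fintype S] (w : V → ℤ) (φ : S → V)
    (g : S → ℕ) :
    IsTubing (Sum.elim w (fun x : S => 1 - (g x : ℤ))) (Sum.inl ∘ φ) Sum.inr
      (fun v => w v - (fiberSum φ g v : ℕ)) (Sum.elim id φ) where
  surj := (Surface.isTubing_cylinders w φ).surj
  ker := (Surface.isTubing_cylinders w φ).ker
  euler c := by
    have h := (Surface.isTubing_cylinders w φ).euler c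
    rw [fiberSum_sum] at h ⊢
    have e : ((Sum.elim w fun x : S => 1 - (g x : ℤ)) ∘ Sum.inr) = fun x => 1 - (g x : ℤ) := rfl
    rw [e, fiberSum_sub, fiberSum_natCast]
    have e' : ((Sum.elim w fun _ : S => (1 : ℤ)) ∘ Sum.inr) = fun x => 1 := rfl
    rw [e'] at h
    have e2 : (Sum.elim w fun x : S => 1 - (g x : ℤ)) ∘ Sum.inl = w := rfl
    have e3 : (Sum.elim w fun _ : S => (1 : ℤ)) ∘ Sum.inl = w := rfl
    rw [e2]
    rw [e3] at h
    have e4 : (Sum.elim id φ : V ⊕ S → V) ∘ Sum.inr = φ := rfl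
    rw [e4] at h ⊢
    linarith

namespace Surface

variable {X : Type}

/-- Add a handle to the component `φ m` for every `m : M`. -/
noncomputable def addHandles {M : Type} [Fintype M] (A : Surface X) (φ : M → A.comp) :
    Surface X where
  comp := A.comp
  bdry := A.bdry
  genus c := A.genus c + fiberSum φ (fun _ => 1) c

theorem addHandles_isTubing {M : Type} [Fintype M] (A : Surface X) (φ : M → A.comp) :
    IsTubing A.weight φ φ (A.addHandles φ).weight id := by
  have h := isTubing_loops A.weight φ
  have e : (A.addHandles φ).weight = fun v => A.weight v - fiberSum φ (fun _ => 1) v := by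
    funext v
    have : ((fiberSum φ (fun _ => 1) v : ℕ) : ℤ) = fiberSum φ (fun _ => 1) v :=
      (fiberSum_natCast φ (fun _ => 1) v).trans rfl
    simp only [weight, addHandles]
    push_cast
    exact (sub_sub _ _ _).symm.trans (congrArg _ this)
  rw [e]
  exact h

theorem tube_self_homeo (A : Surface X) (v : A.comp) :
    Homeo (A.tube v v) (A.addHandles (M := Unit) fun _ => v) :=
  Homeo.of_isTubing (A.tube_isTubing v v) (A.addHandles_isTubing _) A.bdry
    (fun _ => rfl) (fun _ => rfl)

/-- A handle is a tube from a component to itself, so both sides arise from `A` by the same tubes,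
indexed by `M ⊕ N` and `N ⊕ M`. -/
theorem tubes_addHandles_homeo {M N : Type} [Fintype M] [Fintype N] (A : Surface X)
    (f g : M → A.comp) (φ : N → A.comp) :
    Homeo ((A.tubes f g).addHandles (Quot.mk _ ∘ φ))
      (tubes (A.addHandles φ) (f : M → A.comp) (g : M → A.comp)) := by
  have hL := (tubes_isTubing A f g).trans (f' := φ) (g' := φ)
    ((A.tubes f g).addHandles_isTubing (Quot.mk _ ∘ φ))
  have hR := (A.addHandles_isTubing φ).trans (f' := f) (g' := g)
    (tubes_isTubing (A.addHandles φ) f g)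
  refine Homeo.of_isTubing hL (hR.reindex (Equiv.refl _) (Equiv.sumComm _ _) (fun _ => rfl)
    ?_ ?_ (fun _ => rfl)) A.bdry (fun _ => rfl) (fun _ => rfl)
  · rintro (m | m) <;> rfl
  · rintro (m | m) <;> rfl

theorem tubes_option_homeo {M : Type} [Fintype M] (A : Surface X) (f g : Option M → A.comp) :
    Homeo (A.tubes f g)
      ((A.tubes (f ∘ some) (g ∘ some)).tube (Quot.mk _ (f none)) (Quot.mk _ (g none))) := by
  have hR := (tubes_isTubing A (f ∘ some) (g ∘ some)).trans (f' := fun _ : Unit => f none)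
    (g' := fun _ => g none) (tube_isTubing _ _ _)
  refine Homeo.of_isTubing (tubes_isTubing A f g) (hR.reindex (Equiv.refl _)
    (Equiv.optionEquivSumPUnit M) (fun _ => rfl) ?_ ?_ (fun _ => rfl)) A.bdry
    (fun _ => rfl) (fun _ => rfl)
  · rintro (_ | m) <;> rfl
  · rintro (_ | m) <;> rfl

theorem addHandles_option_homeo {M : Type} [Fintype M] (A : Surface X) (v : A.comp)
    (φ : M → A.comp) :
    Homeo (addHandles (A.addHandles (M := Unit) fun _ => v) (φ : M → A.comp))
      (A.addHandles fun m : Option M => m.elim v φ) := by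
  have hL := (A.addHandles_isTubing (M := Unit) fun _ => v).trans (f' := φ)
    (g' := φ) (addHandles_isTubing (A.addHandles (M := Unit) fun _ => v) (φ : M → A.comp))
  refine Homeo.of_isTubing hL ((A.addHandles_isTubing fun m : Option M => m.elim v φ).reindex
    (Equiv.refl _) ((Equiv.sumComm _ _).trans (Equiv.optionEquivSumPUnit M).symm)
    (fun _ => rfl) ?_ ?_ (fun _ => rfl)) A.bdry (fun _ => rfl) (fun _ => rfl)
  · rintro (_ | m) <;> rfl
  · rintro (_ | m) <;> rfl

theorem tubes_reindex_homeo {M M' : Type} [Fintype M] [Fintype M'] (e : M' ≃ M) (A : Surface X)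
    (f g : M → A.comp) : Homeo (A.tubes (f ∘ e) (g ∘ e)) (A.tubes f g) :=
  Homeo.of_isTubing (tubes_isTubing A _ _) ((tubes_isTubing A f g).reindex (Equiv.refl _) e
    (fun _ => rfl) (fun _ => rfl) (fun _ => rfl) (fun _ => rfl)) A.bdry
    (fun _ => rfl) (fun _ => rfl)

theorem addHandles_reindex_homeo {M M' : Type} [Fintype M] [Fintype M'] (e : M' ≃ M)
    (A : Surface X) (φ : M → A.comp) : Homeo (A.addHandles (φ ∘ e)) (A.addHandles φ) :=
  Homeo.of_isTubing (A.addHandles_isTubing _) ((A.addHandles_isTubing φ).reindex (Equiv.refl _) e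
    (fun _ => rfl) (fun _ => rfl) (fun _ => rfl) (fun _ => rfl)) A.bdry
    (fun _ => rfl) (fun _ => rfl)

end Surface

namespace Skein

open Surface

variable (R : Type u) [CommRing R] [Invertible (2 : R)] {X : Type}

theorem invOf_two_smul_add_self {N : Type*} [AddCommGroup N] [Module R N] (x : N) :
    ⅟(2 : R) • (x + x) = x := by
  rw [← two_smul R x, smul_smul, invOf_mul_self, one_smul]

/-- Neck cutting. -/
theorem mk_tube (A : Surface X) (v v' : A.comp) :
    mk R (A.tube v v') = ⅟(2 : R) • (mk R (A.addHandles (M := Unit) fun _ => v) +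
      mk R (A.addHandles (M := Unit) fun _ => v')) := by
  -- 4TU with disks 1, 2 on `v` and disks 3, 4 on `v'`: the sum of the two surfaces with a handle is
  -- twice the surface with the tube.
  rw [← mk_homeo R (A.tube_self_homeo v), ← mk_homeo R (A.tube_self_homeo v'),
    mk_fourTube R A v v v' v', invOf_two_smul_add_self]

/-- Cutting several necks simultaneously. -/
theorem mk_tubes {M : Type} [Fintype M] [DecidableEq M] (A : Surface X) (f g : M → A.comp) :
    mk R (A.tubes f g) = ⅟(2 : R) ^ Fintype.card M •
      ∑ s : M → Bool, mk R (A.addHandles fun m => if s m then f m else g m) := by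
  refine Fintype.induction_empty_option (P := fun M _ => ∀ [DecidableEq M] (A : Surface X)
    (f g : M → A.comp), mk R (A.tubes f g) = ⅟(2 : R) ^ Fintype.card M •
      ∑ s : M → Bool, mk R (A.addHandles fun m => if s m then f m else g m))
    ?_ ?_ ?_ M A f g
  · intro M M' _ e ih _ A f g
    classical
    let _ := Fintype.ofEquiv M' e.symm
    rw [← mk_homeo R (tubes_reindex_homeo e A f g)]
    refine (ih A (f ∘ e) (g ∘ e)).trans ?_
    rw [Fintype.card_congr e]
    congr 1
    refine Finset.sum_nbij' (fun s => s ∘ e.symm) (fun s => s ∘ e) (by simp) (by simp)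
      (by intro s _; funext m; simp) (by intro s _; funext m; simp) ?_
    intro s _
    refine mk_homeo R ?_
    have := addHandles_reindex_homeo e A (fun m => if (s ∘ e.symm) m then f m else g m)
    convert this using 2
    funext m
    simp
  · intro _ A f g
    have h : Homeo (A.tubes f g) (A.addHandles f) :=
      Homeo.of_isTubing (tubes_isTubing A f g) ((A.addHandles_isTubing f).reindex (Equiv.refl _)
        (Equiv.refl _) (fun _ => rfl) (fun m => m.elim) (fun m => m.elim) (fun _ => rfl)) A.bdry
        (fun _ => rfl) (fun _ => rfl)
    rw [mk_homeo R h, Fintype.card_pempty, pow_zero, one_smul, Fintype.sum_unique]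
    congr 2
    funext m
    exact m.elim
  · intro M _ ih _ A f g
    classical
    -- After the extra tube has been cut, its handle sits on a component of the surface with the
    -- remaining tubes. It is moved to `A` itself, so that the induction hypothesis applies to `A`
    -- with one handle.
    have e (v : A.comp) : mk R ((A.tubes (f ∘ some) (g ∘ some)).addHandles
        (M := Unit) fun _ => Quot.mk _ v) = ⅟(2 : R) ^ Fintype.card M • ∑ s : M → Bool,
          mk R (addHandles (A.addHandles (M := Unit) fun _ => v)
            (fun m => if s m then f (some m) else g (some m) : M → A.comp)) :=
      (mk_homeo R (tubes_addHandles_homeo A (f ∘ some) (g ∘ some) fun _ : Unit => v)).trans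
        (ih (A.addHandles (M := Unit) fun _ => v) _ _)
    refine (mk_homeo R (tubes_option_homeo A f g)).trans ((mk_tube R _ _ _).trans ?_)
    rw [e, e, ← smul_add, smul_smul, Fintype.card_option, pow_succ']
    congr 1
    -- The two terms of the last cut are the two values of a choice function at `none`.
    have hs := (Equiv.piOptionEquivProd (β := fun _ : Option M => Bool)).symm.sum_comp
      (fun s => mk R (A.addHandles fun m => if s m then f m else g m))
    have hφ (b : Bool) (s : M → Bool) :
        mk R (A.addHandles fun m => if (Equiv.piOptionEquivProd
          (β := fun _ : Option M => Bool)).symm (b, s) m then f m else g m) =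
        mk R (addHandles (A.addHandles (M := Unit) fun _ => if b then f none else g none)
          (fun m => if s m then f (some m) else g (some m) : M → A.comp)) := by
      rw [mk_homeo R (addHandles_option_homeo A (if b then f none else g none)
        fun m => if s m then f (some m) else g (some m))]
      congr 2
      funext m
      cases m <;> rfl
    refine Eq.trans ?_ (hs.trans (by congr!))
    rw [Fintype.sum_prod_type, Fintype.sum_bool]
    simp only [hφ]
    rfl

end Skein

end CobL

/-! ### Closed surfaces as polynomials in the 2-handle operator -/

namespace CobL

variable {R : Type u} [CommRing R]

namespace Surface

/-- The closed surface with components indexed by `V`. -/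
def closed (V : Type) [Fintype V] (g : V → ℕ) : Surface (Empty ⊕ Empty) where
  comp := V
  bdry := Sum.elim Empty.elim Empty.elim
  genus := g

theorem homeo_closed (A : Surface (Empty ⊕ Empty)) : Homeo A (closed A.comp A.genus) :=
  ⟨Equiv.refl _, by rintro (x | x) <;> exact x.elim, fun _ => rfl⟩

theorem closed_homeo {V V' : Type} [Fintype V] [Fintype V'] (e : V ≃ V') {g : V → ℕ} {g' : V' → ℕ}
    (h : ∀ v, g' (e v) = g v) : Homeo (closed V g) (closed V' g') :=
  ⟨e, by rintro (x | x) <;> exact x.elim, h⟩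

theorem isTubing_isEmpty {V M : Type} [Fintype V] [Fintype M] [IsEmpty M] (w : V → ℤ)
    (f g : M → V) : IsTubing w f g w id := by
  classical
  refine ⟨Function.surjective_id, fun v v' => ⟨?_, fun h => ?_⟩, fun c => by simp [fiberSum_eq]⟩
  · rintro rfl; exact .refl _
  · induction h with
    | rel _ _ h => exact isEmptyElim h.choose
    | refl => rfl
    | symm _ _ _ ih => exact ih.symm
    | trans _ _ _ _ _ h1 h2 => exact h1.trans h2

theorem stack_homeo_pile {S S₂ : Type} (A : Surface (S ⊕ Empty)) (B : Surface (Empty ⊕ S₂)) :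
    Homeo (A.stack B) (pile A B) :=
  Homeo.of_isTubing (tubes_isTubing (pile A B) (Sum.inl ∘ A.bdry ∘ Sum.inr)
    (Sum.inr ∘ B.bdry ∘ Sum.inl)) (isTubing_isEmpty _ _ _) (pile A B).bdry
    (fun _ => rfl) (fun _ => rfl)

end Surface

namespace Cob

open Surface

theorem ofSurface_comp (X Y Z : Cob R) (A : Surface (X.circles ⊕ Y.circles))
    (B : Surface (Y.circles ⊕ Z.circles)) :
    ofSurface X Y A ≫ ofSurface Y Z B = ofSurface X Z (A.stack B) :=
  Skein.glue_mk R A B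

theorem ofSurface_homeo (X Y : Cob R) {A B : Surface (X.circles ⊕ Y.circles)} (h : A.Homeo B) :
    ofSurface X Y A = ofSurface X Y B :=
  Skein.mk_homeo R h

/-- The closed surface with components indexed by `V`, as an endomorphism of the empty set. -/
noncomputable def closedEnd (R : Type u) [CommRing R] (V : Type) [Fintype V] (g : V → ℕ) :
    End (empty R 0) :=
  ofSurface (empty R 0) (empty R 0) (closed V g)

theorem closedEnd_congr {V V' : Type} [Fintype V] [Fintype V'] (e : V ≃ V') {g : V → ℕ}
    {g' : V' → ℕ} (h : ∀ v, g' (e v) = g v) : closedEnd R V g = closedEnd R V' g' :=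
  Skein.mk_homeo R (closed_homeo e h)

theorem closedEnd_mul (V V' : Type) [Fintype V] [Fintype V'] (g : V → ℕ) (g' : V' → ℕ) :
    closedEnd R V' g' * closedEnd R V g = closedEnd R (V ⊕ V') (Sum.elim g g') :=
  (ofSurface_comp _ _ _ _ _).trans
    (Skein.mk_homeo R ((stack_homeo_pile _ _).trans (homeo_closed (pile _ _))))

theorem closedEnd_empty (V : Type) [Fintype V] [IsEmpty V] (g : V → ℕ) : closedEnd R V g = 1 :=
  Skein.mk_homeo R ((closed_homeo (V' := Empty) (g' := fun _ => 0) (Equiv.equivOfIsEmpty _ _)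
    (fun v => isEmptyElim v)).trans (homeo_closed (cylinders Empty)).symm)

theorem closedEnd_zero (R : Type u) [CommRing R] : closedEnd R Unit (fun _ => 0) = 0 := by
  refine Eq.trans ?_ (Skein.mk_sphere R (cylinders Empty))
  refine Skein.mk_homeo R ⟨(Equiv.emptySum Empty Unit).symm, ?_, fun _ => rfl⟩
  rintro (x | x) <;> exact x.elim

theorem closedEnd_one (R : Type u) [CommRing R] :
    closedEnd R Unit (fun _ => 1) = (2 : R) • (1 : End (empty R 0)) := by
  refine Eq.trans ?_ (Skein.mk_torus R (cylinders Empty))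
  refine Skein.mk_homeo R ⟨(Equiv.emptySum Empty Unit).symm, ?_, fun _ => rfl⟩
  rintro (x | x) <;> exact x.elim

/-- The connected sum of closed surfaces of genera `a` and `b`, seen as two components joined by one
tube. -/
theorem isTubing_bool (a b : ℕ) :
    IsTubing (closed Bool fun x => if x then a else b).weight (fun _ : Unit => true)
      (fun _ => false) (closed Unit fun _ => a + b).weight fun _ => () where
  surj _ := ⟨true, rfl⟩
  ker v v' := by
    refine ⟨fun _ => ?_, fun _ => rfl⟩
    have h : ∀ v, Relation.EqvGen (fun a b => ∃ _ : Unit, true = a ∧ false = b) v true := by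
      rintro (_ | _)
      · exact (Relation.EqvGen.rel _ _ ⟨(), rfl, rfl⟩).symm
      · exact .refl _
    exact (h v).trans _ _ _ (h v').symm
  euler c := by
    classical
    change 1 - ((a + b : ℕ) : ℤ) = fiberSum (fun _ : Bool => ())
      (fun x => 1 - ((if x then a else b : ℕ) : ℤ)) () - fiberSum (fun _ : Unit => ()) (fun _ => 1) ()
    simp only [fiberSum_eq]
    simp
    ring

/-- The polynomial in the 2-handle operator represented by the closed connected surface of
genus `g`. -/
noncomputable def closedPoly (R : Type u) [CommRing R] (g : ℕ) : R[X] :=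
  if Even g then 0 else 2 * Polynomial.X ^ (g / 2)

theorem closedPoly_add_two (g : ℕ) :
    closedPoly R (g + 2) = closedPoly R g * Polynomial.X := by
  unfold closedPoly
  have : Even (g + 2) ↔ Even g := by simp [Nat.even_add]
  simp only [this]
  split_ifs
  · simp
  · rw [show (g + 2) / 2 = g / 2 + 1 by omega]
    ring

variable [Invertible (2 : R)]

/-- Cut the neck of a connected sum of surfaces of genera `a` and `b`: the handle appears on either
summand. -/
theorem closedEnd_add (R : Type u) [CommRing R] [Invertible (2 : R)] (a b : ℕ) :
    closedEnd R Unit (fun _ => a + b) = ⅟(2 : R) •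
      (closedEnd R Unit (fun _ => b) * closedEnd R Unit (fun _ => a + 1) +
        closedEnd R Unit (fun _ => b + 1) * closedEnd R Unit (fun _ => a)) := by
  have h := Skein.mk_tube R (closed Bool fun x => if x then a else b) true false
  have e : ∀ v : Bool, Skein.mk R ((closed Bool fun x => if x then a else b).addHandles
      (M := Unit) fun _ => v) = closedEnd R Unit (fun _ => if v then b else b + 1) *
        closedEnd R Unit (fun _ => if v then a + 1 else a) := by
    classical
    intro v
    rw [closedEnd_mul]
    refine Skein.mk_homeo R ((homeo_closed _).trans (closed_homeo
      (Equiv.boolEquivPUnitSumPUnit.trans (Equiv.sumComm _ _)) ?_))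
    rintro (_ | _) <;> cases v <;> simp [addHandles, fiberSum_eq, closed] <;> rfl
  refine Eq.trans ?_ (h.trans ?_)
  · exact Skein.mk_homeo R (Homeo.of_isTubing (isTubing_bool a b) (tube_isTubing _ _ _)
      (Sum.elim Empty.elim Empty.elim) (by rintro (x | x) <;> exact x.elim)
      (by rintro (x | x) <;> exact x.elim))
  · rw [e, e]
    rfl

/-- Let `x` be the surface of genus 2, cut as a connected sum of two tori. As a torus is worth 2,
the cut reads `x = x + x`. -/
theorem closedEnd_two (R : Type u) [CommRing R] [Invertible (2 : R)] :
    closedEnd R Unit (fun _ => 2) = 0 := by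
  have h := closedEnd_add R 1 1
  rw [closedEnd_one, smul_one_mul, mul_smul_one, ← smul_add, smul_smul, invOf_mul_self,
    one_smul] at h
  exact left_eq_add.1 h

theorem closedEnd_three : closedEnd R Unit (fun _ => 3) = (2 : R) • twoHandle R := by
  rw [twoHandle, smul_smul, mul_invOf_self, one_smul]
  rfl

/-- In the connected sum of genera `g` and 2, the term containing the surface of genus 2 vanishes.
The other term contains the surface of genus 3, which is twice the 2-handle operator and absorbs the
factor one half. -/
theorem closedEnd_add_two (g : ℕ) :
    closedEnd R Unit (fun _ => g + 2) = twoHandle R * closedEnd R Unit (fun _ => g) := by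
  rw [closedEnd_add, closedEnd_two, zero_mul, zero_add, closedEnd_three, smul_mul_assoc,
    smul_smul, invOf_mul_self, one_smul]

theorem closedEnd_unit (g : ℕ) : closedEnd R Unit (fun _ => g) =
    Polynomial.aeval (twoHandle R) (closedPoly R g) := by
  induction g using Nat.twoStepInduction with
  | zero => simp [closedEnd_zero, closedPoly]
  | one =>
    have h : closedPoly R 1 = (2 : R) • 1 := by simp [closedPoly, two_smul, one_add_one_eq_two]
    rw [closedEnd_one, h, map_smul, map_one]
  | more g h _ =>
    rw [closedEnd_add_two, h, closedPoly_add_two, mul_comm (closedPoly R g), map_mul,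
      Polynomial.aeval_X]

theorem closedEnd_eq (V : Type) [Fintype V] (g : V → ℕ) : closedEnd R V g =
    Polynomial.aeval (twoHandle R) (∏ v, closedPoly R (g v)) := by
  refine Fintype.induction_empty_option (P := fun V _ => ∀ g : V → ℕ, closedEnd R V g =
    Polynomial.aeval (twoHandle R) (∏ v, closedPoly R (g v))) ?_ ?_ ?_ V g
  · intro V V' _ e ih g
    let _ := Fintype.ofEquiv V' e.symm
    rw [← closedEnd_congr e (fun _ => rfl), ih, e.prod_comp fun v => closedPoly R (g v)]
  · intro g
    rw [closedEnd_empty, Finset.univ_eq_empty, Finset.prod_empty, map_one]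
  · intro V _ ih g
    -- Disjoint union is composition of endomorphisms of the empty set, so one component can be
    -- split off as a factor.
    rw [closedEnd_congr (Equiv.optionEquivSumPUnit V) (g' := Sum.elim (g ∘ some) fun _ => g none)
      (by rintro (_ | _) <;> rfl), ← closedEnd_mul, Fintype.prod_option, map_mul, ih]
    congr 1
    exact closedEnd_unit _

theorem ofSurface_closed (m m' : ℤ) (V : Type) [Fintype V] (g : V → ℕ) :
    ofSurface (empty R m) (empty R m') (closed V g) =
      poly (∏ v, closedPoly R (g v)) m m' :=
  closedEnd_eq V g

end Cob

end CobL

/-! ### Evaluation of surfaces; substitution is fully faithful -/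

namespace CobL

variable {R : Type u} [CommRing R]

/-- An explicit model for a tube between different components: `v'` is deleted from the index set
and absorbed into `v`, whose weight becomes `w v + w v' - 1`, that is, the genera add up. The model
makes products over components computable. -/
theorem isTubing_merge {V : Type} [Fintype V] [DecidableEq V] (w : V → ℤ) (v v' : V)
    (h : v ≠ v') :
    IsTubing w (fun _ : Unit => v) (fun _ => v')
      (fun c : {c // c ≠ v'} => w c + if c.1 = v then w v' - 1 else 0)
      (fun c => if hc : c = v' then ⟨v, h⟩ else ⟨c, hc⟩) where
  surj := by
    rintro ⟨c, hc⟩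
    exact ⟨c, dif_neg hc⟩
  ker c c' := by
    constructor
    · have key : ∀ c, Relation.EqvGen (fun a b => ∃ _ : Unit, v = a ∧ v' = b)
          (if hc : c = v' then (⟨v, h⟩ : {c // c ≠ v'}) else ⟨c, hc⟩).1 c := by
        intro c
        split_ifs with hc
        · subst hc; exact .rel _ _ ⟨(), rfl, rfl⟩
        · exact .refl _
      intro hc
      have h1 := key c
      rw [hc] at h1
      exact h1.symm.trans _ _ _ (key c')
    · intro hc
      induction hc with
      | rel _ _ hr =>
        obtain ⟨_, rfl, rfl⟩ := hr
        simp [h]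
      | refl => rfl
      | symm _ _ _ ih => exact ih.symm
      | trans _ _ _ _ _ h1 h2 => exact h1.trans h2
  euler := by
    rintro ⟨c, hc⟩
    rw [fiberSum_eq, fiberSum_eq, Fintype.sum_eq_add_sum_subtype_ne _ v']
    have e : ∀ x : {x // x ≠ v'}, (if (if hc : x.1 = v' then (⟨v, h⟩ : {c // c ≠ v'})
        else ⟨x.1, hc⟩) = ⟨c, hc⟩ then w x.1 else 0) =
        if x = ⟨c, hc⟩ then w x.1 else 0 := fun x => by rw [dif_neg x.2]
    simp only [e, Finset.sum_ite_eq', Finset.mem_univ, if_true]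
    simp only [Function.comp_apply, dif_neg h, dite_true, Subtype.mk.injEq, eq_comm (a := c),
      Finset.univ_unique, Finset.sum_const, Finset.card_singleton, one_smul]
    split_ifs <;> ring

namespace Surface

variable {X : Type}

/-- Merge two different components. -/
def merged (A : Surface X) [DecidableEq A.comp] (v v' : A.comp) (h : v ≠ v') : Surface X where
  comp := {c // c ≠ v'}
  bdry x := if hx : A.bdry x = v' then ⟨v, h⟩ else ⟨A.bdry x, hx⟩
  genus c := A.genus c + if c.1 = v then A.genus v' else 0

theorem merged_isTubing (A : Surface X) [DecidableEq A.comp] (v v' : A.comp) (h : v ≠ v') :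
    IsTubing A.weight (fun _ : Unit => v) (fun _ => v') (A.merged v v' h).weight
      (fun c => if hc : c = v' then (⟨v, h⟩ : {c // c ≠ v'}) else ⟨c, hc⟩) := by
  have e : (A.merged v v' h).weight = fun c : {c // c ≠ v'} =>
      A.weight c + if c.1 = v then A.weight v' - 1 else 0 := by
    funext c
    change 1 - ((A.genus c.1 + if c.1 = v then A.genus v' else 0 : ℕ) : ℤ) = _
    simp only [weight]
    split_ifs <;> push_cast <;> ring
  rw [e]
  exact isTubing_merge A.weight v v' h

end Surface

namespace Cob

open Surface

/-- Neck cutting on the level of values. If `a + b` is even every term vanishes. If it is odd,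
exactly one of the two products on the right survives, and its two factors 2 match those on the
left. -/
theorem closedPoly_add (R : Type u) [CommRing R] (a b : ℕ) : 2 * closedPoly R (a + b) =
    closedPoly R (a + 1) * closedPoly R b + closedPoly R a * closedPoly R (b + 1) := by
  unfold closedPoly
  rcases Nat.even_or_odd' a with ⟨a, rfl | rfl⟩ <;> rcases Nat.even_or_odd' b with ⟨b, rfl | rfl⟩
  · simp [Nat.even_add]
  · simp [Nat.even_add]
    rw [show (2 * a + (2 * b + 1)) / 2 = a + b by omega, show (2 * a + 1) / 2 = a by omega,
      show (2 * b + 1) / 2 = b by omega]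
    ring
  · simp [Nat.even_add]
    rw [show (2 * a + 1 + 2 * b) / 2 = a + b by omega, show (2 * a + 1) / 2 = a by omega,
      show (2 * b + 1) / 2 = b by omega]
    ring
  · simp [Nat.even_add]

/-- The product of the polynomials represented by the components of a surface, boundary circles
being capped off. -/
noncomputable def surfacePoly (R : Type u) [CommRing R] {X : Type} (A : Surface X) : R[X] :=
  ∏ v, closedPoly R (A.genus v)

theorem surfacePoly_homeo {X : Type} {A B : Surface X} (h : A.Homeo B) :
    surfacePoly R A = surfacePoly R B := by
  obtain ⟨e, -, h⟩ := h
  exact Fintype.prod_equiv e _ _ fun v => by rw [h]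

theorem surfacePoly_addClosed {X : Type} (A : Surface X) (g : ℕ) :
    surfacePoly R (A.addClosed g) = surfacePoly R A * closedPoly R g :=
  (Fintype.prod_sum_type _).trans (congrArg₂ _ rfl (Fintype.prod_unique _))

/-- The evaluation satisfies neck cutting. For `v = v'` the tube is a handle. Otherwise all
components except `v` and `v'` contribute a common factor and what remains is `closedPoly_add`. -/
theorem surfacePoly_tube {X : Type} (A : Surface X) (v v' : A.comp) :
    2 * surfacePoly R (A.tube v v') =
      surfacePoly R (A.addHandles (M := Unit) fun _ => v) +
        surfacePoly R (A.addHandles (M := Unit) fun _ => v') := by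
  classical
  by_cases h : v = v'
  · subst h
    rw [surfacePoly_homeo (A.tube_self_homeo v), two_mul]
  · rw [surfacePoly_homeo (Homeo.of_isTubing (A.tube_isTubing v v') (A.merged_isTubing v v' h)
      A.bdry (fun _ => rfl) (fun _ => rfl))]
    have e0 : ∀ w, surfacePoly R (A.addHandles (M := Unit) fun _ => w) =
        ∏ c : A.comp, closedPoly R (A.genus c + if w = c then 1 else 0) := fun w =>
      Finset.prod_congr rfl fun c _ => by
        refine congrArg (fun k => closedPoly R (A.genus c + k)) ?_
        refine (fiberSum_eq (fun _ : Unit => w) _ c).trans ?_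
        simp
    have e1 : surfacePoly R (A.merged v v' h) = ∏ c : {c // c ≠ v'},
        closedPoly R (A.genus c.1 + if c.1 = v then A.genus v' else 0) :=
      rfl
    have e2 : ∀ w, (∀ c : {c // c ≠ v'}, c ≠ ⟨v, h⟩ → w ≠ c.1) →
        ∏ c : {c : {c // c ≠ v'} // c ≠ ⟨v, h⟩},
          closedPoly R (A.genus c.1.1 + if w = c.1.1 then 1 else 0) =
        ∏ c : {c : {c // c ≠ v'} // c ≠ ⟨v, h⟩}, closedPoly R (A.genus c.1.1) := fun w hw =>
      Finset.prod_congr rfl fun c _ => by rw [if_neg (hw _ c.2), add_zero]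
    have e3 : ∏ c : {c : {c // c ≠ v'} // c ≠ ⟨v, h⟩},
          closedPoly R (A.genus c.1.1 + if c.1.1 = v then A.genus v' else 0) =
        ∏ c : {c : {c // c ≠ v'} // c ≠ ⟨v, h⟩}, closedPoly R (A.genus c.1.1) :=
      Finset.prod_congr rfl fun c _ => by
        rw [if_neg fun hc => c.2 (Subtype.ext hc), add_zero]
    -- The factors of `v'` and `v` are split off from the two products with a handle, and that of
    -- `v` from the product over the merged surface. The remaining products agree by `e2` and `e3`.
    rw [e0, e0, e1, Fintype.prod_eq_mul_prod_subtype_ne _ v',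
      Fintype.prod_eq_mul_prod_subtype_ne _ v',
      Fintype.prod_eq_mul_prod_subtype_ne _ (⟨v, h⟩ : {c // c ≠ v'}),
      Fintype.prod_eq_mul_prod_subtype_ne _ (⟨v, h⟩ : {c // c ≠ v'}),
      Fintype.prod_eq_mul_prod_subtype_ne _ (⟨v, h⟩ : {c // c ≠ v'}),
      e2 v (fun c hc hv => hc (Subtype.ext hv.symm)), e2 v' (fun c _ hv => c.2 hv.symm), e3,
      ← mul_assoc]
    simp only [if_true, if_neg h, if_neg (Ne.symm h), closedPoly_add, add_zero]
    ring

variable [Invertible (2 : R)]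

/-- The polynomial represented by a linear combination of closed surfaces. -/
noncomputable def evalSkein (R : Type u) [CommRing R] [Invertible (2 : R)] (X : Type) :
    Skein R X →ₗ[R] R[X] :=
  Skein.lift R (surfacePoly R) (fun _ _ h => surfacePoly_homeo h)
    (fun C => by rw [surfacePoly_addClosed]; simp [closedPoly])
    (fun C => by rw [surfacePoly_addClosed, mul_comm]; simp [closedPoly, two_smul, two_mul])
    (fun C v₁ v₂ v₃ v₄ => by
      -- Neck cutting gives only twice the value of a tube, so 4TU is checked after doubling. Both
      -- sides then become the sum over the four disks of the value with a handle at that disk.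
      have inj : ∀ p q : R[X], 2 * p = 2 * q → p = q := fun p q h => by
        have := congrArg (⅟(2 : R) • ·) h
        simpa only [two_mul, Skein.invOf_two_smul_add_self] using this
      apply inj
      simp only [mul_add, surfacePoly_tube]
      ring)

theorem evalSkein_mk {X : Type} (A : Surface X) :
    evalSkein R X (Skein.mk R A) = surfacePoly R A :=
  Skein.lift_mk R _ _ _ _ _ A

theorem evalSkein_closed (V : Type) [Fintype V] (g : V → ℕ) :
    evalSkein R (Empty ⊕ Empty) (closedEnd R V g) = ∏ v, closedPoly R (g v) :=
  evalSkein_mk _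

/-- The power `T^n` is one half of the closed surface of genus `2n + 1`, whose value is twice `X^n`.
So evaluation is a left inverse of substitution, and the 2-handle operator satisfies no polynomial
relation over `R`. -/
theorem evalSkein_aeval (p : R[X]) :
    evalSkein R (Empty ⊕ Empty) (Polynomial.aeval (twoHandle R) p : End (empty R 0)) = p := by
  have hpow : ∀ n : ℕ, (twoHandle R) ^ n = ⅟(2 : R) • closedEnd R Unit (fun _ => 2 * n + 1) := by
    intro n
    induction n with
    | zero => rw [pow_zero, closedEnd_one, smul_smul, invOf_mul_self, one_smul]
    | succ n ih =>
      rw [pow_succ', ih, show 2 * (n + 1) + 1 = (2 * n + 1) + 2 by ring, closedEnd_add_two,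
        mul_smul_comm]
  have hmon : ∀ n : ℕ, evalSkein R (Empty ⊕ Empty) ((twoHandle R) ^ n : End (empty R 0)) =
      Polynomial.X ^ n := by
    intro n
    rw [hpow]
    refine (map_smul (evalSkein R (Empty ⊕ Empty)) (⅟(2 : R)) _).trans ?_
    rw [evalSkein_closed]
    have : ¬ Even (2 * n + 1) := by simp
    simp [closedPoly, this]
    rw [show (2 * n + 1) / 2 = n by omega, two_mul, Skein.invOf_two_smul_add_self]
  induction p using Polynomial.induction_on' with
  | add p q hp hq =>
    rw [map_add]
    exact (map_add (evalSkein R (Empty ⊕ Empty)) _ _).trans (congrArg₂ _ hp hq)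
  | monomial n r =>
    rw [Polynomial.aeval_monomial, ← Algebra.smul_def, ← Polynomial.C_mul_X_pow_eq_monomial,
      ← Polynomial.smul_eq_C_mul, ← hmon]
    exact map_smul (evalSkein R (Empty ⊕ Empty)) r _

theorem poly_injective (m m' : ℤ) : Function.Injective fun p : R[X] => poly p m m' := by
  intro p q h
  have := congrArg (evalSkein R (Empty ⊕ Empty)) h
  exact (evalSkein_aeval p).symm.trans (this.trans (evalSkein_aeval q))

theorem poly_smul (r : R) (p : R[X]) (m m' : ℤ) : poly (r • p) m m' = r • poly p m m' :=
  (map_smul (Polynomial.aeval (twoHandle R)) r p :)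

/-- Closed surfaces span the morphisms between empty sets, and on each of them substitution undoes
evaluation; so the value of `f` is a preimage of `f`. -/
theorem poly_surjective (m m' : ℤ) : Function.Surjective fun p : R[X] => poly p m m' := by
  intro f
  let φ : R[X] →ₗ[R] Skein R (Empty ⊕ Empty) :=
    { toFun := fun p => poly p m m'
      map_add' := fun p q => poly_add p q m m'
      map_smul' := fun r p => poly_smul r p m m' }
  have h : φ ∘ₗ evalSkein R (Empty ⊕ Empty) = LinearMap.id := by
    refine Skein.hom_ext fun A => ?_
    rw [Skein.mk_homeo R (homeo_closed A)]
    have e : evalSkein R (Empty ⊕ Empty) (Skein.mk R (closed A.comp A.genus)) = _ :=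
      evalSkein_closed A.comp A.genus
    rw [LinearMap.comp_apply, e]
    exact (ofSurface_closed m m' A.comp A.genus).symm
  exact ⟨_, LinearMap.congr_fun h f⟩

end Cob

namespace FreeMod

theorem hom_ext_entry {M N : FreeMod R} {f g : M ⟶ N}
    (h : ∀ i j, entry f i j = entry g i j) : f = g := by
  classical
  refine InducedCategory.hom_ext (ModuleCat.hom_ext ?_)
  refine LinearMap.pi_ext' fun i => LinearMap.ext_ring (funext fun j => ?_)
  have e : ∀ k : M ⟶ N, (k.hom.hom : (GradedBasis.ι M → R[X]) →ₗ[R[X]] (GradedBasis.ι N → R[X]))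
      (Pi.single i 1) j = entry k i j := fun k => by
    simp only [entry]
  exact (e f).trans ((h i j).trans (e g).symm)

theorem exists_entry_eq {M N : FreeMod R} (p : GradedBasis.ι M → GradedBasis.ι N → R[X]) :
    ∃ f : M ⟶ N, ∀ i j, entry f i j = p i j := by
  classical
  let L : (GradedBasis.ι M → R[X]) →ₗ[R[X]] (GradedBasis.ι N → R[X]) :=
    (Pi.basisFun R[X] (GradedBasis.ι M)).constr R[X] p
  refine ⟨InducedCategory.homMk (ModuleCat.ofHom L), fun i j => ?_⟩
  have h : L (Pi.single i 1) = p i := by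
    have := (Pi.basisFun R[X] (GradedBasis.ι M)).constr_basis R[X] p i
    rwa [Pi.basisFun_apply] at this
  refine Eq.trans ?_ (congrFun h j)
  simp only [entry]
  congr!

variable [Invertible (2 : R)]

instance realize_faithful : (realize R).Faithful where
  map_injective {M N f g} h := by
    refine hom_ext_entry fun i j => ?_
    exact Cob.poly_injective _ _ (congrFun (congrFun h i) j)

instance realize_full : (realize R).Full where
  map_surjective {M N} f := by
    choose p hp using fun i j => Cob.poly_surjective (R := R) (GradedBasis.deg M i)
      (GradedBasis.deg N j) (f i j)
    obtain ⟨g, hg⟩ := exists_entry_eq (M := M) (N := N) p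
    refine ⟨g, Mat_.hom_ext _ _ fun i j => ?_⟩
    exact (congrArg (fun p => Cob.poly p _ _) (hg i j)).trans (hp i j)

end FreeMod
end CobL

/-! ### Delooping collections of circles -/

namespace CobL

variable {R : Type u} [CommRing R]

namespace Surface

variable {S S₁ : Type}

theorem weight_add_fiberSum {X S : Type} [Fintype S] (A : Surface X) (φ : S → A.comp) (g : S → ℕ)
    {X' : Type} (b : X' → A.comp) :
    (⟨A.comp, b, fun c => A.genus c + fiberSum φ g c⟩ : Surface X').weight =
      fun v => A.weight v - (fiberSum φ g v : ℕ) := by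
  funext v
  simp only [weight]
  push_cast
  ring

theorem stack_capSurface [Fintype S₁] (A : Surface (S ⊕ S₁)) (g : S₁ → ℕ) :
    Homeo (A.stack (Cob.capSurface g)) ⟨A.comp, Sum.elim (A.bdry ∘ Sum.inl) Empty.elim,
      fun c => A.genus c + fiberSum (A.bdry ∘ Sum.inr) g c⟩ := by
  have h := isTubing_disks A.weight (A.bdry ∘ Sum.inr) g
  rw [← weight_add_fiberSum A _ _ (Sum.elim (A.bdry ∘ Sum.inl) Empty.elim)] at h
  refine Homeo.of_isTubing (stack_isTubing A (Cob.capSurface g)) h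
    (Sum.elim (Sum.inl ∘ A.bdry ∘ Sum.inl) Empty.elim) ?_ ?_
  · rintro (x | x)
    · rfl
    · exact x.elim
  · rintro (x | x)
    · rfl
    · exact x.elim

theorem cupSurface_stack [Fintype S] (A : Surface (S ⊕ S₁)) (g : S → ℕ) :
    Homeo ((Cob.cupSurface g).stack A) ⟨A.comp, Sum.elim Empty.elim (A.bdry ∘ Sum.inr),
      fun c => A.genus c + fiberSum (A.bdry ∘ Sum.inl) g c⟩ := by
  have h := (isTubing_disks A.weight (A.bdry ∘ Sum.inl) g).swap
  rw [← weight_add_fiberSum A _ _ (Sum.elim Empty.elim (A.bdry ∘ Sum.inr))] at h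
  have h' := h.reindex (Equiv.sumComm S A.comp) (Equiv.refl _)
    (w₁ := Sum.elim (Cob.cupSurface g).weight A.weight) (f₁ := Sum.inl)
    (g₁ := Sum.inr ∘ A.bdry ∘ Sum.inl) (by rintro (v | v) <;> rfl) (fun _ => rfl) (fun _ => rfl)
    (fun _ => rfl)
  refine Homeo.of_isTubing (stack_isTubing (Cob.cupSurface g) A) h'
    (Sum.elim Empty.elim (Sum.inr ∘ A.bdry ∘ Sum.inr)) ?_ ?_
  · rintro (x | x)
    · exact x.elim
    · rfl
  · rintro (x | x)
    · exact x.elim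
    · rfl

end Surface

theorem sum_fiberSum {A V Q : Type} [AddCommMonoid A] [Fintype V] [Fintype Q] (q : V → Q)
    (w : V → A) : ∑ c, fiberSum q w c = ∑ v, w v := by
  classical
  simp only [fiberSum_eq]
  rw [Finset.sum_comm]
  simp

namespace Cob

open Surface

variable [Invertible (2 : R)]

/-- The value of a sphere with `n` boxes, as a polynomial in the 2-handle operator. -/
noncomputable def boxPoly (R : Type u) [CommRing R] [Invertible (2 : R)] (n : ℕ) : R[X] :=
  if Even n then 0 else tPoly R ^ (n / 2)

/-- For `2n + 1` boxes the value is `2 T^n / 2^(2n+1) = (T/4)^n`. This is why `t = T/4` is the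
natural normalization. -/
theorem invOf_pow_smul_closedPoly (n : ℕ) : ⅟(2 : R) ^ n • closedPoly R n = boxPoly R n := by
  unfold closedPoly boxPoly
  rcases Nat.even_or_odd' n with ⟨n, rfl | rfl⟩
  · simp
  · have : ¬ Even (2 * n + 1) := by simp
    rw [if_neg this, if_neg this, show (2 * n + 1) / 2 = n by omega, tPoly, mul_pow, ← map_pow,
      pow_succ, pow_mul, sq, mul_smul, two_mul, Skein.invOf_two_smul_add_self,
      Polynomial.smul_eq_C_mul]

/-- Every matrix entry of a genus 0 cobordism after delooping. The disks close each component to a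
sphere carrying one box for each ingoing `v₋` and each outgoing `v₊` on it, and the factors one half
of the boxes are distributed over the components. -/
theorem cupOff_ofSurface_capOff (X Y : Cob R) (A : Surface (X.circles ⊕ Y.circles))
    (hA : ∀ v, A.genus v = 0) (s : X.circles → Bool) (s' : Y.circles → Bool) (m m' : ℤ) :
    cupOff X s m ≫ ofSurface X Y A ≫ capOff Y s' m' =
      poly (∏ v, boxPoly R (fiberSum (A.bdry ∘ Sum.inl) (fun c => if s c then 0 else 1) v +
        fiberSum (A.bdry ∘ Sum.inr) (fun c => if s' c then 1 else 0) v)) m m' := by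
  have e1 : (∏ c, if s c then 1 else ⅟(2 : R)) =
      ⅟(2 : R) ^ ∑ v, fiberSum (A.bdry ∘ Sum.inl) (fun c => if s c then 0 else 1) v := by
    rw [sum_fiberSum, ← Finset.prod_pow_eq_pow_sum]
    refine Finset.prod_congr rfl fun c _ => ?_
    split_ifs <;> simp
  have e2 : (∏ c, if s' c then ⅟(2 : R) else 1) =
      ⅟(2 : R) ^ ∑ v, fiberSum (A.bdry ∘ Sum.inr) (fun c => if s' c then 1 else 0) v := by
    rw [sum_fiberSum, ← Finset.prod_pow_eq_pow_sum]
    refine Finset.prod_congr rfl fun c _ => ?_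
    split_ifs <;> simp
  have e3 : ofSurface (empty R m) X (cupSurface fun c => if s c then 0 else 1) ≫
      ofSurface X Y A ≫ ofSurface Y (empty R m') (capSurface fun c => if s' c then 1 else 0) =
      poly (∏ v, closedPoly R (fiberSum (A.bdry ∘ Sum.inl) (fun c => if s c then 0 else 1) v +
        fiberSum (A.bdry ∘ Sum.inr) (fun c => if s' c then 1 else 0) v)) m m' := by
    refine (congrArg _ (ofSurface_comp _ _ _ _ _)).trans ((ofSurface_comp _ _ _ _ _).trans ?_)
    rw [← ofSurface_closed]
    refine ofSurface_homeo _ _ (((Homeo.refl _).stack (stack_capSurface A _)).trans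
      ((cupSurface_stack _ _).trans ((homeo_closed _).trans ?_)))
    refine closed_homeo (Equiv.refl _) fun v => ?_
    simp only [hA, zero_add, Equiv.refl_apply]
    exact add_comm _ _
  rw [cupOff, capOff, Linear.comp_smul, Linear.smul_comp, Linear.comp_smul, e3, smul_smul, e1, e2, ← pow_add, ← Finset.sum_add_distrib,
    ← Finset.prod_pow_eq_pow_sum, ← poly_smul, Polynomial.smul_eq_C_mul, map_prod,
    ← Finset.prod_mul_distrib]
  congr 1
  refine Finset.prod_congr rfl fun v _ => ?_
  rw [← Polynomial.smul_eq_C_mul, invOf_pow_smul_closedPoly]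

/-- The two disks on a circle form a sphere with one box if the signs agree and with none or two
boxes if they differ. Its value is 1 or 0 accordingly. -/
theorem cupOff_capOff (X : Cob R) (s s' : X.circles → Bool) (m m' : ℤ) [Decidable (s = s')] :
    cupOff X s m ≫ capOff X s' m' = poly (if s = s' then 1 else 0) m m' := by
  classical
  have h := cupOff_ofSurface_capOff X X (cylinders X.circles) (fun _ => rfl) s s' m m'
  have h1 : ofSurface X X (cylinders X.circles) = 𝟙 X := rfl
  rw [h1, Category.id_comp] at h
  rw [h]
  congr 1
  have e : ∀ v : X.circles, boxPoly R (fiberSum ((cylinders X.circles).bdry ∘ Sum.inl)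
      (fun c => if s c then 0 else 1) v + fiberSum ((cylinders X.circles).bdry ∘ Sum.inr)
      (fun c => if s' c then 1 else 0) v) = if s v = s' v then 1 else 0 := by
    intro v
    have e1 : ∀ k : X.circles → ℕ, fiberSum (id : X.circles → X.circles) k v = k v := fun k =>
      (fiberSum_eq _ _ _).trans (by simp)
    refine (congrArg (boxPoly R) (congrArg₂ (· + ·) (e1 _) (e1 _))).trans ?_
    cases s v <;> cases s' v <;> simp [boxPoly]
  refine (Finset.prod_congr rfl fun v _ => e v).trans ?_
  split_ifs with hs
  · subst hs
    exact Finset.prod_eq_one fun v _ => if_pos rfl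
  · obtain ⟨v, hv⟩ := Function.ne_iff.1 hs
    exact Finset.prod_eq_zero (Finset.mem_univ v) (if_neg hv)

/-- A cylinder is a pair of disks joined by a tube; in this form the identity can be cut by
`mk_tubes`. -/
theorem cylinders_homeo_tubes (S : Type) [Fintype S] :
    Homeo (cylinders S) (tubes (X := S ⊕ S) ⟨S ⊕ S, id, fun _ => 0⟩ Sum.inl Sum.inr) := by
  have h1 : IsTubing (Sum.elim (fun _ : S => (1 : ℤ)) fun _ : S => 1) Sum.inl Sum.inr
      (cylinders S).weight (Sum.elim id id) := by
    have e1 : (cylinders S).weight = fun _ => 1 := by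
      funext s
      simp [weight, cylinders]
    rw [e1]
    exact isTubing_cylinders (fun _ : S => (1 : ℤ)) (id : S → S)
  have h2 := tubes_isTubing (X := S ⊕ S) ⟨S ⊕ S, id, fun _ => 0⟩ Sum.inl Sum.inr
  have e2 : (⟨S ⊕ S, id, fun _ => 0⟩ : Surface (S ⊕ S)).weight =
      Sum.elim (fun _ : S => 1) (fun _ : S => 1) := by
    funext s
    rcases s with s | s <;> simp [weight]
  rw [e2] at h2
  exact Homeo.of_isTubing h1 h2 id (by rintro (x | x) <;> rfl) (fun _ => rfl)

/-- Cut all cylinders of the identity. A choice of the end that receives the handle is a map `s` to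
the signs: the disk of `capOff` is boxed where `s` is `v₊`, the one of `cupOff` where it is `v₋`.
The intermediate shifts `m s` are free, since composition ignores shifts. -/
theorem sum_capOff_cupOff (X : Cob R) (m : (X.circles → Bool) → ℤ) [DecidableEq X.circles] :
    ∑ s, capOff X s (m s) ≫ cupOff X s (m s) = 𝟙 X := by
  have h1 : 𝟙 X = ofSurface X X (cylinders X.circles) := rfl
  rw [h1, ofSurface_homeo X X (cylinders_homeo_tubes X.circles)]
  refine Eq.trans ?_ (Skein.mk_tubes R (X := X.circles ⊕ X.circles)
    ⟨X.circles ⊕ X.circles, id, fun _ => 0⟩ Sum.inl Sum.inr).symm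
  rw [Finset.smul_sum]
  refine Finset.sum_congr rfl fun s _ => ?_
  have e0 : ofSurface X (empty R (m s)) (capSurface fun c => if s c then 1 else 0) ≫
      ofSurface (empty R (m s)) X (cupSurface fun c => if s c then 0 else 1) =
      ofSurface X X (pile (capSurface fun c => if s c then 1 else 0)
        (cupSurface fun c => if s c then 0 else 1)) :=
    (ofSurface_comp _ _ _ _ _).trans (ofSurface_homeo _ _ (stack_homeo_pile _ _))
  rw [capOff, cupOff, Linear.comp_smul, Linear.smul_comp, e0, smul_smul,
    ← Finset.prod_mul_distrib]
  have e : ∀ c, ((if s c then 1 else ⅟(2 : R)) * if s c then ⅟(2 : R) else 1) = ⅟(2 : R) :=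
    fun c => by split_ifs <;> simp
  simp only [e, Finset.prod_const]
  refine congrArg₂ (HSMul.hSMul (α := R)) rfl (Skein.mk_homeo R ?_)
  refine ⟨Equiv.refl _, by rintro (x | x) <;> rfl, ?_⟩
  have e3 : ∀ c, fiberSum (fun m => if s m then Sum.inl m else Sum.inr m :
      X.circles → X.circles ⊕ X.circles) (fun _ => 1) (Sum.inl c) = if s c then 1 else 0 := by
    intro c
    rw [fiberSum_eq, Finset.sum_eq_single c]
    · split_ifs <;> simp_all
    · intro b _ hb
      split_ifs <;> simp_all
    · simp
  have e4 : ∀ c, fiberSum (fun m => if s m then Sum.inl m else Sum.inr m :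
      X.circles → X.circles ⊕ X.circles) (fun _ => 1) (Sum.inr c) = if s c then 0 else 1 := by
    intro c
    rw [fiberSum_eq, Finset.sum_eq_single c]
    · split_ifs <;> simp_all
    · intro b _ hb
      split_ifs <;> simp_all
    · simp
  rintro (c | c)
  · exact (zero_add _).trans (e3 c)
  · exact (zero_add _).trans (e4 c)

theorem deloopHom_deloopInv (X : Cob R) : deloopHom X ≫ deloopInv X = 𝟙 _ := by
  classical
  refine Mat_.hom_ext _ _ fun i j => ?_
  cases i
  cases j
  refine (Mat_.comp_apply _ _ _ _).trans ?_
  refine Eq.trans ?_ ((sum_capOff_cupOff X fun s => X.shift + ∑ c, signDeg (s c)).trans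
    (Mat_.id_apply_self ((Mat_.embedding (Cob R)).obj X) _).symm)
  -- Both sums range over all sign maps, but with different `Fintype` instances.
  exact Finset.sum_congr (Finset.ext fun s => iff_of_true (Finset.mem_univ s)
    (Finset.mem_univ s)) fun _ _ => rfl

theorem deloopInv_deloopHom (X : Cob R) : deloopInv X ≫ deloopHom X = 𝟙 _ := by
  classical
  refine Mat_.hom_ext _ _ fun i j => ?_
  refine (Mat_.comp_apply _ _ _ _).trans ?_
  refine (Fintype.sum_unique (ι := PUnit) _).trans ?_
  by_cases h : i = j
  · subst h
    exact (cupOff_capOff X i i _ _).trans <| (congrArg (poly · _ _) (if_pos rfl)).trans <|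
      (poly_one _).trans (Mat_.id_apply_self (delooped X) i).symm
  · exact (cupOff_capOff X i j _ _).trans <| (congrArg (poly · _ _) (if_neg h)).trans <|
      (poly_zero _ _).trans (Mat_.id_apply_of_ne (delooped X) i j h).symm

/-- Delooping all circles of an object, as an isomorphism. -/
noncomputable def deloopIso (X : Cob R) : (Mat_.embedding (Cob R)).obj X ≅ delooped X :=
  ⟨deloopHom X, deloopInv X, deloopHom_deloopInv X, deloopInv_deloopHom X⟩

/-- The sum of the signs in terms of the number of boxes that `capOff` uses; the primed version uses
the boxes of `cupOff`. -/
theorem sum_signDeg {S : Type} [Fintype S] (s : S → Bool) :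
    ∑ c, signDeg (s c) = 2 * (∑ c, if s c then 1 else 0 : ℕ) - Fintype.card S := by
  rw [Fintype.card_eq_sum_ones]
  push_cast
  rw [Finset.mul_sum, ← Finset.sum_sub_distrib]
  refine Finset.sum_congr rfl fun c _ => ?_
  cases s c <;> simp [signDeg]

theorem sum_signDeg' {S : Type} [Fintype S] (s : S → Bool) :
    ∑ c, signDeg (s c) = Fintype.card S - 2 * (∑ c, if s c then 0 else 1 : ℕ) := by
  rw [Fintype.card_eq_sum_ones]
  push_cast
  rw [Finset.mul_sum, ← Finset.sum_sub_distrib]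
  refine Finset.sum_congr rfl fun c _ => ?_
  cases s c <;> simp [signDeg]

/-- A disk has Euler characteristic 1 and a boxed disk -1, which the shift by the sign compensates.
-/
theorem capOff_mem (X : Cob R) (s : X.circles → Bool) (m : ℤ)
    (hm : m = X.shift + ∑ c, signDeg (s c)) : capOff X s m ∈ homogeneous X (empty R m) 0 := by
  refine Submodule.smul_mem _ _ (Submodule.subset_span ⟨_, ?_, rfl⟩)
  change (∑ c : X.circles, (2 - 2 * ((if s c then 1 else 0 : ℕ) : ℤ)) -
    Fintype.card (X.circles ⊕ Empty)) + m - X.shift = 0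
  rw [hm, sum_signDeg, Finset.sum_sub_distrib, ← Finset.mul_sum]
  simp
  ring

theorem cupOff_mem (X : Cob R) (s : X.circles → Bool) (m : ℤ)
    (hm : m = X.shift + ∑ c, signDeg (s c)) : cupOff X s m ∈ homogeneous (empty R m) X 0 := by
  refine Submodule.smul_mem _ _ (Submodule.subset_span ⟨_, ?_, rfl⟩)
  change (∑ c : X.circles, (2 - 2 * ((if s c then 0 else 1 : ℕ) : ℤ)) -
    Fintype.card (Empty ⊕ X.circles)) + X.shift - m = 0
  rw [hm, sum_signDeg', Finset.sum_sub_distrib, ← Finset.mul_sum]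
  simp
  ring

end Cob
end CobL

/-! ### Planarity: cohomology modulo 2 and the checkerboard colouring -/

namespace CobL

namespace LinkDiagram

variable (D : LinkDiagram)

/-- The ends of strands at crossings. -/
abbrev End : Type := Fin D.n × Fin 4

/-- Whether an end of a strand points away from its crossing. -/
def outgoing (h : D.End) : Bool := (![false, D.pos h.1, true, !D.pos h.1] : Fin 4 → Bool) h.2

theorem outgoing_opp (h : D.End) : D.outgoing (D.opp h) = !D.outgoing h := D.oriented h

/-- The edges of the diagram, given by their starting points. -/
abbrev Edge : Type := {h : D.End // D.outgoing h = true}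

/-- The faces of the diagram. -/
abbrev Face : Type := Quot fun h h' : D.End => h' = ((D.opp h).1, (D.opp h).2 + 1)

/-- The connected pieces of the diagram. -/
abbrev Piece : Type := Quot fun h h' : D.End => h' = D.opp h ∨ h' = (h.1, h.2 + 1)

/-- The face on one side of the edge which starts with a given end. -/
def face (h : D.End) : D.Face := Quot.mk _ h

/-- The piece containing a given end. -/
def piece (h : D.End) : D.Piece := Quot.mk _ h

theorem face_next (h : D.End) : D.face ((D.opp h).1, (D.opp h).2 + 1) = D.face h :=
  (Quot.sound (r := fun h h' : D.End => h' = ((D.opp h).1, (D.opp h).2 + 1)) rfl).symm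

theorem piece_opp (h : D.End) : D.piece (D.opp h) = D.piece h :=
  (Quot.sound (r := fun h h' : D.End => h' = D.opp h ∨ h' = (h.1, h.2 + 1)) (Or.inl rfl)).symm

theorem piece_rotate (h : D.End) : D.piece (h.1, h.2 + 1) = D.piece h :=
  (Quot.sound (r := fun h h' : D.End => h' = D.opp h ∨ h' = (h.1, h.2 + 1)) (Or.inr rfl)).symm

noncomputable instance : Fintype D.Face := Fintype.ofFinite _

noncomputable instance : Fintype D.Piece := Fintype.ofFinite _

theorem card_face : Fintype.card D.Face = D.n + 2 * Fintype.card D.Piece := by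
  rw [← Nat.card_eq_fintype_card, ← Nat.card_eq_fintype_card]
  exact D.planar

/-- Going to the other end of an edge. -/
def oppPerm : Equiv.Perm D.End := Function.Involutive.toPerm D.opp D.opp_opp

/-- Going along the boundary of a face. -/
def facePerm : Equiv.Perm D.End :=
  D.oppPerm.trans (Equiv.prodCongr (Equiv.refl _) (Equiv.addRight 1))

theorem sum_end {A : Type} [AddCommMonoid A] (f : D.End → A) :
    ∑ h, f h = ∑ o : D.Edge, (f o.1 + f (D.opp o.1)) := by
  classical
  rw [Finset.sum_add_distrib, ← Fintype.sum_subtype_add_sum_subtype (fun h => D.outgoing h = true) f]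
  congr 1
  refine Fintype.sum_equiv ((D.oppPerm.subtypeEquiv fun h => ?_)) _ _ fun o => ?_
  · change _ ↔ D.outgoing (D.opp h) = true
    rw [outgoing_opp]
    simp
  · exact congrArg f (D.opp_opp o.1).symm

theorem card_edge : Fintype.card D.Edge = 2 * D.n := by
  have h := D.sum_end fun _ => 1
  simp only [Finset.sum_const, Finset.card_univ, smul_eq_mul, mul_one, Fintype.card_prod,
    Fintype.card_fin] at h
  omega

/-- `facePerm` permutes the ends of each face, so every value of `q` occurs twice and cancels modulo
2. -/
theorem sum_face (q : D.End → ZMod 2) (c : D.Face) [DecidableEq D.Face] :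
    ∑ h : D.End, (if D.face h = c then q h + q (D.facePerm h) else 0) = 0 := by
  have e : ∀ h : D.End, (D.face (D.facePerm h)) = D.face h := D.face_next
  have h1 : ∑ h : D.End, (if D.face h = c then q (D.facePerm h) else 0) =
      ∑ h : D.End, (if D.face h = c then q h else 0) := by
    simpa only [e] using Equiv.sum_comp D.facePerm fun h => if D.face h = c then q h else 0
  have h2 : ∀ h : D.End, (if D.face h = c then q h + q (D.facePerm h) else 0) =
      (if D.face h = c then q h else 0) + if D.face h = c then q (D.facePerm h) else 0 :=
    fun h => by split_ifs <;> simp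
  simp only [h2]
  rw [Finset.sum_add_distrib, h1, CharTwo.add_self_eq_zero]

/-- The coboundary of a function on the crossings. -/
def cobdry : (Fin D.n → ZMod 2) →ₗ[ZMod 2] (D.Edge → ZMod 2) where
  toFun a o := a o.1.1 + a (D.opp o.1).1
  map_add' a b := by
    funext o
    simp only [Pi.add_apply]
    ring
  map_smul' r a := by
    funext o
    simp only [Pi.smul_apply, smul_eq_mul, RingHom.id_apply]
    ring

/-- The incidence matrix between faces and edges modulo two. -/
noncomputable def incidence : Matrix D.Face D.Edge (ZMod 2) :=
  open scoped Classical in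
  fun c o => (if D.face o.1 = c then 1 else 0) + if D.face (D.opp o.1) = c then 1 else 0

/-- A criterion for cocycles: a function on edges which along each face boundary is a difference of
consecutive values of some `q` on ends sums to zero around every face. It covers coboundaries as
well as the cochain that defines the colouring. -/
theorem incidence_mulVec (g q : D.End → ZMod 2) (hg : ∀ h, g (D.opp h) = g h)
    (hq : ∀ h, g h = q h + q (D.facePerm h)) :
    D.incidence.mulVec (fun o => g o.1) = 0 := by
  classical
  funext c
  rw [Pi.zero_apply, ← D.sum_face q c, sum_end]
  refine Finset.sum_congr rfl fun o _ => ?_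
  rw [← hq, ← hq, hg]
  simp only [incidence, add_mul, ite_mul, one_mul, zero_mul]

/-- A function on crossings with zero coboundary takes equal values at both ends of every edge, so
it comes from a function on the connected pieces. -/
theorem finrank_ker_cobdry_le :
    Module.finrank (ZMod 2) (LinearMap.ker D.cobdry) ≤ Fintype.card D.Piece := by
  let L : (D.Piece → ZMod 2) →ₗ[ZMod 2] (Fin D.n → ZMod 2) :=
    LinearMap.funLeft _ _ fun j => D.piece (j, 0)
  have hle : LinearMap.ker D.cobdry ≤ LinearMap.range L := by
    intro a ha
    have h1 : ∀ o : D.Edge, a o.1.1 = a (D.opp o.1).1 := fun o =>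
      CharTwo.add_eq_zero.1 (congrFun ha o)
    have h2 : ∀ h, a h.1 = a (D.opp h).1 := by
      intro h
      by_cases ho : D.outgoing h = true
      · exact h1 ⟨h, ho⟩
      · have := h1 ⟨D.opp h, by rw [outgoing_opp]; simpa using ho⟩
        rw [this, D.opp_opp]
    refine ⟨Quot.lift (fun h => a h.1) ?_, rfl⟩
    rintro h _ (rfl | rfl)
    · exact h2 h
    · rfl
  refine (Submodule.finrank_mono hle).trans ((LinearMap.finrank_range_le L).trans ?_)
  rw [Module.finrank_fintype_fun_eq_card]

/-- The dual statement: a function on faces killed by the transpose agrees on both sides of every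
edge. Crossing the edge at `h` leads to the face of the next end at the same crossing, so the
function is constant on each piece. -/
theorem finrank_ker_incidence_transpose_le :
    Module.finrank (ZMod 2) (LinearMap.ker D.incidence.transpose.mulVecLin) ≤
      Fintype.card D.Piece := by
  classical
  let L : (D.Piece → ZMod 2) →ₗ[ZMod 2] (D.Face → ZMod 2) :=
    LinearMap.funLeft _ _ (Quot.lift D.piece (by
      rintro h _ rfl
      exact (D.piece_opp h).symm.trans (D.piece_rotate _).symm))
  have hle : LinearMap.ker D.incidence.transpose.mulVecLin ≤ LinearMap.range L := by
    intro φ hφ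
    have h1 : ∀ o : D.Edge, φ (D.face o.1) = φ (D.face (D.opp o.1)) := by
      intro o
      refine CharTwo.add_eq_zero.1 (Eq.trans ?_ (congrFun hφ o))
      simp only [Matrix.mulVecLin_apply, Matrix.mulVec, dotProduct, Matrix.transpose_apply,
        incidence, add_mul, Finset.sum_add_distrib, ite_mul, one_mul, zero_mul, Finset.sum_ite_eq,
        Finset.mem_univ, if_true]
    have h2 : ∀ h, φ (D.face h) = φ (D.face (D.opp h)) := by
      intro h
      by_cases ho : D.outgoing h = true
      · exact h1 ⟨h, ho⟩
      · have := h1 ⟨D.opp h, by rw [outgoing_opp]; simpa using ho⟩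
        rw [this, D.opp_opp]
    refine ⟨Quot.lift (fun h => φ (D.face h)) ?_, ?_⟩
    · rintro h _ (rfl | rfl)
      · exact h2 h
      · refine (h2 h).trans (congrArg φ ?_)
        rw [← D.face_next (D.opp h), D.opp_opp]
    · funext c
      induction c using Quot.ind
      rfl
  refine (Submodule.finrank_mono hle).trans ((LinearMap.finrank_range_le L).trans ?_)
  rw [Module.finrank_fintype_fun_eq_card]

/-- On a planar diagram every cocycle modulo two is a coboundary. -/
theorem ker_incidence_le_range_cobdry :
    LinearMap.ker D.incidence.mulVecLin ≤ LinearMap.range D.cobdry := by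
  refine (Submodule.eq_of_le_of_finrank_le ?_ ?_).ge
  · rintro _ ⟨a, rfl⟩
    refine D.incidence_mulVec (fun h => a h.1 + a (D.opp h).1) (fun h => a h.1) (fun h => ?_)
      fun h => rfl
    rw [D.opp_opp, add_comm]
  -- With `P` pieces, the incidence matrix has rank at least `F - P = n + P`, so its kernel has
  -- dimension at most `2n - (n + P) = n - P`. The coboundary has rank at least `n - P`.
  · have h1 := LinearMap.finrank_range_add_finrank_ker D.cobdry
    have h2 := LinearMap.finrank_range_add_finrank_ker D.incidence.mulVecLin
    have h3 := LinearMap.finrank_range_add_finrank_ker D.incidence.transpose.mulVecLin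
    have h4 : Module.finrank (ZMod 2) (LinearMap.range D.incidence.transpose.mulVecLin) =
        Module.finrank (ZMod 2) (LinearMap.range D.incidence.mulVecLin) :=
      D.incidence.rank_transpose
    have h5 := D.finrank_ker_cobdry_le
    have h6 := D.finrank_ker_incidence_transpose_le
    have h7 := D.card_face
    have h8 := D.card_edge
    rw [Module.finrank_fintype_fun_eq_card] at h1 h2 h3
    rw [Fintype.card_fin] at h1
    omega

/-- A planar diagram has a checkerboard colouring; orienting the edges as boundaries of the black
faces, ingoing and outgoing ends alternate at each crossing. -/
theorem exists_checkerboard : ∃ χ : D.End → Bool, (∀ h, χ (D.opp h) = !χ h) ∧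
    ∀ h b, χ (h.1, turn b h.2) = !χ h := by
  -- The colouring is sought as `a + k`, with `a` a function of the crossing and `k` the parity of
  -- the position. Turning changes `k` by 1. The sign change along edges requires `a` to have the
  -- coboundary `k h + k (opp h) + 1`. This is a cocycle, as `facePerm` moves to the next position
  -- after `opp`, which makes the cochain equal to `k h + k (facePerm h)`.
  let k : D.End → ZMod 2 := fun h => (h.2.val : ZMod 2)
  have hk : ∀ i : Fin 4, (((i + 1 : Fin 4).val : ℕ) : ZMod 2) = (i.val : ZMod 2) + 1 := by decide
  have hmem := D.incidence_mulVec (fun h => k h + k (D.opp h) + 1) k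
    (fun h => by rw [D.opp_opp, add_comm (k h)])
    (fun h => by
      rw [add_assoc]
      exact congrArg (k h + ·) (hk (D.opp h).2).symm)
  obtain ⟨a, ha⟩ := D.ker_incidence_le_range_cobdry hmem
  have h1 : ∀ o : D.Edge, a o.1.1 + a (D.opp o.1).1 = k o.1 + k (D.opp o.1) + 1 :=
    fun o => congrFun ha o
  have h2 : ∀ h, a h.1 + a (D.opp h).1 = k h + k (D.opp h) + 1 := by
    intro h
    by_cases ho : D.outgoing h = true
    · exact h1 ⟨h, ho⟩
    · have := h1 ⟨D.opp h, by rw [outgoing_opp]; simpa using ho⟩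
      rw [D.opp_opp] at this
      rw [add_comm, this, add_comm (k h)]
  have hz : ∀ x y : ZMod 2, x = y + 1 → decide (x = 0) = !decide (y = 0) := by decide
  have hz2 : ∀ x y z w : ZMod 2, x + y = z + w + 1 → y + w = x + z + 1 := by decide
  have ht : ∀ (b : Bool) (i : Fin 4), ((turn b i).val : ZMod 2) = (i.val : ZMod 2) + 1 := by decide
  refine ⟨fun h => decide (a h.1 + k h = 0), fun h => hz _ _ (hz2 _ _ _ _ (h2 h)),
    fun h b => hz _ _ ?_⟩
  rw [add_assoc]
  exact congrArg (a h.1 + ·) (ht b h.2)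

end LinkDiagram
end CobL

/-! ### Circles as cycles of permutations; a saddle merges or splits -/

namespace CobL

/-- Once the orbit of `x` returns after `n` steps, all its elements have been seen. -/
theorem not_sameCycle_of_return {α : Type*} [Finite α] {ρ : Equiv.Perm α} {x y : α} {n : ℕ}
    (hn : 0 < n) (hx : (ρ ^ n) x = x) (hy : ∀ i < n, (ρ ^ i) x ≠ y) : ¬ ρ.SameCycle x y := by
  intro h
  obtain ⟨k, hk⟩ := h.exists_nat_pow_eq
  refine hy (k % n) (Nat.mod_lt _ hn) ?_
  have hp : Function.IsPeriodicPt ρ n x := by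
    rw [Function.IsPeriodicPt, Function.IsFixedPt, Equiv.Perm.iterate_eq_pow]
    exact hx
  have := hp.iterate_mod_apply k
  rw [Equiv.Perm.iterate_eq_pow, Equiv.Perm.iterate_eq_pow] at this
  rw [this, hk]

/-- Composing a permutation with a transposition splits a cycle or merges two cycles. -/
theorem sameCycle_iff_not_sameCycle {α : Type*} [Finite α] [DecidableEq α] {ρ ρ' : Equiv.Perm α}
    {s : Set α} {x y : α} (hx : x ∈ s) (hxy : x ≠ y) (hs : ∀ z ∈ s, ρ z ∈ s)
    (h : ∀ z ∈ s, ρ' z = Equiv.swap x y (ρ z)) : ρ.SameCycle x y ↔ ¬ ρ'.SameCycle x y := by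
  have hmem : ∀ i : ℕ, (ρ ^ i) x ∈ s := by
    intro i
    induction i with
    | zero => exact hx
    | succ i ih =>
      rw [pow_succ', Equiv.Perm.mul_apply]
      exact hs _ ih
  -- Walk along `ρ` from `x` up to the first positive time `n` at which `x` or `y` is met. Until
  -- then `ρ'` takes the same steps, and at time `n` the transposition exchanges the two outcomes:
  -- one of the permutations has returned to `x` without meeting `y`, the other has reached `y`.
  have hex : ∃ n, 0 < n ∧ ((ρ ^ n) x = x ∨ (ρ ^ n) x = y) :=
    ⟨orderOf ρ, orderOf_pos ρ, Or.inl (by rw [pow_orderOf_eq_one, Equiv.Perm.one_apply])⟩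
  classical
  obtain ⟨hn, hend⟩ := Nat.find_spec hex
  have hmin : ∀ i, 0 < i → i < Nat.find hex → (ρ ^ i) x ≠ x ∧ (ρ ^ i) x ≠ y := by
    intro i hi hlt
    have := Nat.find_min hex hlt
    tauto
  set n := Nat.find hex
  have hstep : ∀ i : ℕ, (ρ' ^ i) x = (ρ ^ i) x →
      (ρ' ^ (i + 1)) x = Equiv.swap x y ((ρ ^ (i + 1)) x) := by
    intro i hi
    rw [pow_succ', Equiv.Perm.mul_apply, hi, h _ (hmem i), pow_succ', Equiv.Perm.mul_apply]
  have heq : ∀ i < n, (ρ' ^ i) x = (ρ ^ i) x := by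
    intro i
    induction i with
    | zero => simp
    | succ i ih =>
      intro hi
      rw [hstep i (ih (by omega))]
      obtain ⟨h1, h2⟩ := hmin (i + 1) (by omega) hi
      exact Equiv.swap_apply_of_ne_of_ne h1 h2
  have hlast : (ρ' ^ n) x = Equiv.swap x y ((ρ ^ n) x) := by
    have := hstep (n - 1) (heq _ (by omega))
    rwa [Nat.sub_add_cancel hn] at this
  have hne : ∀ i < n, (ρ ^ i) x ≠ y := by
    intro i hi
    rcases Nat.eq_zero_or_pos i with rfl | hpos
    · exact hxy
    · exact (hmin i hpos hi).2
  rcases hend with he | he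
  · refine iff_of_false (not_sameCycle_of_return hn he hne) (not_not.2 ⟨n, ?_⟩)
    rw [zpow_natCast, hlast, he, Equiv.swap_apply_left]
  · refine iff_of_true ⟨n, by rw [zpow_natCast, he]⟩ (not_sameCycle_of_return hn ?_ ?_)
    · rw [hlast, he, Equiv.swap_apply_right]
    · intro i hi
      rw [heq i hi]
      exact hne i hi

theorem fiberSum_one_of_pair {V Q : Type} [Fintype V] [DecidableEq V] (f : V → Q) (c : Q) (x y : V)
    (h : ∀ z, f z = c ↔ z = x ∨ z = y) : fiberSum f (fun _ => 1) c = if x = y then 1 else 2 := by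
  classical
  rw [fiberSum_eq, ← Finset.card_filter]
  have : (Finset.univ.filter fun z => f z = c) = {x, y} := by
    ext z
    simp [h]
  rw [this]
  split_ifs with hxy
  · simp [hxy]
  · exact Finset.card_pair hxy

/-- Passing from a relation `r` to a coarser one which in addition joins `a` and `b`. -/
theorem fiberSum_quot {V : Type} {r r' : V → V → Prop} [Fintype (Quot r)] [DecidableEq (Quot r)]
    [DecidableEq (Quot r')] (a b : V) (f : Quot r → Quot r') (hf : ∀ v, f (Quot.mk r v) = Quot.mk r' v)
    (hab : Quot.mk r' a = Quot.mk r' b)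
    (hr : ∀ v v', r' v v' → Quot.mk r v = Quot.mk r v' ∨
      (Quot.mk r v = Quot.mk r a ∨ Quot.mk r v = Quot.mk r b) ∧
        (Quot.mk r v' = Quot.mk r a ∨ Quot.mk r v' = Quot.mk r b)) (c : Quot r') :
    fiberSum f (fun _ => 1) c =
      if c = Quot.mk r' a then (if Quot.mk r a = Quot.mk r b then 1 else 2) else 1 := by
  -- The alternative "same class, or both in the classes of `a` and `b`" is symmetric and
  -- transitive, so it passes from the generating relation `r'` to the equivalence relation
  -- generated by it.
  have key : ∀ v v', Quot.mk r' v = Quot.mk r' v' → Quot.mk r v = Quot.mk r v' ∨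
      (Quot.mk r v = Quot.mk r a ∨ Quot.mk r v = Quot.mk r b) ∧
        (Quot.mk r v' = Quot.mk r a ∨ Quot.mk r v' = Quot.mk r b) := by
    intro v v' h
    replace h := Quot.eqvGen_exact h
    induction h with
    | rel _ _ h => exact hr _ _ h
    | refl => exact Or.inl rfl
    | symm _ _ _ ih =>
      rcases ih with h | h
      · exact Or.inl h.symm
      · exact Or.inr h.symm
    | trans _ _ _ _ _ ih1 ih2 =>
      rcases ih1 with h1 | h1 <;> rcases ih2 with h2 | h2
      · exact Or.inl (h1.trans h2)
      · rw [h1]; exact Or.inr h2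
      · rw [← h2]; exact Or.inr h1
      · exact Or.inr ⟨h1.1, h2.2⟩
  have down : ∀ v v', Quot.mk r v = Quot.mk r v' → Quot.mk r' v = Quot.mk r' v' := fun v v' h => by
    rw [← hf, ← hf, h]
  obtain ⟨w, rfl⟩ := Quot.exists_rep c
  by_cases hc : Quot.mk r' w = Quot.mk r' a
  · rw [if_pos hc]
    refine fiberSum_one_of_pair f (Quot.mk r' w) (Quot.mk r a) (Quot.mk r b) fun z => ?_
    obtain ⟨v, rfl⟩ := Quot.exists_rep z
    rw [hf, hc]
    constructor
    · intro h
      rcases key v a h with h | h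
      · exact Or.inl h
      · exact h.1
    · rintro (h | h)
      · exact down _ _ h
      · exact (down _ _ h).trans hab.symm
  · rw [if_neg hc]
    refine (fiberSum_one_of_pair f (Quot.mk r' w) (Quot.mk r w) (Quot.mk r w) fun z => ?_).trans
      (if_pos rfl)
    obtain ⟨v, rfl⟩ := Quot.exists_rep z
    rw [hf, or_self]
    constructor
    · intro h
      rcases key v w h with h | h
      · exact h
      · rcases h.2 with h | h
        · exact absurd (down _ _ h) hc
        · exact absurd ((down _ _ h).trans hab.symm) hc
    · exact down _ _

theorem fiberSum_map_inl {V Q U : Type} [Fintype V] [Fintype U] (f : V → Q) (c : Q) :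
    fiberSum (Sum.map f (id : U → U)) (fun _ => 1) (Sum.inl c) = fiberSum f (fun _ => 1) c := by
  classical
  rw [fiberSum_eq, Fintype.sum_sum_type]
  simp [fiberSum_eq]

theorem fiberSum_map_inr {V Q U : Type} [Fintype V] [Fintype U] (f : V → Q) (u : U) :
    fiberSum (Sum.map f (id : U → U)) (fun _ => 1) (Sum.inr u) = 1 := by
  classical
  rw [fiberSum_eq, Fintype.sum_sum_type]
  simp

namespace LinkDiagram

variable (D : LinkDiagram)

theorem turn_turn : ∀ b i, turn b (turn b i) = i := by decide

/-- Going along an arc of a smoothing. -/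
def arcPerm (ε : D.Vertex) : Equiv.Perm D.End :=
  Function.Involutive.toPerm (fun h => (h.1, turn (ε h.1) h.2))
    (fun h => by simp only [turn_turn])

/-- Going along an edge and then along an arc of a smoothing. -/
def circlePerm (ε : D.Vertex) : Equiv.Perm D.End := D.oppPerm.trans (D.arcPerm ε)

theorem circlePerm_apply (ε : D.Vertex) (h : D.End) :
    D.circlePerm ε h = ((D.opp h).1, turn (ε (D.opp h).1) (D.opp h).2) := rfl

/-- The circle of the smoothing `ε` through an end. -/
def circleAt (ε : D.Vertex) (h : D.End) : Quot (D.Joined ε) := Quot.mk _ h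

theorem circleAt_opp (ε : D.Vertex) (h : D.End) : D.circleAt ε (D.opp h) = D.circleAt ε h :=
  (Quot.sound (r := D.Joined ε) (Or.inl rfl)).symm

theorem circleAt_turn (ε : D.Vertex) (h : D.End) :
    D.circleAt ε (h.1, turn (ε h.1) h.2) = D.circleAt ε h :=
  (Quot.sound (r := D.Joined ε) (Or.inr rfl)).symm

/-- The permutation follows an edge and then an arc, each of which flips `χ`, so it preserves the
ends with `χ = true`. These are one end for each edge, and they fix a direction on every circle;
without them the two directions of a circle would have to be told apart. -/
theorem circleAt_eq_iff {χ : D.End → Bool} (h1 : ∀ h, χ (D.opp h) = !χ h)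
    (h2 : ∀ h b, χ (h.1, turn b h.2) = !χ h) (ε : D.Vertex) {x y : D.End} (hx : χ x = true)
    (hy : χ y = true) :
    D.circleAt ε x = D.circleAt ε y ↔ (D.circlePerm ε).SameCycle x y := by
  constructor
  · intro h
    -- The end with `χ = true` on the same edge. Edges do not move it, and an arc moves it one step
    -- along its cycle, forwards or backwards.
    let N : D.End → D.End := fun h => if χ h then h else D.opp h
    have hN : ∀ v v', D.circleAt ε v = D.circleAt ε v' →
        (D.circlePerm ε).SameCycle (N v) (N v') := by
      intro v v' h
      replace h := Quot.eqvGen_exact h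
      induction h with
      | rel v v' h =>
        rcases h with rfl | rfl
        · have : N (D.opp v) = N v := by
            simp only [N, h1]
            cases χ v <;> simp [D.opp_opp]
          rw [this]
        · simp only [N, h2]
          cases hv : χ v
          · simp only [Bool.not_false, if_true]
            exact ⟨1, by simp [circlePerm_apply, D.opp_opp]⟩
          · refine Equiv.Perm.SameCycle.symm ⟨1, ?_⟩
            simp [circlePerm_apply, D.opp_opp, turn_turn]
      | refl => exact .refl _ _
      | symm _ _ _ ih => exact ih.symm
      | trans _ _ _ _ _ ih1 ih2 => exact ih1.trans ih2
    have := hN x y h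
    simpa only [N, hx, hy, if_true] using this
  · intro h
    obtain ⟨k, rfl⟩ := h.exists_nat_pow_eq
    have : ∀ k : ℕ, D.circleAt ε x = D.circleAt ε ((D.circlePerm ε ^ k) x) := by
      intro k
      induction k with
      | zero => rfl
      | succ k ih =>
        rw [ih, pow_succ', Equiv.Perm.mul_apply, circlePerm_apply, circleAt_turn, circleAt_opp]
    exact this k

/-- A saddle of a planar diagram merges two circles or splits a circle into two. -/
theorem circleAt_eq_iff_not {ε ε' : D.Vertex} {j : Fin D.n} (hj : ε j = false)
    (hε : ε' = Function.update ε j true) :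
    D.circleAt ε (j, 0) = D.circleAt ε (j, 2) ↔ ¬ D.circleAt ε' (j, 0) = D.circleAt ε' (j, 2) := by
  -- The negation of a colouring is again a colouring, so ends 0 and 2 at `j` may be assumed to have
  -- `χ = true`, and then 1 and 3 have `χ = false`.
  obtain ⟨χ, h1, h2, h0⟩ : ∃ χ : D.End → Bool, (∀ h, χ (D.opp h) = !χ h) ∧
      (∀ h b, χ (h.1, turn b h.2) = !χ h) ∧ χ (j, 0) = true := by
    obtain ⟨χ, h1, h2⟩ := D.exists_checkerboard
    cases h0 : χ (j, 0)
    · exact ⟨fun h => !χ h, fun h => congrArg not (h1 h), fun h b => congrArg not (h2 h b),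
        congrArg not h0⟩
    · exact ⟨χ, h1, h2, h0⟩
  have hc1 : χ (j, 1) = false := (h2 (j, 0) false).trans (by rw [h0]; rfl)
  have hc3 : χ (j, 3) = false := (h2 (j, 0) true).trans (by rw [h0]; rfl)
  have hc2 : χ (j, 2) = true := (h2 (j, 1) true).trans (by rw [hc1]; rfl)
  rw [D.circleAt_eq_iff h1 h2 ε h0 hc2, D.circleAt_eq_iff h1 h2 ε' h0 hc2]
  refine sameCycle_iff_not_sameCycle (s := {z | χ z = true}) h0 (by simp) ?_ ?_
  · intro z hz
    have hz' : χ z = true := hz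
    change χ (_, turn _ _) = true
    rw [h2]
    change (!χ (D.opp z)) = true
    rw [h1, hz']
    rfl
  -- An edge starting with `χ = true` arrives at `χ = false`. At the crossing `j` it arrives at 1 or
  -- 3, where the two smoothings turn to 0 and 2 in opposite ways; at other crossings they agree and
  -- never hit `(j, 0)` or `(j, 2)` here.
  · intro z hz
    have hw : χ (D.opp z) = false := (h1 z).trans (congrArg not hz)
    rw [circlePerm_apply, circlePerm_apply]
    generalize D.opp z = w at hw
    obtain ⟨k, i⟩ := w
    by_cases hk : k = j
    · subst hk
      subst hε
      fin_cases i
      · exact absurd hw (by simp [h0])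
      · simp [turn, hj]
      · exact absurd hw (by simp [hc2])
      · simp [turn, hj]
    · subst hε
      rw [Equiv.swap_apply_of_ne_of_ne]
      · simp [hk]
      · simp [hk]
      · simp [hk]

end LinkDiagram
end CobL

/-! ### Components of a saddle -/

namespace CobL

theorem fiberSum_add {V Q : Type} [Fintype V] (q : V → Q) (w z : V → ℤ) (c : Q) :
    fiberSum q (fun v => w v + z v) c = fiberSum q w c + fiberSum q z c := by
  classical
  simp only [fiberSum_eq]
  rw [← Finset.sum_add_distrib]
  refine Finset.sum_congr rfl fun x _ => ?_
  split_ifs <;> simp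

theorem fiberSum_two {V Q : Type} [Fintype V] (q : V → Q) (c : Q) :
    fiberSum q (fun _ => (2 : ℤ)) c = 2 * fiberSum q (fun _ => (1 : ℤ)) c := by
  rw [two_mul, ← fiberSum_add]
  rfl

namespace LinkDiagram

variable (D : LinkDiagram)

/-- Either smoothing joins an odd end to an even one, so ends 0 and 2 represent all circles that
pass through the crossing. -/
theorem circleAt_cross_zero {ε : D.Vertex} {j : Fin D.n} (i : Fin 4) :
    D.circleAt ε (j, i) = D.circleAt ε (j, 0) ∨ D.circleAt ε (j, i) = D.circleAt ε (j, 2) := by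
  have h0 := D.circleAt_turn ε (j, 0)
  have h2 := D.circleAt_turn ε (j, 2)
  cases hb : ε j <;> simp [hb, turn] at h0 h2 <;> fin_cases i <;> simp_all

theorem joined_of_joined {ε ε' : D.Vertex} {j : Fin D.n} (h : ∀ k, k ≠ j → ε k = ε' k)
    {x y : D.End} (hxy : D.Joined ε' x y) : D.Joined ε x y ∨ x.1 = j ∧ y.1 = j := by
  rcases hxy with rfl | rfl
  · exact Or.inl (Or.inl rfl)
  · by_cases hx : x.1 = j
    · exact Or.inr ⟨hx, hx⟩
    · exact Or.inl (Or.inr (by rw [h _ hx]))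

/-- The smoothings differ only at `j`, so the new arcs can join only the circles through `(j, 0)`
and `(j, 2)`. This is the hypothesis that `fiberSum_quot` needs. -/
theorem circleAt_of_joined_or {ε ε' : D.Vertex} {j : Fin D.n} (h : ∀ k, k ≠ j → ε k = ε' k)
    {x y : D.End} (hxy : D.Joined ε x y ∨ D.Joined ε' x y) :
    D.circleAt ε x = D.circleAt ε y ∨
      (D.circleAt ε x = D.circleAt ε (j, 0) ∨ D.circleAt ε x = D.circleAt ε (j, 2)) ∧
        (D.circleAt ε y = D.circleAt ε (j, 0) ∨ D.circleAt ε y = D.circleAt ε (j, 2)) := by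
  rcases hxy with hxy | hxy
  · exact Or.inl (Quot.sound hxy)
  · rcases D.joined_of_joined h hxy with hxy | ⟨hx, hy⟩
    · exact Or.inl (Quot.sound hxy)
    · obtain ⟨x, i⟩ := x
      obtain ⟨y, i'⟩ := y
      obtain rfl : x = j := hx
      obtain rfl : y = x := hy
      exact Or.inr ⟨D.circleAt_cross_zero i, D.circleAt_cross_zero i'⟩

/-- The component of a saddle to which an ingoing circle belongs. -/
def saddleInl (ε ε' : D.Vertex) : Quot (D.Joined ε) →
    Quot (fun h h' => D.Joined ε h h' ∨ D.Joined ε' h h') := Quot.map id fun _ _ => Or.inl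

/-- The component of a saddle to which an outgoing circle belongs. -/
def saddleInr (ε ε' : D.Vertex) : Quot (D.Joined ε') →
    Quot (fun h h' => D.Joined ε h h' ∨ D.Joined ε' h h') := Quot.map id fun _ _ => Or.inr

/-- The component of a saddle, or of a composition of saddles, through an end. -/
def saddleAt (ε ε' : D.Vertex) (h : D.End) : (D.saddle ε ε').comp :=
  Sum.inl (Quot.mk _ h)

theorem saddleAt_eq {ε ε' : D.Vertex} {h h' : D.End} (hh : D.Joined ε h h' ∨ D.Joined ε' h h') :
    D.saddleAt ε ε' h = D.saddleAt ε ε' h' :=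
  congrArg Sum.inl (Quot.sound hh)

/-- One smoothing has the arc from 0 to 1, the other the arc from 1 to 2. -/
theorem saddleAt_cross {ε ε' : D.Vertex} {j : Fin D.n} (h : ε j ≠ ε' j) :
    (Quot.mk (fun x y => D.Joined ε x y ∨ D.Joined ε' x y) (j, 0)) = Quot.mk _ (j, 2) := by
  cases hε : ε j
  · have hε' : ε' j = true := by cases h' : ε' j <;> simp_all
    refine (Quot.sound (b := (j, 1)) (Or.inl (Or.inr ?_))).trans (Quot.sound (Or.inr (Or.inr ?_)))
    · simp [hε, turn]
    · simp [hε', turn]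
  · have hε' : ε' j = false := by cases h' : ε' j <;> simp_all
    refine (Quot.sound (b := (j, 1)) (Or.inr (Or.inr ?_))).trans (Quot.sound (Or.inl (Or.inr ?_)))
    · simp [hε', turn]
    · simp [hε, turn]

open scoped Classical in
theorem fiberSum_saddle_inl {ε ε' : D.Vertex} {j : Fin D.n} (h : ∀ k, k ≠ j → ε k = ε' k)
    (hj : ε j ≠ ε' j) (d : (D.saddle ε ε').comp) :
    fiberSum ((D.saddle ε ε').bdry ∘ Sum.inl) (fun _ => 1) d =
      if d = D.saddleAt ε ε' (j, 0) then
        (if D.circleAt ε (j, 0) = D.circleAt ε (j, 2) then 1 else 2) else 1 := by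
  let _ : Fintype (Quot (D.Joined ε)) := Fintype.ofFinite _
  rcases d with c | l
  · refine (fiberSum_map_inl (U := Fin D.loops) (D.saddleInl ε ε') c).trans ?_
    refine (fiberSum_quot (j, 0) (j, 2) _ (fun _ => rfl) (D.saddleAt_cross hj)
      (fun v v' => D.circleAt_of_joined_or h) c).trans ?_
    refine if_congr ?_ rfl rfl
    exact ⟨congrArg Sum.inl, Sum.inl_injective.eq_iff.1⟩
  · refine (fiberSum_map_inr (U := Fin D.loops) (D.saddleInl ε ε') l).trans ?_
    rw [if_neg]
    exact Sum.inr_ne_inl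

open scoped Classical in
theorem fiberSum_saddle_inr {ε ε' : D.Vertex} {j : Fin D.n} (h : ∀ k, k ≠ j → ε k = ε' k)
    (hj : ε j ≠ ε' j) (d : (D.saddle ε ε').comp) :
    fiberSum ((D.saddle ε ε').bdry ∘ Sum.inr) (fun _ => 1) d =
      if d = D.saddleAt ε ε' (j, 0) then
        (if D.circleAt ε' (j, 0) = D.circleAt ε' (j, 2) then 1 else 2) else 1 := by
  let _ : Fintype (Quot (D.Joined ε')) := Fintype.ofFinite _
  rcases d with c | l
  · refine (fiberSum_map_inl (U := Fin D.loops) (D.saddleInr ε ε') c).trans ?_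
    refine (fiberSum_quot (j, 0) (j, 2) _ (fun _ => rfl) (D.saddleAt_cross hj)
      (fun v v' hv => D.circleAt_of_joined_or (fun k hk => (h k hk).symm) hv.symm) c).trans ?_
    refine if_congr ?_ rfl rfl
    exact ⟨congrArg Sum.inl, Sum.inl_injective.eq_iff.1⟩
  · refine (fiberSum_map_inr (U := Fin D.loops) (D.saddleInr ε ε') l).trans ?_
    rw [if_neg]
    exact Sum.inr_ne_inl

/-- The components of a saddle of a planar diagram are cylinders, except for one pair of pants. -/
theorem card_bdry_saddle {ε ε' : D.Vertex} {j : Fin D.n} (hj : ε j = false)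
    (hε : ε' = Function.update ε j true) (d : (D.saddle ε ε').comp) :
    fiberSum ((D.saddle ε ε').bdry ∘ Sum.inl) (fun _ => 1) d +
      fiberSum ((D.saddle ε ε').bdry ∘ Sum.inr) (fun _ => 1) d =
      2 + fiberSum (fun _ : Unit => D.saddleAt ε ε' (j, 0)) (fun _ => 1) d := by
  classical
  have h1 : ∀ k, k ≠ j → ε k = ε' k := fun k hk => by rw [hε, Function.update_of_ne hk]
  have h2 : ε j ≠ ε' j := by rw [hε, Function.update_self, hj]; simp
  rw [D.fiberSum_saddle_inl h1 h2, D.fiberSum_saddle_inr h1 h2, fiberSum_eq]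
  -- Exactly one of the two smoothings has two circles at the crossing, the other has one: three
  -- circles on the component of the crossing.
  have h3 := D.circleAt_eq_iff_not hj hε
  simp only [Finset.univ_unique, Finset.sum_singleton, eq_comm (a := d)]
  by_cases h4 : D.circleAt ε' (j, 0) = D.circleAt ε' (j, 2) <;> simp only [h3, h4] <;>
    split_ifs <;> simp_all

theorem card_bdry_saddle_int {ε ε' : D.Vertex} {j : Fin D.n} (hj : ε j = false)
    (hε : ε' = Function.update ε j true) (d : (D.saddle ε ε').comp) :
    fiberSum ((D.saddle ε ε').bdry ∘ Sum.inl) (fun _ => (1 : ℤ)) d +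
      fiberSum ((D.saddle ε ε').bdry ∘ Sum.inr) (fun _ => 1) d =
      2 + fiberSum (fun _ : Unit => D.saddleAt ε ε' (j, 0)) (fun _ => 1) d := by
  have h := congrArg (Nat.cast (R := ℤ)) (D.card_bdry_saddle hj hε d)
  push_cast [fiberSum_natCast] at h
  exact h

end LinkDiagram
end CobL

/-! ### Compositions of saddles and the faces of the cube -/

namespace CobL

namespace LinkDiagram

open Surface

variable (D : LinkDiagram)

/-- The circles and crossings of a component of a composition of two saddles, which determine its
genus. -/
noncomputable def doubleWeight (ε ε₂ : D.Vertex) (j j' : Fin D.n) (c : (D.saddle ε ε₂).comp) : ℤ :=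
  fiberSum ((D.saddle ε ε₂).bdry ∘ Sum.inl) (fun _ => 1) c +
    fiberSum ((D.saddle ε ε₂).bdry ∘ Sum.inr) (fun _ => 1) c -
    fiberSum (fun _ : Unit => D.saddleAt ε ε₂ (j, 0)) (fun _ => 1) c -
    fiberSum (fun _ : Unit => D.saddleAt ε ε₂ (j', 0)) (fun _ => 1) c

theorem saddle_weight (ε ε' : D.Vertex) : (D.saddle ε ε').weight = fun _ => 1 := by
  funext v
  simp [weight, saddle]

/-- The composition of two saddles at different crossings. -/
theorem exists_equiv_stack_saddle {ε ε₁ ε₂ : D.Vertex} {j j' : Fin D.n} (hj : ε j = false)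
    (h₁ : ε₁ = Function.update ε j true) (hj' : ε₁ j' = false)
    (h₂ : ε₂ = Function.update ε₁ j' true) :
    ∃ e : ((D.saddle ε ε₁).stack (D.saddle ε₁ ε₂)).comp ≃ (D.saddle ε ε₂).comp,
      (∀ x, e (((D.saddle ε ε₁).stack (D.saddle ε₁ ε₂)).bdry x) = (D.saddle ε ε₂).bdry x) ∧
      ∀ v, D.doubleWeight ε ε₂ j j' (e v) =
        2 * ((D.saddle ε ε₁).stack (D.saddle ε₁ ε₂)).weight v := by
  have hjj : j ≠ j' := by
    rintro rfl
    rw [h₁, Function.update_self] at hj'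
    exact Bool.noConfusion hj'
  -- At `j` the middle smoothing agrees with `ε₂`, elsewhere with `ε`. So the components of the
  -- composition can be read off from the two outer smoothings alone.
  have hmid : ∀ h h', D.Joined ε₁ h h' → D.Joined ε h h' ∨ D.Joined ε₂ h h' := by
    rintro h _ (rfl | rfl)
    · exact Or.inl (Or.inl rfl)
    · by_cases hh : h.1 = j
      · refine Or.inr (Or.inr ?_)
        rw [h₂, Function.update_of_ne (by rw [hh]; exact hjj)]
      · refine Or.inl (Or.inr ?_)
        rw [h₁, Function.update_of_ne hh]
  let q₁ : (D.saddle ε ε₁).comp → (D.saddle ε ε₂).comp :=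
    Sum.map (Quot.map id fun h h' hh => hh.elim Or.inl (hmid h h')) id
  let q₂ : (D.saddle ε₁ ε₂).comp → (D.saddle ε ε₂).comp :=
    Sum.map (Quot.map id fun h h' hh => hh.elim (hmid h h') Or.inr) id
  let q : (D.saddle ε ε₁).comp ⊕ (D.saddle ε₁ ε₂).comp → (D.saddle ε ε₂).comp := Sum.elim q₁ q₂
  let f : D.Circles ε₁ → (D.saddle ε ε₁).comp ⊕ (D.saddle ε₁ ε₂).comp :=
    Sum.inl ∘ (D.saddle ε ε₁).bdry ∘ Sum.inr
  let g : D.Circles ε₁ → (D.saddle ε ε₁).comp ⊕ (D.saddle ε₁ ε₂).comp :=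
    Sum.inr ∘ (D.saddle ε₁ ε₂).bdry ∘ Sum.inl
  let w : (D.saddle ε ε₁).comp ⊕ (D.saddle ε₁ ε₂).comp → ℤ :=
    Sum.elim (D.saddle ε ε₁).weight (D.saddle ε₁ ε₂).weight
  have hglue : ∀ m, q (f m) = q (g m) := by
    rintro (m | m)
    · induction m using Quot.ind
      rfl
    · rfl
  let K := Quot fun a b => ∃ m, f m = a ∧ g m = b
  let k : (D.saddle ε ε₁).comp ⊕ (D.saddle ε₁ ε₂).comp → K := Quot.mk _
  have hk : ∀ m, k (f m) = k (g m) := fun m => Quot.sound ⟨m, rfl, rfl⟩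
  have hk' : ∀ h, k (Sum.inl (D.saddleAt ε ε₁ h)) = k (Sum.inr (D.saddleAt ε₁ ε₂ h)) :=
    fun h => hk (Sum.inl (D.circleAt ε₁ h))
  -- A map back to the glued components. It shows that `q` identifies nothing beyond what the gluing
  -- forces.
  let back : (D.saddle ε ε₂).comp → K :=
    Sum.elim (Quot.lift (fun h => k (Sum.inl (D.saddleAt ε ε₁ h))) (by
      rintro h h' (hh | hh)
      · exact congrArg (k ∘ Sum.inl) (D.saddleAt_eq (Or.inl hh))
      · rw [hk', hk', D.saddleAt_eq (Or.inr hh)])) fun l => k (Sum.inl (Sum.inr l))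
  have hback : ∀ v, back (q v) = k v := by
    rintro ((v | l) | (v | l))
    · induction v using Quot.ind
      rfl
    · rfl
    · induction v using Quot.ind
      exact hk' _
    · exact hk (Sum.inr l)
  have hT : IsTubing w f g (fun c => fiberSum q w c - fiberSum (q ∘ f) (fun _ => 1) c) q := by
    refine ⟨?_, fun v v' => ⟨fun h => ?_, fun h => ?_⟩, fun c => rfl⟩
    · rintro (c | l)
      · induction c using Quot.ind with
        | _ h => exact ⟨Sum.inl (D.saddleAt ε ε₁ h), rfl⟩
      · exact ⟨Sum.inl (Sum.inr l), rfl⟩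
    · have := congrArg back h
      rw [hback, hback] at this
      exact Quot.eqvGen_exact this
    · induction h with
      | rel _ _ h => obtain ⟨m, rfl, rfl⟩ := h; exact hglue m
      | refl => rfl
      | symm _ _ _ ih => exact ih.symm
      | trans _ _ _ _ _ ih1 ih2 => exact ih1.trans ih2
  obtain ⟨e, he1, he2⟩ := (stack_isTubing (D.saddle ε ε₁) (D.saddle ε₁ ε₂)).unique hT
  refine ⟨e, ?_, ?_⟩
  · rintro ((x | x) | (x | x))
    · induction x using Quot.ind
      exact he1 _
    · exact he1 _
    · induction x using Quot.ind
      exact he1 _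
    · exact he1 _
  · intro v
    rw [← he2 v]
    generalize e v = c
    have n1 : ∀ c, fiberSum q₁ (fun d =>
        fiberSum ((D.saddle ε ε₁).bdry ∘ Sum.inl) (fun _ => (1 : ℤ)) d +
          fiberSum ((D.saddle ε ε₁).bdry ∘ Sum.inr) (fun _ => 1) d) c =
        fiberSum q₁ (fun d => 2 +
          fiberSum (fun _ : Unit => D.saddleAt ε ε₁ (j, 0)) (fun _ => 1) d) c := fun c => by
      simp only [D.card_bdry_saddle_int hj h₁]
    have n2 : ∀ c, fiberSum q₂ (fun d =>
        fiberSum ((D.saddle ε₁ ε₂).bdry ∘ Sum.inl) (fun _ => (1 : ℤ)) d +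
          fiberSum ((D.saddle ε₁ ε₂).bdry ∘ Sum.inr) (fun _ => 1) d) c =
        fiberSum q₂ (fun d => 2 +
          fiberSum (fun _ : Unit => D.saddleAt ε₁ ε₂ (j', 0)) (fun _ => 1) d) c := fun c => by
      simp only [D.card_bdry_saddle_int hj' h₂]
    have n1 := n1 c
    have n2 := n2 c
    rw [fiberSum_add, fiberSum_add, fiberSum_fiberSum, fiberSum_fiberSum, fiberSum_fiberSum,
      fiberSum_two] at n1 n2
    have a1 : q₁ ∘ (D.saddle ε ε₁).bdry ∘ Sum.inl = (D.saddle ε ε₂).bdry ∘ Sum.inl := by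
      funext x
      rcases x with x | x
      · induction x using Quot.ind
        rfl
      · rfl
    have a2 : q₂ ∘ (D.saddle ε₁ ε₂).bdry ∘ Sum.inr = (D.saddle ε ε₂).bdry ∘ Sum.inr := by
      funext x
      rcases x with x | x
      · induction x using Quot.ind
        rfl
      · rfl
    have a3 : q₁ ∘ (D.saddle ε ε₁).bdry ∘ Sum.inr = q ∘ f := rfl
    have a4 : q₂ ∘ (D.saddle ε₁ ε₂).bdry ∘ Sum.inl = q ∘ f := funext fun m => (hglue m).symm
    have a5 : (q₁ ∘ fun _ : Unit => D.saddleAt ε ε₁ (j, 0)) =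
      fun _ => D.saddleAt ε ε₂ (j, 0) := rfl
    have a6 : (q₂ ∘ fun _ : Unit => D.saddleAt ε₁ ε₂ (j', 0)) =
      fun _ => D.saddleAt ε ε₂ (j', 0) := rfl
    rw [a1, a3, a5] at n1
    rw [a2, a4, a6] at n2
    have hw : fiberSum q w c = fiberSum q₁ (fun _ => 1) c + fiberSum q₂ (fun _ => 1) c := by
      rw [fiberSum_sum]
      change fiberSum q₁ (D.saddle ε ε₁).weight c + fiberSum q₂ (D.saddle ε₁ ε₂).weight c = _
      rw [saddle_weight, saddle_weight]
    -- Over `c` let there be `k₁` and `k₂` components, `i` ingoing, `l` middle and `o` outgoing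
    -- circles. The boundary counts are `i + l = 2 k₁ + [j]` and `l + o = 2 k₂ + [j']`, where a
    -- bracket is 1 if that crossing lies on `c` and 0 otherwise. The weight is `k₁ + k₂ - l`, so
    -- twice the weight is `i + o - [j] - [j']`.
    simp only [doubleWeight]
    rw [hw]
    linarith

/-- The faces of the cube of resolutions commute. -/
theorem stack_saddle_homeo {ε ε₁ ε₁' ε₂ : D.Vertex} {j j' : Fin D.n} (hj : ε j = false)
    (h₁ : ε₁ = Function.update ε j true) (hj' : ε₁ j' = false)
    (h₂ : ε₂ = Function.update ε₁ j' true) (h₁' : ε₁' = Function.update ε j' true) :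
    Homeo ((D.saddle ε ε₁).stack (D.saddle ε₁ ε₂)) ((D.saddle ε ε₁').stack (D.saddle ε₁' ε₂)) := by
  have hjj : j ≠ j' := by
    rintro rfl
    rw [h₁, Function.update_self] at hj'
    exact Bool.noConfusion hj'
  obtain ⟨e, he1, he2⟩ := D.exists_equiv_stack_saddle hj h₁ hj' h₂
  obtain ⟨e', he1', he2'⟩ := D.exists_equiv_stack_saddle (ε := ε) (ε₁ := ε₁') (ε₂ := ε₂) (j := j')
    (j' := j) (by rwa [h₁, Function.update_of_ne hjj.symm] at hj') h₁'
    (by rwa [h₁', Function.update_of_ne hjj]) (by rw [h₂, h₁, h₁', Function.update_comm hjj])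
  refine ⟨e.trans e'.symm, fun x => ?_, fun v => ?_⟩
  · rw [Equiv.trans_apply, he1, Equiv.symm_apply_eq, he1']
  · have h := he2' (e.trans e'.symm v)
    rw [Equiv.trans_apply, Equiv.apply_symm_apply] at h
    have h' := he2 v
    -- The genus is determined by an expression symmetric in the two crossings.
    have : D.doubleWeight ε ε₂ j' j (e v) = D.doubleWeight ε ε₂ j j' (e v) := by
      simp only [doubleWeight]
      ring
    rw [this, h'] at h
    simp only [weight] at h
    rw [Equiv.trans_apply]
    omega

end LinkDiagram
end CobL

/-! ### The differential squares to zero -/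

namespace CobL

namespace LinkDiagram

open Surface

variable (D : LinkDiagram) {R : Type u} [CommRing R]

theorem height_update {ε : D.Vertex} {j : Fin D.n} (hj : ε j = false) :
    D.height (Function.update ε j true) = D.height ε + 1 := by
  have : (Finset.univ.filter fun i => Function.update ε j true i = true) =
      insert j (Finset.univ.filter fun i => ε i = true) := by
    ext i
    by_cases h : i = j
    · subst h; simp
    · simp [h]
  rw [height, this, Finset.card_insert_of_notMem (by simp [hj])]
  rfl

/-- The sign of an edge of the cube. -/
def edgeSign (R : Type u) [CommRing R] (ε : D.Vertex) (j : Fin D.n) : R :=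
  (-1 : R) ^ (Finset.card {i | i < j ∧ ε i = true})

theorem edgeSign_update {ε : D.Vertex} {j j' : Fin D.n} (hj : ε j = false) :
    D.edgeSign R (Function.update ε j true) j' =
      (if j < j' then -1 else 1) * D.edgeSign R ε j' := by
  unfold edgeSign
  split_ifs with h
  · have : (Finset.univ.filter fun i => i < j' ∧ Function.update ε j true i = true) =
        insert j (Finset.univ.filter fun i => i < j' ∧ ε i = true) := by
      ext i
      by_cases hi : i = j
      · subst hi; simp [h]
      · simp [hi]
    rw [this, Finset.card_insert_of_notMem (by simp [hj]), pow_succ']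
  · have : (Finset.univ.filter fun i => i < j' ∧ Function.update ε j true i = true) =
        Finset.univ.filter fun i => i < j' ∧ ε i = true := by
      ext i
      by_cases hi : i = j
      · subst hi; simp [h]
      · simp [hi]
    rw [this, one_mul]

/-- The contribution of two edges of the cube to the square of the differential. -/
noncomputable def doubleEdge (R : Type u) [CommRing R] (ε ε₂ : D.Vertex) (j j' : Fin D.n) :
    Skein R (D.Circles ε ⊕ D.Circles ε₂) :=
  if ε j = false ∧ Function.update ε j true j' = false ∧
      ε₂ = Function.update (Function.update ε j true) j' true then
    (D.edgeSign R ε j * D.edgeSign R (Function.update ε j true) j') •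
      Skein.mk R ((D.saddle ε (Function.update ε j true)).stack
        (D.saddle (Function.update ε j true) ε₂))
  else 0

/-- The two routes around a face of the cube give homeomorphic surfaces. Their signs differ, because
changing the smaller crossing first adds a one before the larger crossing, while the other order
adds none before the smaller one. -/
theorem doubleEdge_swap (ε ε₂ : D.Vertex) (j j' : Fin D.n) :
    D.doubleEdge R ε ε₂ j j' = -D.doubleEdge R ε ε₂ j' j := by
  by_cases h : ε j = false ∧ Function.update ε j true j' = false ∧
      ε₂ = Function.update (Function.update ε j true) j' true
  · have hjj : j ≠ j' := by
      rintro rfl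
      rw [Function.update_self] at h
      exact Bool.noConfusion h.2.1
    have h' : ε j' = false ∧ Function.update ε j' true j = false ∧
        ε₂ = Function.update (Function.update ε j' true) j true := by
      have := h.2.1
      rw [Function.update_of_ne hjj.symm] at this
      exact ⟨this, by rw [Function.update_of_ne hjj, h.1], by rw [h.2.2, Function.update_comm hjj]⟩
    rw [doubleEdge, doubleEdge, if_pos h, if_pos h', edgeSign_update D h.1, edgeSign_update D h'.1,
      Skein.mk_homeo R (D.stack_saddle_homeo h.1 rfl h.2.1 h.2.2 rfl), ← neg_smul]
    congr 1
    rcases lt_or_gt_of_ne hjj with hlt | hlt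
    · rw [if_pos hlt, if_neg hlt.not_gt]
      ring
    · rw [if_pos hlt, if_neg hlt.not_gt]
      ring
  · have h' : ¬ (ε j' = false ∧ Function.update ε j' true j = false ∧
        ε₂ = Function.update (Function.update ε j' true) j true) := by
      intro h'
      have hjj : j' ≠ j := by
        rintro rfl
        rw [Function.update_self] at h'
        exact Bool.noConfusion h'.2.1
      have := h'.2.1
      rw [Function.update_of_ne hjj.symm] at this
      exact h ⟨this, by rw [Function.update_of_ne hjj, h'.1],
        by rw [h'.2.2, Function.update_comm hjj]⟩
    rw [doubleEdge, doubleEdge, if_neg h, if_neg h', neg_zero]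

/-- The contribution of an edge of the cube to the differential. -/
noncomputable def edgeHom (R : Type u) [CommRing R] (r : ℤ) (ε ε' : D.Vertex) (j : Fin D.n) :
    D.smoothing R r ε ⟶ D.smoothing R (r + 1) ε' :=
  if ε j = false ∧ ε' = Function.update ε j true then
    D.edgeSign R ε j •
      Cob.ofSurface (D.smoothing R r ε) (D.smoothing R (r + 1) ε') (D.saddle ε ε')
  else 0

/-- The crossing `j` determines the middle vertex, so at most one summand is nonzero. -/
theorem sum_edgeHom_comp (r : ℤ) (ε : D.VertexAt r) (ε₂ : D.VertexAt (r + 1 + 1))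
    (j j' : Fin D.n) :
    ∑ ε' : D.VertexAt (r + 1), D.edgeHom R r ε.1 ε'.1 j ≫ D.edgeHom R (r + 1) ε'.1 ε₂.1 j' =
      D.doubleEdge R ε.1 ε₂.1 j j' := by
  by_cases hj : ε.1 j = false
  · have hr : (D.height (Function.update ε.1 j true) : ℤ) - D.nNeg = r + 1 := by
      rw [D.height_update hj]
      push_cast
      linarith [ε.2]
    rw [Fintype.sum_eq_single ⟨Function.update ε.1 j true, hr⟩]
    · rw [edgeHom, if_pos ⟨hj, rfl⟩, edgeHom]
      by_cases h : Function.update ε.1 j true j' = false ∧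
          ε₂.1 = Function.update (Function.update ε.1 j true) j' true
      · rw [if_pos h, doubleEdge, if_pos ⟨hj, h⟩, Linear.comp_smul, Linear.smul_comp, smul_smul,
          mul_comm]
        exact congrArg _ (Cob.ofSurface_comp _ _ _ _ _)
      · rw [if_neg h, Limits.comp_zero, doubleEdge, if_neg (fun h' => h h'.2)]
        rfl
    · intro ε' hε'
      rw [edgeHom, if_neg (fun h => hε' (Subtype.ext h.2)), Limits.zero_comp]
  · rw [doubleEdge, if_neg (fun h => hj h.1)]
    refine Finset.sum_eq_zero fun ε' _ => ?_
    rw [edgeHom, if_neg (fun h => hj h.1), Limits.zero_comp]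

theorem khD_comp_khD [Invertible (2 : R)] (r : ℤ) : D.khD R r ≫ D.khD R (r + 1) = 0 := by
  refine Mat_.hom_ext _ _ fun ε ε₂ => ?_
  refine (Mat_.comp_apply _ _ _ _).trans ?_
  have e : ∑ ε' : D.VertexAt (r + 1), D.khD R r ε ε' ≫ D.khD R (r + 1) ε' ε₂ =
      ∑ j, ∑ j', D.doubleEdge R ε.1 ε₂.1 j j' := by
    have e0 : ∀ ε' : D.VertexAt (r + 1), (∑ j, D.edgeHom R r ε.1 ε'.1 j) ≫
        (∑ j', D.edgeHom R (r + 1) ε'.1 ε₂.1 j') =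
        ∑ j, ∑ j', D.edgeHom R r ε.1 ε'.1 j ≫ D.edgeHom R (r + 1) ε'.1 ε₂.1 j' := fun ε' => by
      rw [Preadditive.sum_comp]
      exact Finset.sum_congr rfl fun j _ => Preadditive.comp_sum _ _ _
    refine (Finset.sum_congr rfl fun ε' _ => e0 ε').trans ?_
    rw [Finset.sum_comm]
    refine Finset.sum_congr rfl fun j _ => ?_
    rw [Finset.sum_comm]
    exact Finset.sum_congr rfl fun j' _ => D.sum_edgeHom_comp r ε ε₂ j j'
  refine e.trans ?_
  -- By antisymmetry the double sum equals its negative. As 2 is invertible it vanishes, diagonal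
  -- terms included.
  have h : ∑ j, ∑ j', D.doubleEdge R ε.1 ε₂.1 j j' =
      -∑ j, ∑ j', D.doubleEdge R ε.1 ε₂.1 j j' := by
    conv_rhs => rw [Finset.sum_comm]
    simp only [← Finset.sum_neg_distrib]
    exact Finset.sum_congr rfl fun j _ => Finset.sum_congr rfl fun j' _ =>
      D.doubleEdge_swap ε.1 ε₂.1 j j'
  rw [← Skein.invOf_two_smul_add_self R (∑ j, ∑ j', D.doubleEdge R ε.1 ε₂.1 j j'),
    add_eq_zero_iff_eq_neg.2 h, smul_zero]
  rfl

end LinkDiagram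
end CobL

/-! ### Delooping the complex of a diagram -/

namespace CobL

namespace LinkDiagram

open Surface

variable (D : LinkDiagram) {R : Type u} [CommRing R] [Invertible (2 : R)]

theorem deloopKh_self (r : ℤ) (ε : D.VertexAt r) (s : D.Circles ε.1 → Bool) :
    D.deloopKh R r ε ⟨ε, s⟩ = Cob.capOff (D.smoothing R r ε.1) s _ := by
  refine (dif_pos rfl).trans ?_
  exact Category.id_comp _

theorem deloopKh_of_ne (r : ℤ) {ε : D.VertexAt r} {p : Σ ε : D.VertexAt r, (D.Circles ε.1 → Bool)}
    (h : ε ≠ p.1) : D.deloopKh R r ε p = 0 := dif_neg h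

/-- The inverse of delooping all circles of all smoothings in homological degree `r`. -/
noncomputable def deloopKhInv (R : Type u) [CommRing R] [Invertible (2 : R)] (r : ℤ) :
    (FreeMod.realize R).obj (D.deloopedBasis R r) ⟶ D.khX R r :=
  open scoped Classical in
  fun p ε => if h : p.1 = ε then
    Cob.cupOff (D.smoothing R r p.1.1) p.2 _ ≫ eqToHom (by rw [← h]; rfl)
  else 0

theorem deloopKhInv_self (r : ℤ) (ε : D.VertexAt r) (s : D.Circles ε.1 → Bool) :
    D.deloopKhInv R r ⟨ε, s⟩ ε = Cob.cupOff (D.smoothing R r ε.1) s _ := by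
  refine (dif_pos rfl).trans ?_
  exact Category.comp_id _

theorem deloopKhInv_of_ne (r : ℤ) {ε : D.VertexAt r}
    {p : Σ ε : D.VertexAt r, (D.Circles ε.1 → Bool)} (h : p.1 ≠ ε) :
    D.deloopKhInv R r p ε = 0 := dif_neg h

theorem deloopKh_deloopKhInv (r : ℤ) : D.deloopKh R r ≫ D.deloopKhInv R r = 𝟙 _ := by
  classical
  refine Mat_.hom_ext _ _ fun ε ε' => ?_
  refine (Mat_.comp_apply _ _ _ _).trans ?_
  have e : ∀ F : (Σ ε : D.VertexAt r, (D.Circles ε.1 → Bool)) →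
      (D.smoothing R r ε.1 ⟶ D.smoothing R r ε'.1),
      Finset.sum (Finset.univ (α := ((FreeMod.realize R).obj (D.deloopedBasis R r)).ι)) F =
        ∑ ε₁, ∑ s, F ⟨ε₁, s⟩ := fun F => by
    rw [← Fintype.sum_sigma]
    exact Finset.sum_congr (Finset.ext fun s => iff_of_true (Finset.mem_univ s)
      (Finset.mem_univ s)) fun _ _ => rfl
  refine (e _).trans ((Fintype.sum_eq_single ε fun ε₁ h => ?_).trans ?_)
  · refine Finset.sum_eq_zero fun s _ => ?_
    refine (congrArg (· ≫ D.deloopKhInv R r ⟨ε₁, s⟩ ε')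
      (D.deloopKh_of_ne r (p := ⟨ε₁, s⟩) h.symm)).trans ?_
    exact Limits.zero_comp
  · by_cases h : ε = ε'
    · subst h
      refine Eq.trans ?_ ((Cob.sum_capOff_cupOff (D.smoothing R r ε.1) fun s =>
        r + D.nPos - D.nNeg + ∑ c, Cob.signDeg (s c)).trans
          (Mat_.id_apply_self (D.khX R r) ε).symm)
      exact Finset.sum_congr rfl fun s _ =>
        congrArg₂ (· ≫ ·) (D.deloopKh_self r ε s) (D.deloopKhInv_self r ε s)
    · refine Eq.trans ?_ (Mat_.id_apply_of_ne (D.khX R r) ε ε' h).symm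
      refine Finset.sum_eq_zero fun s _ => ?_
      refine (congrArg (D.deloopKh R r ε ⟨ε, s⟩ ≫ ·)
        (D.deloopKhInv_of_ne r (p := ⟨ε, s⟩) h)).trans ?_
      exact Limits.comp_zero

/-- A basis element belongs to one smoothing only, so a row of the inverse of delooping has at most
one nonzero entry. -/
theorem deloopKhInv_comp_apply (r : ℤ) (N : Mat_ (Cob R)) (f : D.khX R r ⟶ N)
    (p : Σ ε : D.VertexAt r, (D.Circles ε.1 → Bool)) (i : N.ι) :
    (D.deloopKhInv R r ≫ f) p i = D.deloopKhInv R r p p.1 ≫ f p.1 i := by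
  refine (Mat_.comp_apply _ _ _ _).trans (Fintype.sum_eq_single p.1 fun ε h => ?_)
  refine (congrArg (· ≫ f ε i) (D.deloopKhInv_of_ne r (p := p) h.symm)).trans ?_
  exact Limits.zero_comp

theorem comp_deloopKh_apply (r : ℤ) (N : Mat_ (Cob R)) (f : N ⟶ D.khX R r)
    (p : Σ ε : D.VertexAt r, (D.Circles ε.1 → Bool)) (i : N.ι) :
    (f ≫ D.deloopKh R r) i p = f i p.1 ≫ D.deloopKh R r p.1 p := by
  refine (Mat_.comp_apply _ _ _ _).trans (Fintype.sum_eq_single p.1 fun ε h => ?_)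
  refine (congrArg (f i ε ≫ ·) (D.deloopKh_of_ne r (p := p) h)).trans ?_
  exact Limits.comp_zero

theorem deloopKhInv_deloopKh (r : ℤ) : D.deloopKhInv R r ≫ D.deloopKh R r = 𝟙 _ := by
  classical
  refine Mat_.hom_ext _ _ fun p p' => ?_
  refine (D.deloopKhInv_comp_apply r _ _ p p').trans ?_
  obtain ⟨ε, s⟩ := p
  obtain ⟨ε', s'⟩ := p'
  by_cases h : ε = ε'
  · subst h
    refine (congrArg₂ (· ≫ ·) (D.deloopKhInv_self r ε s) (D.deloopKh_self r ε s')).trans ?_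
    refine (Cob.cupOff_capOff (D.smoothing R r ε.1) s s' _ _).trans ?_
    by_cases hs : s = s'
    · subst hs
      exact (congrArg (Cob.poly · _ _) (if_pos rfl)).trans <|
        (Cob.poly_one _).trans
          (Mat_.id_apply_self ((FreeMod.realize R).obj (D.deloopedBasis R r)) ⟨ε, s⟩).symm
    · exact (congrArg (Cob.poly · _ _) (if_neg hs)).trans <|
        (Cob.poly_zero _ _).trans (Mat_.id_apply_of_ne
          ((FreeMod.realize R).obj (D.deloopedBasis R r)) ⟨ε, s⟩ ⟨ε, s'⟩
          fun hh => hs (sigma_mk_injective hh)).symm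
  · refine (congrArg (D.deloopKhInv R r ⟨ε, s⟩ ε ≫ ·)
      (D.deloopKh_of_ne r (p := ⟨ε', s'⟩) h)).trans ?_
    exact Limits.comp_zero.trans
      (Mat_.id_apply_of_ne _ _ _ fun hh => h (congrArg Sigma.fst hh)).symm

/-- Delooping in homological degree `r`, as an isomorphism. -/
noncomputable def deloopKhIso (R : Type u) [CommRing R] [Invertible (2 : R)] (r : ℤ) :
    D.khX R r ≅ (FreeMod.realize R).obj (D.deloopedBasis R r) :=
  ⟨D.deloopKh R r, D.deloopKhInv R r, D.deloopKh_deloopKhInv r, D.deloopKhInv_deloopKh r⟩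

theorem isDegreeZero_deloopKh (r : ℤ) : Cob.IsDegreeZero (D.deloopKh R r) := by
  rintro ε ⟨ε', s⟩
  by_cases h : ε = ε'
  · subst h
    rw [D.deloopKh_self r ε s]
    exact Cob.capOff_mem (D.smoothing R r ε.1) s _ rfl
  · rw [D.deloopKh_of_ne r (p := ⟨ε', s⟩) h]
    exact Submodule.zero_mem _

theorem isDegreeZero_deloopKhInv (r : ℤ) : Cob.IsDegreeZero (D.deloopKhInv R r) := by
  rintro ⟨ε, s⟩ ε'
  by_cases h : ε = ε'
  · subst h
    rw [D.deloopKhInv_self r ε s]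
    exact Cob.cupOff_mem (D.smoothing R r ε.1) s _ rfl
  · rw [D.deloopKhInv_of_ne r (p := ⟨ε, s⟩) h]
    exact Submodule.zero_mem _

/-- The differential of the delooped complex. -/
noncomputable def deloopedD (R : Type u) [CommRing R] [Invertible (2 : R)] (r : ℤ) :
    D.deloopedBasis R r ⟶ D.deloopedBasis R (r + 1) :=
  (FreeMod.realize R).preimage (D.deloopKhInv R r ≫ D.khD R r ≫ D.deloopKh R (r + 1))

theorem realize_deloopedD (r : ℤ) : (FreeMod.realize R).map (D.deloopedD R r) =
    D.deloopKhInv R r ≫ D.khD R r ≫ D.deloopKh R (r + 1) :=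
  (FreeMod.realize R).map_preimage _

/-- By faithfulness this can be checked after realization, where the differential is conjugate to
that of the cube. -/
theorem deloopedD_comp_deloopedD (r : ℤ) : D.deloopedD R r ≫ D.deloopedD R (r + 1) = 0 := by
  refine (FreeMod.realize R).map_injective ?_
  rw [Functor.map_comp, realize_deloopedD, realize_deloopedD, Functor.map_zero]
  simp only [Category.assoc]
  rw [reassoc_of% (D.deloopKh_deloopKhInv (R := R) (r + 1)), reassoc_of% (D.khD_comp_khD (R := R) r)]
  simp

theorem cupOff_edgeHom_capOff (r : ℤ) {ε ε' : D.Vertex} {j : Fin D.n}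
    (h : ε j = false ∧ ε' = Function.update ε j true) (s : D.Circles ε → Bool)
    (s' : D.Circles ε' → Bool) (m m' : ℤ) :
    Cob.cupOff (D.smoothing R r ε) s m ≫ D.edgeHom R r ε ε' j ≫
      Cob.capOff (D.smoothing R (r + 1) ε') s' m' =
    Cob.poly (D.edgeSign R ε j • ∏ v, Cob.boxPoly R
      (fiberSum ((D.saddle ε ε').bdry ∘ Sum.inl) (fun c => if s c then 0 else 1) v +
        fiberSum ((D.saddle ε ε').bdry ∘ Sum.inr) (fun c => if s' c then 1 else 0) v)) m m' := by
  rw [edgeHom, if_pos h, Linear.smul_comp, Linear.comp_smul, Cob.poly_smul]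
  exact congrArg _ (Cob.cupOff_ofSurface_capOff (D.smoothing R r ε) (D.smoothing R (r + 1) ε')
    (D.saddle ε ε') (fun _ => rfl) s s' m m')

theorem poly_entry_deloopedD (r : ℤ) (p : Σ ε : D.VertexAt r, (D.Circles ε.1 → Bool))
    (p' : Σ ε : D.VertexAt (r + 1), (D.Circles ε.1 → Bool)) :
    Cob.poly (FreeMod.entry (D.deloopedD R r) p p') (GradedBasis.deg (D.deloopedBasis R r) p)
        (GradedBasis.deg (D.deloopedBasis R (r + 1)) p') =
      ∑ j, Cob.cupOff (D.smoothing R r p.1.1) p.2 (GradedBasis.deg (D.deloopedBasis R r) p) ≫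
        D.edgeHom R r p.1.1 p'.1.1 j ≫ Cob.capOff (D.smoothing R (r + 1) p'.1.1) p'.2
          (GradedBasis.deg (D.deloopedBasis R (r + 1)) p') := by
  have h := congrFun (congrFun (D.realize_deloopedD (R := R) r) p) p'
  have h1 := D.deloopKhInv_comp_apply (R := R) r _ (D.khD R r ≫ D.deloopKh R (r + 1)) p p'
  have h2 := D.comp_deloopKh_apply (R := R) (r + 1) _ (D.khD R r) p' p.1
  have h3 := D.deloopKhInv_self (R := R) r p.1 p.2
  have h4 := D.deloopKh_self (R := R) (r + 1) p'.1 p'.2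
  refine (h.trans h1).trans ?_
  rw [h2, h4, h3]
  refine Eq.trans ?_ (Preadditive.comp_sum _ _ _)
  exact congrArg _ (Preadditive.sum_comp _ _ _)

/-- Sum the boundary counts over the components: two circles on each, and one more on the pair of
pants. -/
theorem two_mul_card_saddle {ε ε' : D.Vertex} {j : Fin D.n}
    (h : ε j = false ∧ ε' = Function.update ε j true) :
    Fintype.card (D.Circles ε) + Fintype.card (D.Circles ε') =
      2 * Fintype.card (D.saddle ε ε').comp + 1 := by
  have h1 : ∑ d, _ = ∑ d, _ := Finset.sum_congr rfl fun d _ => D.card_bdry_saddle h.1 h.2 d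
  rw [Finset.sum_add_distrib, Finset.sum_add_distrib, sum_fiberSum, sum_fiberSum,
    sum_fiberSum] at h1
  simpa [mul_comm] using h1

/-- An even number of boxes on one component kills the product. Otherwise each component with `n`
boxes gives `t^((n-1)/2)`, and the total number of boxes is twice the exponent of `t` plus the
number of components. The count determines the degree of an entry. -/
theorem prod_boxPoly {V : Type} [Fintype V] (n : V → ℕ) :
    ∏ v, Cob.boxPoly R (n v) = 0 ∨
      (∏ v, Cob.boxPoly R (n v) = tPoly R ^ ∑ v, n v / 2) ∧
        ∑ v, n v = 2 * ∑ v, n v / 2 + Fintype.card V := by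
  by_cases h : ∃ v, Even (n v)
  · obtain ⟨v, hv⟩ := h
    exact Or.inl (Finset.prod_eq_zero (Finset.mem_univ v) (if_pos hv))
  · simp only [not_exists] at h
    refine Or.inr ⟨?_, ?_⟩
    · rw [← Finset.prod_pow_eq_pow_sum]
      exact Finset.prod_congr rfl fun v _ => if_neg (h v)
    · rw [Fintype.card_eq_sum_ones, Finset.mul_sum, ← Finset.sum_add_distrib]
      refine Finset.sum_congr rfl fun v _ => ?_
      have := Nat.odd_iff.1 (Nat.not_even_iff_odd.1 (h v))
      omega

/-- The entries of the differentials of the delooped complex are monomials. -/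
theorem entry_deloopedD (r : ℤ) (p : Σ ε : D.VertexAt r, (D.Circles ε.1 → Bool))
    (p' : Σ ε : D.VertexAt (r + 1), (D.Circles ε.1 → Bool)) :
    FreeMod.entry (D.deloopedD R r) p p' = 0 ∨
      ∃ (z : ℤ) (k : ℕ), FreeMod.entry (D.deloopedD R r) p p' = (z : R[X]) * tPoly R ^ k ∧
        GradedBasis.deg (D.deloopedBasis R (r + 1)) p' =
          GradedBasis.deg (D.deloopedBasis R r) p + 4 * k := by
  have hp := D.poly_entry_deloopedD (R := R) r p p'
  obtain ⟨ε, s⟩ := p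
  obtain ⟨ε', s'⟩ := p'
  by_cases h : ∃ j, ε.1 j = false ∧ ε'.1 = Function.update ε.1 j true
  · obtain ⟨j, hj⟩ := h
    -- An edge of the cube changes only one crossing, so a single term of the sum survives.
    rw [Fintype.sum_eq_single j, D.cupOff_edgeHom_capOff r hj] at hp
    · have hp := Cob.poly_injective _ _ hp
      rcases prod_boxPoly (R := R) (fun v =>
        fiberSum ((D.saddle ε.1 ε'.1).bdry ∘ Sum.inl) (fun c => if s c then 0 else 1) v +
          fiberSum ((D.saddle ε.1 ε'.1).bdry ∘ Sum.inr) (fun c => if s' c then 1 else 0) v)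
        with h0 | ⟨h1, h2⟩
      · rw [h0, smul_zero] at hp
        exact Or.inl hp
      · refine Or.inr ⟨(-1) ^ (Finset.card {i | i < j ∧ ε.1 i = true}),
          ∑ v, (fiberSum ((D.saddle ε.1 ε'.1).bdry ∘ Sum.inl) (fun c => if s c then 0 else 1) v +
            fiberSum ((D.saddle ε.1 ε'.1).bdry ∘ Sum.inr) (fun c => if s' c then 1 else 0) v) / 2,
          ?_, ?_⟩
        · rw [h1] at hp
          refine hp.trans ?_
          rw [Polynomial.smul_eq_C_mul, edgeSign]
          simp
        · change r + 1 + D.nPos - D.nNeg + ∑ c, Cob.signDeg (s' c) =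
            r + D.nPos - D.nNeg + ∑ c, Cob.signDeg (s c) + _
          rw [Cob.sum_signDeg, Cob.sum_signDeg']
          rw [Finset.sum_add_distrib, sum_fiberSum, sum_fiberSum] at h2
          -- With `B` boxes, the label grows by 1 from the homological shift and by `2B` minus the
          -- number of circles from the signs. As `B = 2k + V` and the number of circles is `2V + 1`
          -- for `V` components, the total is `4k`.
          have h3 := D.two_mul_card_saddle hj
          omega
    · intro j' hj'
      have : ¬ (ε.1 j' = false ∧ ε'.1 = Function.update ε.1 j' true) := by
        rintro ⟨-, h⟩
        have := congrFun (hj.2.symm.trans h) j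
        rw [Function.update_self, Function.update_of_ne hj'.symm, hj.1] at this
        exact Bool.noConfusion this
      rw [edgeHom, if_neg this, Limits.zero_comp, Limits.comp_zero]
  · left
    refine Cob.poly_injective _ _ (hp.trans ?_)
    refine (Finset.sum_eq_zero fun j _ => ?_).trans (Cob.poly_zero _ _).symm
    rw [edgeHom, if_neg fun hj => h ⟨j, hj⟩, Limits.zero_comp, Limits.comp_zero]

/-- Delooping as an isomorphism of complexes. -/
noncomputable def khIso (R : Type u) [CommRing R] [Invertible (2 : R)] :
    D.kh R D.khD_comp_khD ≅ ((FreeMod.realize R).mapHomologicalComplex (ComplexShape.up ℤ)).obj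
      (CochainComplex.of (D.deloopedBasis R) (D.deloopedD R) D.deloopedD_comp_deloopedD) :=
  HomologicalComplex.Hom.isoOfComponents (fun r => D.deloopKhIso R r) (by
    rintro r _ rfl
    have h1 : (D.kh R D.khD_comp_khD).d r (r + 1) = D.khD R r := CochainComplex.of_d _ _ _
    have h2 : (CochainComplex.of (D.deloopedBasis R) (D.deloopedD R)
      D.deloopedD_comp_deloopedD).d r (r + 1) = D.deloopedD R r := CochainComplex.of_d _ _ _
    have h3 : D.deloopKh R r ≫ (FreeMod.realize R).map (D.deloopedD R r) =
        D.khD R r ≫ D.deloopKh R (r + 1) := by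
      rw [realize_deloopedD, reassoc_of% (D.deloopKh_deloopKhInv (R := R) r)]
    rw [h1, Functor.mapHomologicalComplex_obj_d, h2]
    exact h3)

end LinkDiagram
end CobL

/-! ### The pairs of pants and the single circle -/

namespace CobL

variable {R : Type u} [CommRing R] [Invertible (2 : R)]

namespace Cob

theorem deloop_ofSurface_apply (X Y : Cob R) (A : Surface (X.circles ⊕ Y.circles))
    (hA : ∀ v, A.genus v = 0) (s : X.circles → Bool) (s' : Y.circles → Bool) :
    (deloopInv X ≫ (Mat_.embedding (Cob R)).map (ofSurface X Y A) ≫ deloopHom Y) s s' =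
      poly (∏ v, boxPoly R (fiberSum (A.bdry ∘ Sum.inl) (fun c => if s c then 0 else 1) v +
        fiberSum (A.bdry ∘ Sum.inr) (fun c => if s' c then 1 else 0) v)) _ _ := by
  refine Eq.trans ?_ (cupOff_ofSurface_capOff X Y A hA s s' _ _)
  refine ((Mat_.comp_apply _ _ _ _).trans (Fintype.sum_unique (ι := PUnit) _)).trans ?_
  exact congrArg (cupOff X s _ ≫ ·)
    ((Mat_.comp_apply _ _ _ _).trans (Fintype.sum_unique (ι := PUnit) _))

/-- The pair of pants closes up to a single sphere, with one box for each `v₋` among the inputs and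
one for an output `v₊`. The values of spheres with 0, 1, 2, 3 boxes are 0, 1, 0, `t`, which is the
multiplication table. -/
theorem deloop_merge (a b c : Bool) :
    (deloopInv (twoCircles R) ≫ (Mat_.embedding (Cob R)).map (merge R) ≫
      deloopHom (circle R)) (![a, b] : Fin 2 → Bool) (fun _ : Unit => c) =
      poly (leeMul R a b c) _ _ := by
  refine (deloop_ofSurface_apply (twoCircles R) (circle R) ⟨Unit, fun _ => (), fun _ => 0⟩
    (fun _ => rfl) (![a, b] : Fin 2 → Bool) fun _ : Unit => c).trans ?_
  refine congrArg (poly · _ _) ((Fintype.prod_unique (ι := Unit) _).trans ?_)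
  have e : fiberSum (fun _ : Fin 2 => ()) (fun i => if (![a, b] : Fin 2 → Bool) i then 0 else 1) () +
      fiberSum (fun _ : Unit => ()) (fun _ => if c then 1 else 0) () =
      (if a then 0 else 1) + (if b then 0 else 1) + if c then 1 else 0 := by
    rw [fiberSum_eq, fiberSum_eq, Fin.sum_univ_two]
    cases a <;> cases b <;> cases c <;> rfl
  refine (congrArg (boxPoly R) e).trans ?_
  cases a <;> cases b <;> cases c <;> simp [boxPoly, leeMul, Nat.even_iff]

theorem deloop_split (a b c : Bool) :
    (deloopInv (circle R) ≫ (Mat_.embedding (Cob R)).map (split R) ≫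
      deloopHom (twoCircles R)) (fun _ : Unit => a) (![b, c] : Fin 2 → Bool) =
      poly (leeComul R a b c) _ _ := by
  refine (deloop_ofSurface_apply (circle R) (twoCircles R) ⟨Unit, fun _ => (), fun _ => 0⟩
    (fun _ => rfl) (fun _ : Unit => a) (![b, c] : Fin 2 → Bool)).trans ?_
  refine congrArg (poly · _ _) ((Fintype.prod_unique (ι := Unit) _).trans ?_)
  have e : fiberSum (fun _ : Unit => ()) (fun _ => if a then 0 else 1) () +
      fiberSum (fun _ : Fin 2 => ()) (fun i => if (![b, c] : Fin 2 → Bool) i then 1 else 0) () =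
      (if a then 0 else 1) + ((if b then 1 else 0) + if c then 1 else 0) := by
    rw [fiberSum_eq, fiberSum_eq, Fin.sum_univ_two]
    cases a <;> cases b <;> cases c <;> rfl
  refine (congrArg (boxPoly R) e).trans ?_
  cases a <;> cases b <;> cases c <;> simp [boxPoly, leeComul, Nat.even_iff]

theorem isDegreeZero_deloopHom (X : Cob R) : IsDegreeZero (deloopHom X) :=
  fun _ s => capOff_mem X s _ rfl

theorem isDegreeZero_deloopInv (X : Cob R) : IsDegreeZero (deloopInv X) :=
  fun s _ => cupOff_mem X s _ rfl

/-- Delooping the circle. -/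
noncomputable def circleHom (R : Type u) [CommRing R] [Invertible (2 : R)] :
    circleColumn R ⟶ column R :=
  fun _ b => capOff (circle R) (fun _ => b) (signDeg b)

/-- The inverse of delooping the circle. -/
noncomputable def circleInv (R : Type u) [CommRing R] [Invertible (2 : R)] :
    column R ⟶ circleColumn R :=
  fun b _ => cupOff (circle R) (fun _ => b) (signDeg b)

theorem circleHom_circleInv : circleHom R ≫ circleInv R = 𝟙 _ := by
  let _ : DecidableEq (circle R).circles := inferInstanceAs (DecidableEq Unit)
  refine Mat_.hom_ext _ _ fun i j => ?_
  cases i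
  cases j
  refine (Mat_.comp_apply _ _ _ _).trans (Eq.trans ?_
    (Mat_.id_apply_self (circleColumn R) PUnit.unit).symm)
  have h := sum_capOff_cupOff (circle R) (fun s => signDeg (s ()))
  refine Eq.trans ?_ h
  -- The column is indexed by signs, not by maps from the one circle to signs.
  exact (Fintype.sum_equiv (Equiv.funUnique Unit Bool) _ (fun b => capOff (circle R)
    (fun _ => b) (signDeg b) ≫ cupOff (circle R) (fun _ => b) (signDeg b)) fun s => rfl).symm

theorem circleInv_circleHom : circleInv R ≫ circleHom R = 𝟙 _ := by
  classical
  refine Mat_.hom_ext _ _ fun i j => ?_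
  refine ((Mat_.comp_apply _ _ _ _).trans (Fintype.sum_unique (ι := PUnit) _)).trans ?_
  by_cases h : i = j
  · subst h
    exact (cupOff_capOff (circle R) (fun _ => i) (fun _ => i) _ _).trans <|
      (congrArg (poly · _ _) (if_pos rfl)).trans <|
        (poly_one _).trans (Mat_.id_apply_self (column R) i).symm
  · exact (cupOff_capOff (circle R) (fun _ => i) (fun _ => j) _ _).trans <|
      (congrArg (poly · _ _) (if_neg fun hh => h (congrFun hh ()))).trans <|
        (poly_zero _ _).trans (Mat_.id_apply_of_ne (column R) i j h).symm

end Cob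

end CobL

theorem mainTheorem4 {R : Type*} [CommRing R] [Invertible (2 : R)] :
    -- The circle is isomorphic to the column `[∅{-1}, ∅{+1}]`.
    (∃ e : CobL.Cob.circleColumn R ≅ CobL.Cob.column R,
      (e.hom = fun _ b => CobL.Cob.capOff (CobL.Cob.circle R) (fun _ => b) (CobL.Cob.signDeg b)) ∧
      (e.inv = fun b _ => CobL.Cob.cupOff (CobL.Cob.circle R) (fun _ => b) (CobL.Cob.signDeg b)) ∧
      CobL.Cob.IsDegreeZero e.hom ∧ CobL.Cob.IsDegreeZero e.inv) ∧
    -- Any finite union of circles can be delooped in the same way.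
    (∀ X : CobL.Cob R, ∃ e : (Mat_.embedding (CobL.Cob R)).obj X ≅ CobL.Cob.delooped X,
      e.hom = CobL.Cob.deloopHom X ∧ e.inv = CobL.Cob.deloopInv X ∧
      CobL.Cob.IsDegreeZero e.hom ∧ CobL.Cob.IsDegreeZero e.inv) ∧
    -- Morphisms between columns of empty sets are the same as maps of free `R[T]`-modules.
    ((CobL.FreeMod.realize R).Full ∧ (CobL.FreeMod.realize R).Faithful) ∧
    -- The complex of a link is isomorphic to a complex of free `R[T]`-modules.
    (∀ D : CobL.LinkDiagram,
      ∃ (hd : ∀ r, D.khD R r ≫ D.khD R (r + 1) = 0)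
        (δ : ∀ r, D.deloopedBasis R r ⟶ D.deloopedBasis R (r + 1))
        (hδ : ∀ r, δ r ≫ δ (r + 1) = 0)
        (e : D.kh R hd ≅
          ((CobL.FreeMod.realize R).mapHomologicalComplex (ComplexShape.up ℤ)).obj
            (CochainComplex.of (D.deloopedBasis R) δ hδ)),
        (∀ r, e.hom.f r = D.deloopKh R r) ∧
        (∀ r, CobL.Cob.IsDegreeZero (e.hom.f r) ∧ CobL.Cob.IsDegreeZero (e.inv.f r)) ∧
        (∀ r i j, CobL.FreeMod.entry (δ r) i j = 0 ∨
          ∃ (z : ℤ) (k : ℕ), CobL.FreeMod.entry (δ r) i j = (z : R[X]) * CobL.tPoly R ^ k ∧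
            CobL.GradedBasis.deg (D.deloopedBasis R (r + 1)) j =
              CobL.GradedBasis.deg (D.deloopedBasis R r) i + 4 * k)) ∧
    -- The pairs of pants become the generalized Lee structure.
    (∀ a b c : Bool,
      (CobL.Cob.deloopInv (CobL.Cob.twoCircles R) ≫
          (Mat_.embedding (CobL.Cob R)).map (CobL.merge R) ≫
          CobL.Cob.deloopHom (CobL.Cob.circle R))
        (![a, b] : Fin 2 → Bool) (fun _ : Unit => c) = CobL.Cob.poly (CobL.leeMul R a b c) _ _) ∧
    (∀ a b c : Bool,
      (CobL.Cob.deloopInv (CobL.Cob.circle R) ≫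
          (Mat_.embedding (CobL.Cob R)).map (CobL.split R) ≫
          CobL.Cob.deloopHom (CobL.Cob.twoCircles R))
        (fun _ : Unit => a) (![b, c] : Fin 2 → Bool) = CobL.Cob.poly (CobL.leeComul R a b c) _ _) := by
  refine ⟨⟨⟨CobL.Cob.circleHom R, CobL.Cob.circleInv R, CobL.Cob.circleHom_circleInv, CobL.Cob.circleInv_circleHom⟩, rfl, rfl, fun _ b => ?_,
    fun b _ => ?_⟩, fun X => ⟨CobL.Cob.deloopIso X, rfl, rfl, CobL.Cob.isDegreeZero_deloopHom X,
      CobL.Cob.isDegreeZero_deloopInv X⟩,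
    ⟨CobL.FreeMod.realize_full, CobL.FreeMod.realize_faithful⟩,
    fun D => ⟨D.khD_comp_khD, D.deloopedD R, D.deloopedD_comp_deloopedD, D.khIso R,
      fun r => rfl, fun r => ⟨D.isDegreeZero_deloopKh r, D.isDegreeZero_deloopKhInv r⟩,
      D.entry_deloopedD⟩,
    CobL.Cob.deloop_merge, CobL.Cob.deloop_split⟩
  · exact CobL.Cob.capOff_mem (CobL.Cob.circle R) (fun _ => b) _
      (by change _ = 0 + ∑ _ : Unit, CobL.Cob.signDeg b; simp)
  · exact CobL.Cob.cupOff_mem (CobL.Cob.circle R) (fun _ => b) _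
      (by change _ = 0 + ∑ _ : Unit, CobL.Cob.signDeg b; simp)
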